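/- **Setting.** Let $H$ be a real Hilbert space with scalar product $\langle\cdot,\cdot\rangle$ and norm $|\cdot|$, and let $A:D(A)\subset H\to H$ satisfy (A1) $A$ is self-adjoint and nonnegative, has a compact resolvent, and $|Au|\ge\omega|u|$ on $D(A)$ for some $\omega>0$. For $k\in\mathbb N$ let $H_k=D(A^{k/2})$ with norm $|u|_k=|A^{k/2}u|$, and let $H_{-k}=H_k'$ be its dual with respect to the pivot space $H_0=H$, with norm $|u|_{-k}=|A^{-k/2}u|$. For $k\in\mathbb Z$ put $e_k(u,u')=\frac12\big(|A^{k/2}u|^2+|A^{(k-1)/2}u'|^2\big)$. A *strong solution* on $[0,T]$ of $w''+Aw=f$ with $f\in C([0,T];H)$ is a solution with $w\in C([0,T];H_2)\cap C^1([0,T];H_1)\cap C^2([0,T];H)$; write $W=(w,w')$. Let $n\ge2$, $p\ge1$, let $C_{ij},\Pi_i\in\mathcal L(H)$, and let $G_n,\dots,G_{n+p}$ be real Hilbert spaces. Assume: (A2) for $2\le i\le n$: $C_{i,i-1}^*\in\mathcal L(H_k)$ for $0\le k\le n-i+1$; $|C_{i,i-1}w|^2\le\|C_{i,i-1}\|\,\langle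 C_{i,i-1}w,w\rangle$ for all $w\in H$; and there is $\alpha_i>0$ with $\alpha_i|\Pi_iw|^2\le\langle C_{i,i-1}w,w\rangle$ for all $w\in H$; (A3) for $2\le i\le n$ there is $T_{0,i}>0$ such that for every $T>T_{0,i}$ there is $\gamma_i(T)>0$ with $\int_0^T|\Pi_iw'|^2dt\ge\gamma_i(T)\,e_1(W)(0)$ for all strong solutions of $w''+Aw=0$; (C) $C_{ij},C_{ij}^*\in\mathcal L(H_k)$ for $k=0,1$, $n+1\le i\le n+p$, $n-1\le j\le i-1$. For an operator $\mathbf B^*\in\mathcal L(H_2\times H;G)$ consider the conditions: (A4) for every $T>0$ there is $D(T)>0$ such that all strong solutions of $w''+Aw=f$ satisfy $$\int_0^T\|\mathbf B^*W\|_G^2dt\le D(T)\Big(e_1(W)(0)+e_1(W)(T)+\int_0^Te_1(W)dt+\int_0^T|f|^2dt\Big);$$ (A5) there is $T_0>0$ such that for every $T>T_0$ there is $R(T)>0$ with $\int_0^T\|\mathbf B^*W\|_G^2dt\ge R(T)\,e_1(W)(0)$ for all strong solutions of $w''+Aw=0$. The *observed system* is $$u_1''+Au_1=0,\qquad u_i''+Au_i+C_{i,i-1}u_{i-1}=0\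 (2\le i\le n),\qquad u_i''+Au_i+\sum_{k=n-1}^{i-1}C_{ik}u_k=0\ (n+1\le i\le n+p).$$ Given $\mathbf B_n^*,\dots,\mathbf B_{n+p}^*$, a number $T^*>0$ is called an *observability time* if for every $T>T^*$ there are constants $d_i,\rho_k>0$ such that all strong solutions of this system, with $U_i=(u_i,u_i')$, satisfy $$e_{1+i-n}(U_i)(0)\le d_i\int_0^T\|\mathbf B_n^*U_n\|^2dt\ (1\le i\le n),\qquad e_1(U_{n+k})(0)\le\rho_k\sum_{l=0}^k\int_0^T\|\mathbf B_{n+l}^*U_{n+l}\|^2dt\ (1\le k\le p).$$ The *control system* is $$\begin{cases}y_i''+Ay_i+C_{i+1,i}^*y_{i+1}=0,&1\le i\le n-2,\\ y_{n-1}''+Ay_{n-1}+\sum_{k=n}^{n+p}C_{k,n-1}^*y_k=0,\\ y_i''+Ay_i+\sum_{k=i+1}^{n+p}C_{ki}^*y_k=B_iv_i,&n\le i\le n+p,\\ (y_i,y_i')(0)=(y_i^0,y_i^1),&1\le i\le n+p,\end{cases}$$ (the first line is absent if $n=2$, the sum is empty for $i=n+p$). For $v_k\in L^2((0,T);G_k)$,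 its solution with data $Y_0=(y_i^0,y_i^1)_i$ in a space $M^*$ below is understood by transposition: it is a function $Y=(y_i,y_i')_i\in C([0,T];M^*)$ with $Y(0)=Y_0$ such that, for every strong solution $(w_i)$ of the observed system on $[0,T]$ and every $\tau\in[0,T]$, $$\sum_{i=1}^{n+p}\Big[\langle y_i'(\tau),w_i(\tau)\rangle-\langle y_i(\tau),w_i'(\tau)\rangle\Big]-\sum_{i=1}^{n+p}\Big[\langle y_i^1,w_i(0)\rangle-\langle y_i^0,w_i'(0)\rangle\Big]=\sum_{k=n}^{n+p}\int_0^\tau\langle v_k,B_k^*w_k\rangle_{G_k}dt .$$ **Theorem.** Assume (A1), (A2), (A3) and (C). (i) (*Bounded controls.*) Let $B_{n+k}\in\mathcal L(G_{n+k},H)$ for $0\le k\le p$ be such that the operators $\mathbf B_{n+k}^*(w,w')=B_{n+k}^*w'$ satisfy (A4) and (A5), and let $$M^*_{-(n+p-1)}=\Big(\prod_{i=1}^nH_{n-i+1}\times H_1^p\Big)\times\Big(\prod_{i=1}^nH_{n-i}\times H^p\Big).$$ Then an observability time exists, and for every observability time $T^*_{n+p}$, every $T>T^*_{n+p}$ and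 every $Y_0\in M^*_{-(n+p-1)}$ there are controls $v_{n+k}\in L^2((0,T);G_{n+k})$, $0\le k\le p$, such that the control system has a solution by transposition in $C([0,T];M^*_{-(n+p-1)})$ with initial data $Y_0$, and every such solution satisfies $Y(T)=0$. (ii) (*Unbounded controls.*) Let $B_{n+k}\in\mathcal L(G_{n+k},H_2')$ for $0\le k\le p$ be such that the operators $\mathbf B_{n+k}^*(w,w')=B_{n+k}^*w$, with $B_{n+k}^*\in\mathcal L(H_2,G_{n+k})$, satisfy (A4) and (A5), and let $$M^*_{(n+p-1)}=\Big(\prod_{i=1}^nH_{n-i}\times H^p\Big)\times\Big(\prod_{i=1}^nH_{n-i-1}\times H_{-1}^p\Big).$$ Then the same conclusion holds with $M^*_{(n+p-1)}$ in place of $M^*_{-(n+p-1)}$: an observability time exists, and for every observability time $T^*_{n+p}$, every $T>T^*_{n+p}$ and every $Y_0\in M^*_{(n+p-1)}$ there are controls $v_{n+k}\in L^2((0,T);G_{n+k})$ such that the control system has a solution by transposition in $C([0,T];M^*_{(n+p-1)})$ with initial data $Y_0$, and every such solution satisfies $Y(T)=0$. -/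

import Mathlib

noncomputable section

namespace Cascade

section Scale

variable {H : Type*} [NormedAddCommGroup H] [InnerProductSpace ℝ H] [CompleteSpace H]

/-- The standing assumption on the operator `A : D(A) ⊂ H → H`: it is self-adjoint (in particular
densely defined), nonnegative, bounded below by some `ω > 0`, and has a compact resolvent. -/
structure HypA1 (A : H →ₗ.[ℝ] H) : Prop where
  selfAdjoint : IsSelfAdjoint A
  nonneg : ∀ u : A.domain, 0 ≤ inner ℝ (A u) (u : H)
  bddBelow : ∃ ω : ℝ, 0 < ω ∧ ∀ u : A.domain, ω * ‖(u : H)‖ ≤ ‖A u‖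
  compactResolvent : ∃ (z : ℝ) (R : H →L[ℝ] H), IsCompactOperator R ∧
    (∀ x : H, ∃ h : R x ∈ A.domain, A ⟨R x, h⟩ - z • R x = x) ∧
    (∀ u : A.domain, R (A u - z • (u : H)) = u)

/-- The eigenspace `{u ∈ D(A) | A u = μ u}`. -/
def eigenspace (A : H →ₗ.[ℝ] H) (μ : ℝ) : Submodule ℝ H :=
  (LinearMap.ker (A.toFun - μ • A.domain.subtype)).map A.domain.subtype

theorem mem_eigenspace (A : H →ₗ.[ℝ] H) (μ : ℝ) (u : H) :
    u ∈ eigenspace A μ ↔ ∃ h : u ∈ A.domain, A ⟨u, h⟩ = μ • u := by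
  constructor
  · rintro ⟨x, hx, rfl⟩
    refine ⟨x.2, ?_⟩
    have hx' : A.toFun x - μ • (x : H) = 0 := by simpa using hx
    exact sub_eq_zero.mp hx'
  · rintro ⟨h, hu⟩
    refine ⟨⟨u, h⟩, ?_, rfl⟩
    have : A.toFun ⟨u, h⟩ - μ • u = 0 := sub_eq_zero.mpr hu
    simpa using this

/-- The spectral projection of `A` at `μ`: the orthogonal projection onto the (closed) eigenspace;
it vanishes when `μ` is not an eigenvalue. -/
def specProj (A : H →ₗ.[ℝ] H) (μ : ℝ) : H →L[ℝ] H :=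
  (eigenspace A μ).topologicalClosure.starProjection

/-- `|u|_k² = |A^{k/2} u|² = ∑_μ μ^k ‖P_μ u‖²`, for `k ∈ ℤ`, by the spectral calculus of the
positive operator `A` with compact resolvent, whose eigenspaces span `H`. Only eigenvalues
`μ > 0` contribute, so that the absolute value is immaterial. -/
def powNormSq (A : H →ₗ.[ℝ] H) (k : ℤ) (u : H) : ℝ :=
  ∑' μ : ℝ, |μ| ^ k * ‖specProj A μ u‖ ^ 2

/-- The energy of level `k`, `e_k(u, u') = (|A^{k/2} u|² + |A^{(k-1)/2} u'|²) / 2`. -/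
def energy (A : H →ₗ.[ℝ] H) (k : ℤ) (u u' : H) : ℝ :=
  (powNormSq A k u + powNormSq A (k - 1) u') / 2

theorem specSummable_mul {a b c d : ℝ → ℝ} (hc : ∀ μ, 0 ≤ c μ)
    (ha : Summable fun μ => c μ * a μ ^ 2) (hb : Summable fun μ => c μ * b μ ^ 2)
    (hd : ∀ μ, |d μ| ≤ |a μ| * |b μ|) : Summable fun μ => c μ * d μ := by
  refine Summable.of_norm_bounded (ha.add hb) fun μ => ?_
  rw [Real.norm_eq_abs, abs_mul, abs_of_nonneg (hc μ), ← mul_add]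
  refine mul_le_mul_of_nonneg_left ((hd μ).trans ?_) (hc μ)
  nlinarith [sq_nonneg (|a μ| - |b μ|), sq_abs (a μ), sq_abs (b μ), sq_nonneg (a μ),
    sq_nonneg (b μ)]

/-- The domain `D(A^{k/2}) = {u ∈ H | ∑_μ μ^k ‖P_μ u‖² < ∞}`, for `k ∈ ℕ`. -/
def powDomain (A : H →ₗ.[ℝ] H) (k : ℕ) : Submodule ℝ H where
  carrier := {u | Summable fun μ : ℝ => |μ| ^ k * ‖specProj A μ u‖ ^ 2}
  zero_mem' := by simp
  add_mem' := by
    intro u v hu hv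
    simp only [Set.mem_ofPred_eq] at hu hv ⊢
    refine Summable.of_nonneg_of_le (fun μ => by positivity) (fun μ => ?_)
      ((hu.mul_left 2).add (hv.mul_left 2))
    have h1 : ‖specProj A μ (u + v)‖ ≤ ‖specProj A μ u‖ + ‖specProj A μ v‖ := by
      rw [map_add]; exact norm_add_le _ _
    have h2 : ‖specProj A μ (u + v)‖ ^ 2
        ≤ 2 * ‖specProj A μ u‖ ^ 2 + 2 * ‖specProj A μ v‖ ^ 2 := by
      nlinarith [norm_nonneg (specProj A μ (u + v)), norm_nonneg (specProj A μ u),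
        norm_nonneg (specProj A μ v), sq_nonneg (‖specProj A μ u‖ - ‖specProj A μ v‖)]
    have h3 : (0 : ℝ) ≤ |μ| ^ k := by positivity
    nlinarith [mul_le_mul_of_nonneg_left h2 h3]
  smul_mem' := by
    intro c u hu
    simp only [Set.mem_ofPred_eq] at hu ⊢
    refine (hu.mul_left (c ^ 2)).congr fun μ => ?_
    rw [map_smul, norm_smul, mul_pow, Real.norm_eq_abs, sq_abs]
    ring

/-- The space `H_k = D(A^{k/2})`, `k ∈ ℕ`, a type of its own since it does not carry the norm
of `H` but `|u|_k = |A^{k/2} u|`. -/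
def HSp (A : H →ₗ.[ℝ] H) (k : ℕ) : Type _ := powDomain A k

instance (A : H →ₗ.[ℝ] H) (k : ℕ) : AddCommGroup (HSp A k) :=
  inferInstanceAs (AddCommGroup (powDomain A k))

instance (A : H →ₗ.[ℝ] H) (k : ℕ) : Module ℝ (HSp A k) :=
  inferInstanceAs (Module ℝ (powDomain A k))

/-- The inclusion `H_k ⊂ H`. -/
def HSp.val {A : H →ₗ.[ℝ] H} {k : ℕ} : HSp A k →ₗ[ℝ] H := (powDomain A k).subtype

theorem HSp.summable {A : H →ₗ.[ℝ] H} {k : ℕ} (u : HSp A k) :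
    Summable fun μ : ℝ => |μ| ^ k * ‖specProj A μ (HSp.val u)‖ ^ 2 := u.2

theorem HSp.summable_inner {A : H →ₗ.[ℝ] H} {k : ℕ} (u v : HSp A k) :
    Summable fun μ : ℝ =>
      |μ| ^ k * inner ℝ (specProj A μ (HSp.val u)) (specProj A μ (HSp.val v)) := by
  refine specSummable_mul (a := fun μ => ‖specProj A μ (HSp.val u)‖)
    (b := fun μ => ‖specProj A μ (HSp.val v)‖) (fun μ => by positivity) u.summable v.summable
    fun μ => ?_
  simpa using abs_real_inner_le_norm (specProj A μ (HSp.val u)) (specProj A μ (HSp.val v))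

/-- The scalar product `⟨A^{k/2} u, A^{k/2} v⟩ = ∑_μ μ^k ⟨P_μ u, P_μ v⟩` of `H_k`. -/
@[reducible]
def HSp.core (A : H →ₗ.[ℝ] H) (k : ℕ) : PreInnerProductSpace.Core ℝ (HSp A k) where
  inner u v := ∑' μ : ℝ,
    |μ| ^ k * inner ℝ (specProj A μ (HSp.val u)) (specProj A μ (HSp.val v))
  conj_inner_symm u v := by
    simp only [conj_trivial]
    exact tsum_congr fun μ => by rw [real_inner_comm]
  re_inner_nonneg u := by
    simp only [RCLike.re_to_real]
    exact tsum_nonneg fun μ => mul_nonneg (by positivity) real_inner_self_nonneg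
  add_left u v w := by
    rw [← (HSp.summable_inner u w).tsum_add (HSp.summable_inner v w)]
    exact tsum_congr fun μ => by rw [map_add, map_add, inner_add_left, mul_add]
  smul_left u v r := by
    simp only [conj_trivial]
    rw [← tsum_mul_left]
    exact tsum_congr fun μ => by rw [map_smul, map_smul, real_inner_smul_left]; ring

instance (A : H →ₗ.[ℝ] H) (k : ℕ) : SeminormedAddCommGroup (HSp A k) :=
  @InnerProductSpace.Core.toSeminormedAddCommGroup ℝ (HSp A k) _ _ _ (HSp.core A k)

instance (A : H →ₗ.[ℝ] H) (k : ℕ) : InnerProductSpace ℝ (HSp A k) :=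
  InnerProductSpace.ofCore (HSp.core A k)

theorem HSp.norm_sq {A : H →ₗ.[ℝ] H} {k : ℕ} (u : HSp A k) :
    ‖u‖ ^ 2 = powNormSq A k (HSp.val u) := by
  rw [← real_inner_self_eq_norm_sq]
  exact tsum_congr fun μ => by rw [real_inner_self_eq_norm_sq, zpow_natCast]

/-- The inclusion `H_2 ⊂ H_1`. -/
def HSp.toOne {A : H →ₗ.[ℝ] H} (hA : HypA1 A) (u : HSp A 2) : HSp A 1 :=
  ⟨HSp.val u, by
    obtain ⟨ω, hω, h⟩ := hA.bddBelow
    change Summable fun μ : ℝ => |μ| ^ 1 * ‖specProj A μ (HSp.val u)‖ ^ 2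
    refine Summable.of_nonneg_of_le (fun μ => by positivity) (fun μ => ?_)
      (u.summable.mul_left ω⁻¹)
    by_cases hb : eigenspace A μ = ⊥
    · have : specProj A μ (HSp.val u) = 0 := by
        have hmem : specProj A μ (HSp.val u) ∈ (eigenspace A μ).topologicalClosure :=
          Submodule.starProjection_apply_mem _ _
        rw [hb] at hmem
        have hcl : (⊥ : Submodule ℝ H).topologicalClosure = ⊥ :=
          IsClosed.submodule_topologicalClosure_eq (by simp)
        rw [hcl] at hmem
        simpa using hmem
      simp [this]
    · obtain ⟨x, hx, hx0⟩ := Submodule.exists_mem_ne_zero_of_ne_bot hb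
      obtain ⟨hd, hx⟩ := (mem_eigenspace A μ x).mp hx
      have h1 := h ⟨x, hd⟩
      rw [hx, norm_smul, Real.norm_eq_abs] at h1
      have h2 : ω ≤ |μ| := le_of_mul_le_mul_right h1 (norm_pos_iff.mpr hx0)
      have h3 : |μ| ^ 1 ≤ ω⁻¹ * |μ| ^ 2 := by
        rw [inv_mul_eq_div, le_div_iff₀ hω]
        nlinarith [abs_nonneg μ]
      calc |μ| ^ 1 * ‖specProj A μ (HSp.val u)‖ ^ 2
          ≤ (ω⁻¹ * |μ| ^ 2) * ‖specProj A μ (HSp.val u)‖ ^ 2 := by gcongr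
        _ = _ := by ring⟩

/-- `L ∈ 𝓛(H_k)`: the bounded operator `L` of `H` restricts to a bounded operator of `H_k`. -/
def BoundedOn (A : H →ₗ.[ℝ] H) (k : ℕ) (L : H →L[ℝ] H) : Prop :=
  ∃ L' : HSp A k →L[ℝ] HSp A k, ∀ u, HSp.val (L' u) = L (HSp.val u)

end Scale

section Hypotheses

variable {H : Type*} [NormedAddCommGroup H] [InnerProductSpace ℝ H] [CompleteSpace H]

/-- `(w, w')` is a strong solution on `[0, T]` of `w'' + A w = f`:
`w ∈ C([0,T]; H_2) ∩ C¹([0,T]; H_1) ∩ C²([0,T]; H)` when `f ∈ C([0,T]; H)`. -/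
structure IsStrongSol (A : H →ₗ.[ℝ] H) (T : ℝ) (f : ℝ → H)
    (w : ℝ → HSp A 2) (w' : ℝ → HSp A 1) : Prop where
  source : ContinuousOn f (Set.Icc 0 T)
  cont : ContinuousOn w (Set.Icc 0 T)
  cont' : ContinuousOn w' (Set.Icc 0 T)
  deriv : ∀ t ∈ Set.Icc 0 T,
    HasDerivWithinAt (fun s => HSp.val (w s)) (HSp.val (w' t)) (Set.Icc 0 T) t
  eqn : ∀ t ∈ Set.Icc 0 T, ∃ h : HSp.val (w t) ∈ A.domain,
    HasDerivWithinAt (fun s => HSp.val (w' s)) (f t - A ⟨HSp.val (w t), h⟩) (Set.Icc 0 T) t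

/-- The assumptions on the couplings `C_{i,i-1}`, `2 ≤ i ≤ n`, with the operators `P i`
(written `Π_i` in mathematics). -/
def HypA2 (A : H →ₗ.[ℝ] H) (n : ℕ) (C : ℕ → ℕ → H →L[ℝ] H) (P : ℕ → H →L[ℝ] H) : Prop :=
  ∀ i ∈ Finset.Icc 2 n,
    (∀ k ≤ n - i + 1, BoundedOn A k (ContinuousLinearMap.adjoint (C i (i - 1)))) ∧
    (∀ w : H, ‖C i (i - 1) w‖ ^ 2 ≤ ‖C i (i - 1)‖ * inner ℝ (C i (i - 1) w) w) ∧
    ∃ α : ℝ, 0 < α ∧ ∀ w : H, α * ‖P i w‖ ^ 2 ≤ inner ℝ (C i (i - 1) w) w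

/-- Observability of the free equation `w'' + A w = 0` through `P i w'`, `2 ≤ i ≤ n`. -/
def HypA3 (A : H →ₗ.[ℝ] H) (n : ℕ) (P : ℕ → H →L[ℝ] H) : Prop :=
  ∀ i ∈ Finset.Icc 2 n, ∃ T₀ : ℝ, 0 < T₀ ∧ ∀ T > T₀, ∃ γ : ℝ, 0 < γ ∧
    ∀ w w', IsStrongSol A T (fun _ => 0) w w' →
      γ * energy A 1 (HSp.val (w 0)) (HSp.val (w' 0))
        ≤ ∫ t in (0 : ℝ)..T, ‖P i (HSp.val (w' t))‖ ^ 2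

/-- Admissibility of an observation operator `𝐁* ∈ 𝓛(H_2 × H; G)`. -/
def HypA4 (A : H →ₗ.[ℝ] H) {G : Type*} [NormedAddCommGroup G] [InnerProductSpace ℝ G]
    (Bs : HSp A 2 × H →L[ℝ] G) : Prop :=
  ∀ T > (0 : ℝ), ∃ D : ℝ, 0 < D ∧ ∀ f w w', IsStrongSol A T f w w' →
    ∫ t in (0 : ℝ)..T, ‖Bs (w t, HSp.val (w' t))‖ ^ 2
      ≤ D * (energy A 1 (HSp.val (w 0)) (HSp.val (w' 0))
        + energy A 1 (HSp.val (w T)) (HSp.val (w' T))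
        + (∫ t in (0 : ℝ)..T, energy A 1 (HSp.val (w t)) (HSp.val (w' t)))
        + ∫ t in (0 : ℝ)..T, ‖f t‖ ^ 2)

/-- Observability of the free equation `w'' + A w = 0` through `𝐁*(w, w')`. -/
def HypA5 (A : H →ₗ.[ℝ] H) {G : Type*} [NormedAddCommGroup G] [InnerProductSpace ℝ G]
    (Bs : HSp A 2 × H →L[ℝ] G) : Prop :=
  ∃ T₀ : ℝ, 0 < T₀ ∧ ∀ T > T₀, ∃ R : ℝ, 0 < R ∧
    ∀ w w', IsStrongSol A T (fun _ => 0) w w' →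
      R * energy A 1 (HSp.val (w 0)) (HSp.val (w' 0))
        ≤ ∫ t in (0 : ℝ)..T, ‖Bs (w t, HSp.val (w' t))‖ ^ 2

/-- The couplings of the last `p` equations: `C_{ij}, C_{ij}* ∈ 𝓛(H_k)`, `k = 0, 1`,
for `n + 1 ≤ i ≤ n + p` and `n - 1 ≤ j ≤ i - 1`. -/
def HypC (A : H →ₗ.[ℝ] H) (n p : ℕ) (C : ℕ → ℕ → H →L[ℝ] H) : Prop :=
  ∀ i ∈ Finset.Icc (n + 1) (n + p), ∀ j ∈ Finset.Icc (n - 1) (i - 1), ∀ k ≤ 1,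
    BoundedOn A k (C i j) ∧ BoundedOn A k (ContinuousLinearMap.adjoint (C i j))

end Hypotheses

section System

variable {H : Type*} [NormedAddCommGroup H] [InnerProductSpace ℝ H] [CompleteSpace H]

/-- The coupling term of the `i`-th equation of the observed mixed cascade system: none for
`i = 1`, `C_{i,i-1} u_{i-1}` for `2 ≤ i ≤ n`, and `∑_{k=n-1}^{i-1} C_{ik} u_k` for `i > n`. -/
def coupling (n : ℕ) (C : ℕ → ℕ → H →L[ℝ] H) (u : ℕ → H) (i : ℕ) : H :=
  if i ≤ 1 then 0
  else if i ≤ n then C i (i - 1) (u (i - 1))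
  else ∑ k ∈ Finset.Icc (n - 1) (i - 1), C i k (u k)

/-- Strong solutions `U = (u_1, …, u_{n+p}, u_1', …, u_{n+p}')` on `[0, T]` of the mixed cascade
system `u_1'' + A u_1 = 0`, `u_i'' + A u_i + C_{i,i-1} u_{i-1} = 0` (`2 ≤ i ≤ n`),
`u_i'' + A u_i + ∑_{k=n-1}^{i-1} C_{ik} u_k = 0` (`n+1 ≤ i ≤ n+p`). Only the components with
index in `{1, …, n+p}` matter. -/
def IsCascadeSol (A : H →ₗ.[ℝ] H) (n p : ℕ) (C : ℕ → ℕ → H →L[ℝ] H) (T : ℝ)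
    (u : ℕ → ℝ → HSp A 2) (u' : ℕ → ℝ → HSp A 1) : Prop :=
  ∀ i ∈ Finset.Icc 1 (n + p),
    IsStrongSol A T (fun t => - coupling n C (fun k => HSp.val (u k t)) i) (u i) (u' i)

/-- `Tstar` is an observability time for the mixed cascade system: for every `T > Tstar` the
solutions satisfy, with constants depending only on `T` and the data of the system,
`e_{1+i-n}(U_i)(0) ≤ d_i ∫_0^T ‖𝐁*_n U_n‖²` for `1 ≤ i ≤ n`, and
`e_1(U_{n+k})(0) ≤ ρ_k ∑_{l=0}^k ∫_0^T ‖𝐁*_{n+l} U_{n+l}‖²` for `1 ≤ k ≤ p`. -/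
def IsObsTime (A : H →ₗ.[ℝ] H) (n p : ℕ) (C : ℕ → ℕ → H →L[ℝ] H)
    {G : ℕ → Type*} [∀ k, NormedAddCommGroup (G k)] [∀ k, InnerProductSpace ℝ (G k)]
    (Bs : ∀ k, HSp A 2 × H →L[ℝ] G k) (Tstar : ℝ) : Prop :=
  ∀ T > Tstar, ∃ d ρ : ℕ → ℝ, (∀ i, 0 < d i) ∧ (∀ k, 0 < ρ k) ∧
    ∀ u u', IsCascadeSol A n p C T u u' →
      (∀ i ∈ Finset.Icc 1 n,
        energy A (1 + (i : ℤ) - (n : ℤ)) (HSp.val (u i 0)) (HSp.val (u' i 0))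
          ≤ d i * ∫ t in (0 : ℝ)..T, ‖Bs n (u n t, HSp.val (u' n t))‖ ^ 2) ∧
      (∀ k ∈ Finset.Icc 1 p,
        energy A 1 (HSp.val (u (n + k) 0)) (HSp.val (u' (n + k) 0))
          ≤ ρ k * ∑ l ∈ Finset.range (k + 1),
            ∫ t in (0 : ℝ)..T, ‖Bs (n + l) (u (n + l) t, HSp.val (u' (n + l) t))‖ ^ 2)

end System

section Bounded

variable {H : Type*} [NormedAddCommGroup H] [InnerProductSpace ℝ H] [CompleteSpace H]

/-- The observation `𝐁*(w, w') = B* w'` attached to a bounded control operator `B ∈ 𝓛(G, H)`. -/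
def obsBounded (A : H →ₗ.[ℝ] H) {G : Type*} [NormedAddCommGroup G] [InnerProductSpace ℝ G]
    [CompleteSpace G] (B : G →L[ℝ] H) : HSp A 2 × H →L[ℝ] G :=
  (ContinuousLinearMap.adjoint B).comp (ContinuousLinearMap.snd ℝ (HSp A 2) H)

/-- The state space `((∏_{i=1}^n H_{n-i+1}) × H_1^p) × ((∏_{i=1}^n H_{n-i}) × H^p)`:
the truncated difference `n - i` is `0` for `i ≥ n`. -/
abbrev StateBounded (A : H →ₗ.[ℝ] H) (n p : ℕ) : Type _ :=
  (∀ i : Finset.Icc 1 (n + p), HSp A (n - (i : ℕ) + 1)) ×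
    (∀ i : Finset.Icc 1 (n + p), HSp A (n - (i : ℕ)))

/-- The duality product `∑_i ⟨y_i', w_i⟩ - ∑_i ⟨y_i, w_i'⟩` of a state `Y = (y, y')` with the
state `(w, w')` of the adjoint system. -/
def pairingBounded {A : H →ₗ.[ℝ] H} {n p : ℕ} (Y : StateBounded A n p)
    (w : ℕ → HSp A 2) (w' : ℕ → HSp A 1) : ℝ :=
  (∑ i, inner ℝ (HSp.val (Y.2 i)) (HSp.val (w (i : ℕ))))
    - ∑ i, inner ℝ (HSp.val (Y.1 i)) (HSp.val (w' (i : ℕ)))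

/-- `Y = (y_1, …, y_{n+p}, y_1', …, y_{n+p}') ∈ C([0,T]; StateBounded)` is the solution by
transposition, with initial data `Y₀` and controls `v_n, …, v_{n+p}`, of the control system
`y_i'' + A y_i + C_{i+1,i}* y_{i+1} = 0` (`1 ≤ i ≤ n-2`),
`y_{n-1}'' + A y_{n-1} + ∑_{k=n}^{n+p} C_{k,n-1}* y_k = 0`,
`y_i'' + A y_i + ∑_{k=i+1}^{n+p} C_{ki}* y_k = B_i v_i` (`n ≤ i ≤ n+p`):
the identity obtained by integrating by parts against the solutions of the adjoint cascade
system holds on `[0, τ]` for every `τ ∈ [0, T]`. -/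
structure IsControlledBounded (A : H →ₗ.[ℝ] H) (n p : ℕ) (C : ℕ → ℕ → H →L[ℝ] H)
    {G : ℕ → Type*} [∀ k, NormedAddCommGroup (G k)] [∀ k, InnerProductSpace ℝ (G k)]
    [∀ k, CompleteSpace (G k)] (B : ∀ k, G k →L[ℝ] H) (T : ℝ) (v : ∀ k, ℝ → G k)
    (Y₀ : StateBounded A n p) (Y : ℝ → StateBounded A n p) : Prop where
  cont : ContinuousOn Y (Set.Icc 0 T)
  initial : Y 0 = Y₀
  transposition : ∀ w w', IsCascadeSol A n p C T w w' → ∀ τ ∈ Set.Icc 0 T,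
    pairingBounded (Y τ) (fun i => w i τ) (fun i => w' i τ)
        - pairingBounded Y₀ (fun i => w i 0) (fun i => w' i 0)
      = ∑ k ∈ Finset.Icc n (n + p), ∫ t in (0 : ℝ)..τ,
          inner ℝ (v k t) (ContinuousLinearMap.adjoint (B k) (HSp.val (w k t)))

end Bounded

section Unbounded

variable {H : Type*} [NormedAddCommGroup H] [InnerProductSpace ℝ H] [CompleteSpace H]

/-- The adjoint `B* ∈ 𝓛(H_2, G)` of `B ∈ 𝓛(G, H_2')`: `⟨B* w, g⟩_G = ⟨B g, w⟩`. -/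
def adjointUnbounded {A : H →ₗ.[ℝ] H} {G : Type*} [NormedAddCommGroup G]
    [InnerProductSpace ℝ G] [CompleteSpace G] (B : G →L[ℝ] StrongDual ℝ (HSp A 2)) :
    HSp A 2 →L[ℝ] G where
  toFun w := (InnerProductSpace.toDual ℝ G).symm (B.flip w)
  map_add' u v := by rw [map_add, map_add]
  map_smul' c u := by rw [map_smul, map_smulₛₗ]; simp
  cont := (InnerProductSpace.toDual ℝ G).symm.continuous.comp B.flip.continuous

theorem inner_adjointUnbounded {A : H →ₗ.[ℝ] H} {G : Type*} [NormedAddCommGroup G]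
    [InnerProductSpace ℝ G] [CompleteSpace G] (B : G →L[ℝ] StrongDual ℝ (HSp A 2))
    (w : HSp A 2) (g : G) : inner ℝ (adjointUnbounded B w) g = B g w := by
  change inner ℝ ((InnerProductSpace.toDual ℝ G).symm (B.flip w)) g = B g w
  rw [InnerProductSpace.toDual_symm_apply, ContinuousLinearMap.flip_apply]

/-- The observation `𝐁*(w, w') = B* w` attached to a control operator `B ∈ 𝓛(G, H_2')`. -/
def obsUnbounded {A : H →ₗ.[ℝ] H} {G : Type*} [NormedAddCommGroup G] [InnerProductSpace ℝ G]
    [CompleteSpace G] (B : G →L[ℝ] StrongDual ℝ (HSp A 2)) : HSp A 2 × H →L[ℝ] G :=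
  (adjointUnbounded B).comp (ContinuousLinearMap.fst ℝ (HSp A 2) H)

/-- The state space `((∏_{i=1}^n H_{n-i}) × H^p) × ((∏_{i=1}^n H_{n-i-1}) × H_{-1}^p)`, where
`H_{-1}` is the dual space of `H_1`: the truncated difference `n - i` is `0` for `i ≥ n`, and
the velocities are split into those in `H_{n-1-i}`, `1 ≤ i ≤ n-1`, and those in `H_{-1}`,
`n ≤ i ≤ n+p`. -/
abbrev StateUnbounded (A : H →ₗ.[ℝ] H) (n p : ℕ) : Type _ :=
  (∀ i : Finset.Icc 1 (n + p), HSp A (n - (i : ℕ))) ×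
    ((∀ i : Finset.Icc 1 (n - 1), HSp A (n - 1 - (i : ℕ))) ×
      (Finset.Icc n (n + p) → StrongDual ℝ (HSp A 1)))

/-- The duality product `∑_i ⟨y_i', w_i⟩ - ∑_i ⟨y_i, w_i'⟩` of a state `Y = (y, y')` with the
state `(w, w')` of the adjoint system, with pivot space `H`. -/
def pairingUnbounded {A : H →ₗ.[ℝ] H} (hA : HypA1 A) {n p : ℕ} (Y : StateUnbounded A n p)
    (w : ℕ → HSp A 2) (w' : ℕ → HSp A 1) : ℝ :=
  (∑ i, inner ℝ (HSp.val (Y.2.1 i)) (HSp.val (w (i : ℕ))))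
    + (∑ i, Y.2.2 i (HSp.toOne hA (w (i : ℕ))))
    - ∑ i, inner ℝ (HSp.val (Y.1 i)) (HSp.val (w' (i : ℕ)))

/-- The analogue of `IsControlledBounded` for control operators `B_k ∈ 𝓛(G_k, H_2')`. -/
structure IsControlledUnbounded {A : H →ₗ.[ℝ] H} (hA : HypA1 A) (n p : ℕ)
    (C : ℕ → ℕ → H →L[ℝ] H)
    {G : ℕ → Type*} [∀ k, NormedAddCommGroup (G k)] [∀ k, InnerProductSpace ℝ (G k)]
    [∀ k, CompleteSpace (G k)] (B : ∀ k, G k →L[ℝ] StrongDual ℝ (HSp A 2)) (T : ℝ)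
    (v : ∀ k, ℝ → G k) (Y₀ : StateUnbounded A n p) (Y : ℝ → StateUnbounded A n p) : Prop where
  cont : ContinuousOn Y (Set.Icc 0 T)
  initial : Y 0 = Y₀
  transposition : ∀ w w', IsCascadeSol A n p C T w w' → ∀ τ ∈ Set.Icc 0 T,
    pairingUnbounded hA (Y τ) (fun i => w i τ) (fun i => w' i τ)
        - pairingUnbounded hA Y₀ (fun i => w i 0) (fun i => w' i 0)
      = ∑ k ∈ Finset.Icc n (n + p), ∫ t in (0 : ℝ)..τ,
          inner ℝ (v k t) (adjointUnbounded (B k) (w k t))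

end Unbounded

end Cascade

end

set_option linter.unusedSectionVars false

noncomputable section

/-! ### Spectral decomposition of `A`. -/

namespace Cascade

section Spectral

variable {H : Type*} [NormedAddCommGroup H] [InnerProductSpace ℝ H] [CompleteSpace H]
  {A : H →ₗ.[ℝ] H}

/-! Observability of the cascade and controllability of its adjoint are dual, so the proof has two
halves: an observability time exists, and any observability time yields null controls.

Everything is carried to `H` by `S = A^{-1/2}`: a strong solution is written `(w, w') = (S² α, S
β)`, and the energy of level `1 - j` becomes half the squared norm of `S^(j+1) (α, β)`. With the
exponent `n - i` on the `i`-th component, the derivative lost at each coupling disappears. The first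
`n` equations form a `Chain`, whose couplings `K k i`, formally `S^k C_{i,i-1} S^{-k}`, are bounded
because the adjoint of `C_{i,i-1}` acts on `H_k`.

For the first half, time integrals over the whole line are taken with the weight `exp (-l √(1+t²))`.
A chain is nilpotent, hence grows subexponentially, so there are no boundary terms, and
differentiating the weight costs only a factor `l`. Pairing consecutive components by the symplectic
form `⟨x, rot y⟩` bounds the coupling form of the lower one, and (A2), (A3) turn this form into its
full energy. Induction on the length (`lowerBound_succ`) shows that all lower components together
have weighted energy at most `C l²` times that of the last. The step needs the induction hypothesis
for a chain with one derivative less, obtained from the time antiderivative (`Chain.anti`). For `l`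
small, the lower components are absorbed into the window estimate that (A4), (A5) give for the
`n`-th equation. `exists_chain_obs` also absorbs the tail outside a large time interval, which makes
the observation time finite. The last `p` equations follow one at a time by Duhamel
(`IsRoot.exists_obsTime`).

The second half is the Hilbert uniqueness method (`UnitaryGroup.exists_control`). The weighted
states of the observed system evolve by a unitary group with a bounded perturbation; the
observability inequality makes `-⟨Y₀, ·⟩` a bounded functional of the observation, and Riesz
represents it by a control. Admissibility gives a continuous controlled state, and density of the
strong data, carried by the invertible evolution, forces every transposition solution to vanish at
`T`. For unbounded controls the observation is already `B* w`. For bounded controls observability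
concerns `B* w'` while transposition produces `B* w`; the inequality is therefore applied to a time
primitive of the solution (`exists_primitive`), which shifts all norms by one derivative. -/

theorem HypA1.inner_symm (hA : HypA1 A) (x y : A.domain) :
    inner ℝ (A x) (y : H) = inner ℝ (x : H) (A y) := by
  have h := LinearPMap.adjoint_isFormalAdjoint hA.selfAdjoint.dense_domain
  rw [LinearPMap.isSelfAdjoint_def.mp hA.selfAdjoint] at h
  exact h x y

theorem HypA1.inner_eigenspace (hA : HypA1 A) {μ ν : ℝ} (h : μ ≠ ν) {x y : H}
    (hx : x ∈ eigenspace A μ) (hy : y ∈ eigenspace A ν) : inner ℝ x y = 0 := by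
  obtain ⟨hx, hx'⟩ := (mem_eigenspace A μ x).mp hx
  obtain ⟨hy, hy'⟩ := (mem_eigenspace A ν y).mp hy
  have := hA.inner_symm ⟨x, hx⟩ ⟨y, hy⟩
  rw [hx', hy', real_inner_smul_left, real_inner_smul_right] at this
  have h2 : (μ - ν) * inner ℝ x y = 0 := by linarith
  exact (mul_eq_zero.mp h2).resolve_left (sub_ne_zero.mpr h)

theorem HypA1.orthogonalFamily (hA : HypA1 A) :
    OrthogonalFamily ℝ (fun μ => (eigenspace A μ).topologicalClosure)
      fun μ => (eigenspace A μ).topologicalClosure.subtypeₗᵢ := by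
  refine OrthogonalFamily.of_pairwise fun μ ν h => ?_
  change (eigenspace A μ).topologicalClosure ⟂ (eigenspace A ν).topologicalClosure
  rw [Submodule.isOrtho_iff_le, Submodule.orthogonal_closure]
  refine Submodule.topologicalClosure_minimal _ (fun x hx => ?_) (Submodule.isClosed_orthogonal _)
  exact (Submodule.mem_orthogonal _ _).mpr fun y hy => hA.inner_eigenspace h.symm hy hx

/-- The resolvent `R` at `z` is compact and symmetric, so its eigenspaces span a dense subspace. `R`
is injective, which disposes of the eigenvalue `0`, and an eigenvector of `R` for `ν ≠ 0` is one of
`A` for `z + ν⁻¹`. -/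
theorem HypA1.iSup_orthogonal (hA : HypA1 A) : (⨆ μ, eigenspace A μ)ᗮ = ⊥ := by
  obtain ⟨z, R, hR, h1, h2⟩ := hA.compactResolvent
  have hsymm : R.toLinearMap.IsSymmetric := by
    intro x y
    obtain ⟨hx, hx'⟩ := h1 x
    obtain ⟨hy, hy'⟩ := h1 y
    have := hA.inner_symm ⟨R x, hx⟩ ⟨R y, hy⟩
    rw [sub_eq_iff_eq_add] at hx' hy'
    rw [hx', hy', inner_add_left, inner_add_right, real_inner_smul_left, real_inner_smul_right]
      at this
    simp only [ContinuousLinearMap.coe_coe]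
    linarith
  have key := ContinuousLinearMap.orthogonalComplement_iSup_eigenspaces_eq_bot (T := R) hR hsymm
  rw [eq_bot_iff, ← key]
  refine Submodule.orthogonal_le (iSup_le fun ν => ?_)
  rcases eq_or_ne ν 0 with rfl | hν
  · intro x hx
    have hx0 : R x = 0 := by simpa using Module.End.mem_eigenspace_iff.mp hx
    obtain ⟨hd, hx'⟩ := h1 x
    have : (⟨R x, hd⟩ : A.domain) = 0 := Subtype.ext hx0
    rw [this, hx0] at hx'
    simp only [LinearPMap.map_zero, smul_zero, sub_zero] at hx'
    rw [← hx']; exact Submodule.zero_mem _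
  · refine le_trans ?_ (le_iSup _ (z + ν⁻¹))
    intro x hx
    have hx0 : R x = ν • x := by simpa using Module.End.mem_eigenspace_iff.mp hx
    obtain ⟨hd, hx'⟩ := h1 x
    have hxd : x ∈ A.domain := by
      have : x = ν⁻¹ • R x := by rw [hx0, smul_smul, inv_mul_cancel₀ hν, one_smul]
      rw [this]; exact A.domain.smul_mem _ hd
    refine (mem_eigenspace _ _ _).mpr ⟨hxd, ?_⟩
    have : (⟨R x, hd⟩ : A.domain) = ν • ⟨x, hxd⟩ := Subtype.ext hx0
    rw [this, LinearPMap.map_smul, hx0, sub_eq_iff_eq_add] at hx'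
    have h3 : A ⟨x, hxd⟩ = ν⁻¹ • (ν • A ⟨x, hxd⟩) := by
      rw [smul_smul, inv_mul_cancel₀ hν, one_smul]
    rw [h3, hx', smul_add, smul_smul, smul_smul, add_smul]
    have : ν⁻¹ * (z * ν) = z := by field_simp
    rw [mul_assoc, this, add_comm]

theorem HypA1.isHilbertSum (hA : HypA1 A) :
    IsHilbertSum ℝ (fun μ => (eigenspace A μ).topologicalClosure)
      fun μ => (eigenspace A μ).topologicalClosure.subtypeₗᵢ := by
  refine IsHilbertSum.mkInternal _ hA.orthogonalFamily ?_
  rw [top_le_iff, Submodule.topologicalClosure_eq_top_iff, eq_bot_iff, ← hA.iSup_orthogonal]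
  exact Submodule.orthogonal_le (iSup_mono fun μ => Submodule.le_topologicalClosure _)

theorem specProj_mem (μ : ℝ) (u : H) : specProj A μ u ∈ (eigenspace A μ).topologicalClosure :=
  Submodule.starProjection_apply_mem _ _

theorem specProj_eq_self {μ : ℝ} {u : H} (h : u ∈ (eigenspace A μ).topologicalClosure) :
    specProj A μ u = u := Submodule.starProjection_eq_self_iff.mpr h

theorem HypA1.specProj_eq_zero (hA : HypA1 A) {μ ν : ℝ} (hμ : μ ≠ ν) {u : H}
    (h : u ∈ (eigenspace A ν).topologicalClosure) : specProj A μ u = 0 := by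
  refine (Submodule.starProjection_apply_eq_zero_iff _).mpr ?_
  refine (Submodule.mem_orthogonal _ _).mpr fun v hv => ?_
  exact hA.orthogonalFamily hμ ⟨v, hv⟩ ⟨u, h⟩

theorem HypA1.hasSum_specProj (hA : HypA1 A) (u : H) :
    HasSum (fun μ => specProj A μ u) u := by
  have h := hA.isHilbertSum.hasSum_linearIsometryEquiv_symm (hA.isHilbertSum.linearIsometryEquiv u)
  rw [LinearIsometryEquiv.symm_apply_apply] at h
  set f := hA.isHilbertSum.linearIsometryEquiv u
  convert h using 2 with μ
  have h2 := h.mapL (specProj A μ)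
  refine h2.unique ?_
  change HasSum _ ((f μ : H))
  convert hasSum_ite_eq μ ((f μ : H)) using 2 with ν
  split_ifs with hν
  · subst hν; exact specProj_eq_self (f ν).2
  · exact hA.specProj_eq_zero (Ne.symm hν) (f ν).2

theorem inner_specProj (μ : ℝ) (u v : H) :
    inner ℝ (specProj A μ u) v = inner ℝ u (specProj A μ v) :=
  Submodule.inner_starProjection_left_eq_right _ _ _

theorem inner_specProj_specProj (μ : ℝ) (u v : H) :
    inner ℝ (specProj A μ u) (specProj A μ v) = inner ℝ (specProj A μ u) v := by
  rw [← inner_specProj, specProj_eq_self (specProj_mem μ u)]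

theorem HypA1.hasSum_inner (hA : HypA1 A) (u v : H) :
    HasSum (fun μ => inner ℝ (specProj A μ u) (specProj A μ v)) (inner ℝ u v) := by
  have := (hA.hasSum_specProj u).mapL (innerSL ℝ v)
  simp only [innerSL_apply_apply] at this
  rw [real_inner_comm]
  refine this.congr_fun fun μ => ?_
  rw [inner_specProj_specProj, real_inner_comm]

theorem HypA1.hasSum_norm_sq (hA : HypA1 A) (u : H) :
    HasSum (fun μ => ‖specProj A μ u‖ ^ 2) (‖u‖ ^ 2) := by
  have := hA.hasSum_inner u u
  simpa only [real_inner_self_eq_norm_sq] using this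

theorem HypA1.ext (hA : HypA1 A) {u v : H} (h : ∀ μ, specProj A μ u = specProj A μ v) : u = v := by
  have h1 := hA.hasSum_specProj u
  simp only [h] at h1
  exact h1.unique (hA.hasSum_specProj v)

theorem HypA1.summable_diag (hA : HypA1 A) {f : ℝ → H}
    (hf : ∀ μ, f μ ∈ (eigenspace A μ).topologicalClosure) (hs : Summable fun μ => ‖f μ‖ ^ 2) :
    Summable f :=
  (hA.orthogonalFamily.summable_iff_norm_sq_summable fun μ => ⟨f μ, hf μ⟩).mpr hs

theorem HypA1.exists_specProj_eq (hA : HypA1 A) {f : ℝ → H}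
    (hf : ∀ μ, f μ ∈ (eigenspace A μ).topologicalClosure) (hs : Summable fun μ => ‖f μ‖ ^ 2) :
    ∃ x, ∀ μ, specProj A μ x = f μ := by
  refine ⟨∑' μ, f μ, fun μ => ?_⟩
  refine ((hA.summable_diag hf hs).hasSum.mapL (specProj A μ)).unique ?_
  convert hasSum_ite_eq μ (f μ) using 2 with ν
  split_ifs with hν
  · subst hν; exact specProj_eq_self (hf ν)
  · exact hA.specProj_eq_zero (Ne.symm hν) (hf ν)

theorem specProj_eq_zero_of_bot {μ : ℝ} (h : eigenspace A μ = ⊥) (u : H) : specProj A μ u = 0 := by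
  have hmem := specProj_mem (A := A) μ u
  have hcl : (⊥ : Submodule ℝ H).topologicalClosure = ⊥ :=
    IsClosed.submodule_topologicalClosure_eq (by simp)
  rw [h, hcl] at hmem
  simpa using hmem

/-- Bounded functional calculus: the symbol acts on each spectral component, and Parseval gives the
bound. Boundedness of `φ` is needed only at eigenvalues, which is what allows `μ^{-1/2}`. -/
theorem HypA1.exists_diag (hA : HypA1 A) (φ : ℝ → ℝ)
    (hφ : ∃ C, ∀ μ, eigenspace A μ ≠ ⊥ → |φ μ| ≤ C) :
    ∃ L : H →L[ℝ] H, ∀ μ u, specProj A μ (L u) = φ μ • specProj A μ u := by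
  obtain ⟨C, hC⟩ := hφ
  have hle : ∀ u μ, ‖φ μ • specProj A μ u‖ ^ 2 ≤ C ^ 2 * ‖specProj A μ u‖ ^ 2 := by
    intro u μ
    by_cases h : eigenspace A μ = ⊥
    · simp [specProj_eq_zero_of_bot h]
    · rw [norm_smul, mul_pow, Real.norm_eq_abs]
      gcongr
      exact hC μ h
  have hs : ∀ u, Summable fun μ => ‖φ μ • specProj A μ u‖ ^ 2 := fun u =>
    Summable.of_nonneg_of_le (fun μ => by positivity) (hle u)
      ((hA.hasSum_norm_sq u).summable.mul_left _)
  have hm : ∀ u μ, φ μ • specProj A μ u ∈ (eigenspace A μ).topologicalClosure := fun u μ =>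
    Submodule.smul_mem _ _ (specProj_mem μ u)
  choose L hL using fun u => hA.exists_specProj_eq (hm u) (hs u)
  let L' : H →ₗ[ℝ] H :=
    { toFun := L
      map_add' := fun u v => hA.ext fun μ => by simp only [map_add, hL, smul_add]
      map_smul' := fun r u => hA.ext fun μ => by
        simp only [map_smul, hL, RingHom.id_apply, smul_comm r] }
  refine ⟨L'.mkContinuous |C| fun u => ?_, fun μ u => hL u μ⟩
  refine abs_le_of_sq_le_sq' ?_ (by positivity) |>.2
  have h1 := hA.hasSum_norm_sq (L' u)
  have h2 := (hA.hasSum_norm_sq u).mul_left (C ^ 2)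
  rw [mul_pow, sq_abs]
  refine hasSum_le (fun μ => ?_) h1 h2
  change ‖specProj A μ (L u)‖ ^ 2 ≤ _
  rw [hL]; exact hle u μ

theorem HypA1.eigenvalue_ge (hA : HypA1 A) :
    ∃ ω : ℝ, 0 < ω ∧ ∀ μ, eigenspace A μ ≠ ⊥ → ω ≤ μ := by
  obtain ⟨ω, hω, h⟩ := hA.bddBelow
  refine ⟨ω, hω, fun μ hb => ?_⟩
  obtain ⟨x, hx, hx0⟩ := Submodule.exists_mem_ne_zero_of_ne_bot hb
  obtain ⟨hd, hx⟩ := (mem_eigenspace A μ x).mp hx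
  have h1 := h ⟨x, hd⟩
  have h0 := hA.nonneg ⟨x, hd⟩
  rw [hx, norm_smul, Real.norm_eq_abs] at h1
  rw [hx, real_inner_smul_left] at h0
  have hp : 0 < inner ℝ x x := real_inner_self_pos.mpr hx0
  have h3 : 0 ≤ μ := by
    by_contra hneg
    push Not at hneg
    simp only at h0
    nlinarith
  rw [abs_of_nonneg h3] at h1
  exact le_of_mul_le_mul_right h1 (norm_pos_iff.mpr hx0)

/-- Identities between spectral components then need checking at positive `μ` only, where division
by `√μ` is harmless. -/
theorem HypA1.pos_or (hA : HypA1 A) (μ : ℝ) : 0 < μ ∨ ∀ u, specProj A μ u = 0 := by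
  obtain ⟨ω, hω, h⟩ := hA.eigenvalue_ge
  by_cases hb : eigenspace A μ = ⊥
  · exact Or.inr (specProj_eq_zero_of_bot hb)
  · exact Or.inl (hω.trans_le (h μ hb))

theorem HypA1.specProj_apply (hA : HypA1 A) (μ : ℝ) (u : A.domain) :
    specProj A μ (A u) = μ • specProj A μ (u : H) := by
  rw [← map_smul, ← sub_eq_zero, ← map_sub]
  refine (Submodule.starProjection_apply_eq_zero_iff _).mpr ?_
  rw [Submodule.orthogonal_closure]
  refine (Submodule.mem_orthogonal _ _).mpr fun v hv => ?_
  obtain ⟨hd, hv⟩ := (mem_eigenspace A μ v).mp hv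
  have := hA.inner_symm ⟨v, hd⟩ u
  rw [hv, real_inner_smul_left] at this
  rw [inner_sub_right, ← this, real_inner_smul_right, sub_self]

end Spectral

end Cascade

/-! ### The operators `A^{-1/2}`, cosine and sine. -/

namespace Cascade

/-- The operators `S = A^{-1/2}`, `c t = cos (t A^{1/2})`, `s t = sin (t A^{1/2})` attached to a
positive self-adjoint operator `A` with bounded inverse, with the rules of calculation between
them. -/
structure WaveGroup (H : Type*) [NormedAddCommGroup H] [InnerProductSpace ℝ H] where
  S : H →L[ℝ] H
  c : ℝ → H →L[ℝ] H
  s : ℝ → H →L[ℝ] H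
  S_symm : ∀ x y, inner ℝ (S x) y = inner ℝ x (S y)
  S_inj : ∀ x, S x = 0 → x = 0
  c_symm : ∀ t x y, inner ℝ (c t x) y = inner ℝ x (c t y)
  s_symm : ∀ t x y, inner ℝ (s t x) y = inner ℝ x (s t y)
  c_comm : ∀ t x, c t (S x) = S (c t x)
  s_comm : ∀ t x, s t (S x) = S (s t x)
  c_zero : ∀ x, c 0 x = x
  s_zero : ∀ x, s 0 x = 0
  c_add : ∀ t r x, c (t + r) x = c t (c r x) - s t (s r x)
  s_add : ∀ t r x, s (t + r) x = s t (c r x) + c t (s r x)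
  c_neg : ∀ t x, c (-t) x = c t x
  s_neg : ∀ t x, s (-t) x = -s t x
  c_cont : ∀ x, Continuous fun t => c t x
  s_cont : ∀ x, Continuous fun t => s t x
  c_deriv : ∀ x t, HasDerivAt (fun t => S (c t x)) (-(s t x)) t
  s_deriv : ∀ x t, HasDerivAt (fun t => S (s t x)) (c t x) t

section Spectral

variable {H : Type*} [NormedAddCommGroup H] [InnerProductSpace ℝ H] [CompleteSpace H]
  {A : H →ₗ.[ℝ] H}

/-- By Parseval the squared distance to `L t₀ x` is a series of continuous functions of `t`,
dominated by `4 ‖P_μ x‖²`, hence continuous. -/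
theorem HypA1.continuous_diag (hA : HypA1 A) {φ : ℝ → ℝ → ℝ} (hφ : ∀ μ, Continuous fun t => φ t μ)
    (h1 : ∀ t μ, |φ t μ| ≤ 1) {L : ℝ → H →L[ℝ] H}
    (hL : ∀ t μ u, specProj A μ (L t u) = φ t μ • specProj A μ u) (x : H) :
    Continuous fun t => L t x := by
  rw [continuous_iff_continuousAt]
  intro t₀
  have hn : ∀ t, ‖L t x - L t₀ x‖ ^ 2 = ∑' μ, (φ t μ - φ t₀ μ) ^ 2 * ‖specProj A μ x‖ ^ 2 := by
    intro t
    rw [← (hA.hasSum_norm_sq _).tsum_eq]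
    refine tsum_congr fun μ => ?_
    rw [map_sub, hL, hL, ← sub_smul, norm_smul, mul_pow, Real.norm_eq_abs, sq_abs]
  have hc : Continuous fun t => ‖L t x - L t₀ x‖ ^ 2 := by
    simp only [hn]
    refine continuous_tsum (fun μ => by have := hφ μ; fun_prop)
      ((hA.hasSum_norm_sq x).summable.mul_left 4) fun μ t => ?_
    rw [Real.norm_of_nonneg (by positivity)]
    gcongr
    have a1 := abs_le.mp (h1 t μ)
    have a2 := abs_le.mp (h1 t₀ μ)
    nlinarith
  have h2 : Filter.Tendsto (fun t => √(‖L t x - L t₀ x‖ ^ 2)) (nhds t₀) (nhds 0) := by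
    have := (hc.sqrt).tendsto t₀
    simpa using this
  refine tendsto_iff_norm_sub_tendsto_zero.mpr ?_
  simpa [Real.sqrt_sq] using h2

/-- The series is not differentiated term by term. The formula `f t = f 0 + ∫ g` is checked on each
spectral component, where it is the scalar fundamental theorem of calculus; continuity of `g` then
gives the derivative. -/
theorem HypA1.hasDerivAt_diag (hA : HypA1 A) {f g : ℝ → H} {φ ψ : ℝ → ℝ → ℝ} (hg : Continuous g)
    (hφ : ∀ μ t, 0 < μ → HasDerivAt (fun t => φ t μ) (ψ t μ) t) (x : H)
    (hf' : ∀ t μ, specProj A μ (f t) = φ t μ • specProj A μ x)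
    (hg' : ∀ t μ, specProj A μ (g t) = ψ t μ • specProj A μ x) (t : ℝ) : HasDerivAt f (g t) t := by
  have key : ∀ t, f t = f 0 + ∫ r in (0 : ℝ)..t, g r := by
    intro t
    refine hA.ext fun μ => ?_
    rw [map_add, ← ContinuousLinearMap.intervalIntegral_comp_comm _ (hg.intervalIntegrable _ _)]
    rcases hA.pos_or μ with hμ | hμ
    · have hd : ∀ r, HasDerivAt (fun r => φ r μ • specProj A μ x) (specProj A μ (g r)) r := by
        intro r
        rw [hg']
        exact (hφ μ r hμ).smul_const _
      have hi : IntervalIntegrable (fun r => specProj A μ (g r)) MeasureTheory.volume 0 t :=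
        ((specProj A μ).continuous.comp hg).intervalIntegrable _ _
      rw [intervalIntegral.integral_eq_sub_of_hasDerivAt (fun r _ => hd r) hi, hf', hf']
      abel
    · simp [hμ]
  rw [funext key]
  simpa using (intervalIntegral.integral_hasDerivAt_right (hg.intervalIntegrable 0 t)
    hg.aestronglyMeasurable.stronglyMeasurableAtFilter hg.continuousAt).const_add (f 0)

/-- `W` is attached to the operator `A`: its `S` is `A^{-1/2}`. -/
def WaveGroup.IsRoot (W : WaveGroup H) (A : H →ₗ.[ℝ] H) : Prop :=
  ∀ μ u, specProj A μ (W.S u) = (√μ)⁻¹ • specProj A μ u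

theorem HypA1.exists_waveGroup (hA : HypA1 A) : ∃ W : WaveGroup H, W.IsRoot A := by
  obtain ⟨ω, hω, hle⟩ := hA.eigenvalue_ge
  obtain ⟨S, hS⟩ := hA.exists_diag (fun μ => (√μ)⁻¹) ⟨(√ω)⁻¹, fun μ h => by
    rw [abs_of_nonneg (by positivity)]
    exact inv_anti₀ (Real.sqrt_pos.mpr hω) (Real.sqrt_le_sqrt (hle μ h))⟩
  choose c hc using fun t : ℝ => hA.exists_diag (fun μ => Real.cos (√μ * t))
    ⟨1, fun μ _ => Real.abs_cos_le_one _⟩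
  choose s hs using fun t : ℝ => hA.exists_diag (fun μ => Real.sin (√μ * t))
    ⟨1, fun μ _ => Real.abs_sin_le_one _⟩
  have hsymm : ∀ (L : H →L[ℝ] H) (φ : ℝ → ℝ), (∀ μ u, specProj A μ (L u) = φ μ • specProj A μ u) →
      ∀ x y, inner ℝ (L x) y = inner ℝ x (L y) := by
    intro L φ hL x y
    refine (hA.hasSum_inner (L x) y).unique ?_
    refine (hA.hasSum_inner x (L y)).congr_fun fun μ => ?_
    rw [hL, hL, real_inner_smul_left, real_inner_smul_right]
  have hcc : ∀ x, Continuous fun t => c t x := fun x =>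
    hA.continuous_diag (φ := fun t μ => Real.cos (√μ * t)) (fun μ => by fun_prop)
      (fun t μ => Real.abs_cos_le_one _) hc x
  have hsc : ∀ x, Continuous fun t => s t x := fun x =>
    hA.continuous_diag (φ := fun t μ => Real.sin (√μ * t)) (fun μ => by fun_prop)
      (fun t μ => Real.abs_sin_le_one _) hs x
  refine ⟨⟨S, c, s, hsymm S _ hS, fun x hx => hA.ext fun μ => ?_, fun t => hsymm _ _ (hc t),
    fun t => hsymm _ _ (hs t), fun t x => hA.ext fun μ => ?_, fun t x => hA.ext fun μ => ?_,
    fun x => hA.ext fun μ => ?_, fun x => hA.ext fun μ => ?_, fun t r x => hA.ext fun μ => ?_,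
    fun t r x => hA.ext fun μ => ?_, fun t x => hA.ext fun μ => ?_, fun t x => hA.ext fun μ => ?_,
    hcc, hsc, fun x t => ?_, fun x t => ?_⟩, hS⟩
  · rcases hA.pos_or μ with hμ | hμ
    · have h := hS μ x
      rw [hx, map_zero] at h
      rw [map_zero]
      exact ((smul_eq_zero.mp h.symm).resolve_left (inv_ne_zero (Real.sqrt_pos.mpr hμ).ne'))
    · simp [hμ]
  · rw [hc, hS, hS, hc, smul_comm]
  · rw [hs, hS, hS, hs, smul_comm]
  · simp [hc]
  · simp [hs]
  · simp only [hc, hs, map_sub, smul_smul, mul_add, Real.cos_add, sub_smul]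
  · simp only [hc, hs, map_add, smul_smul, mul_add, Real.sin_add, add_smul]
  · simp [hc]
  · simp [hs]
  · refine hA.hasDerivAt_diag (φ := fun t μ => (√μ)⁻¹ * Real.cos (√μ * t))
      (ψ := fun t μ => -Real.sin (√μ * t)) (hsc x).neg (fun μ t hμ => ?_) x
      (fun t μ => by rw [hS, hc, smul_smul]) (fun t μ => by rw [Pi.neg_apply, map_neg, hs, neg_smul]) t
    have hμ' := (Real.sqrt_pos.mpr hμ).ne'
    convert! (((hasDerivAt_id' t).const_mul (√μ)).cos).const_mul (√μ)⁻¹ using 1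
    field_simp
  · refine hA.hasDerivAt_diag (φ := fun t μ => (√μ)⁻¹ * Real.sin (√μ * t))
      (ψ := fun t μ => Real.cos (√μ * t)) (hcc x) (fun μ t hμ => ?_) x
      (fun t μ => by rw [hS, hs, smul_smul]) (fun t μ => hc t μ x) t
    have hμ' := (Real.sqrt_pos.mpr hμ).ne'
    convert! (((hasDerivAt_id' t).const_mul (√μ)).sin).const_mul (√μ)⁻¹ using 1
    field_simp

variable {W : WaveGroup H}

theorem WaveGroup.IsRoot.pow (hW : W.IsRoot A) (j : ℕ) (μ : ℝ) (x : H) :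
    specProj A μ ((W.S ^ j) x) = ((√μ)⁻¹) ^ j • specProj A μ x := by
  induction j generalizing x with
  | zero => simp
  | succ j ih => rw [pow_succ, mul_apply_eq_comp, ih, hW, smul_smul, pow_succ]

theorem WaveGroup.IsRoot.powNormSq (hW : W.IsRoot A) (hA : HypA1 A) (j m : ℕ) (x : H) :
    powNormSq A ((j : ℤ) - m) ((W.S ^ j) x) = ‖(W.S ^ m) x‖ ^ 2 := by
  rw [← (hA.hasSum_norm_sq _).tsum_eq]
  refine tsum_congr fun μ => ?_
  rcases hA.pos_or μ with hμ | hμ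
  · rw [hW.pow, hW.pow, norm_smul, norm_smul, mul_pow, mul_pow, ← mul_assoc]
    congr 1
    rw [abs_of_pos hμ, zpow_sub₀ hμ.ne', zpow_natCast, zpow_natCast, Real.norm_of_nonneg (by positivity),
      Real.norm_of_nonneg (by positivity), ← pow_mul, ← pow_mul, mul_comm j, mul_comm m, pow_mul,
      pow_mul, inv_pow, Real.sq_sqrt hμ.le, inv_pow, inv_pow]
    field_simp
  · simp [hμ]

theorem WaveGroup.IsRoot.pow_mem (hW : W.IsRoot A) (hA : HypA1 A) (k : ℕ) (x : H) :
    (W.S ^ k) x ∈ powDomain A k := by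
  change Summable _
  refine (hA.hasSum_norm_sq x).summable.congr fun μ => ?_
  rcases hA.pos_or μ with hμ | hμ
  · rw [hW.pow, norm_smul, mul_pow, ← mul_assoc, Real.norm_of_nonneg (by positivity), ← pow_mul,
      mul_comm k, pow_mul, inv_pow, Real.sq_sqrt hμ.le, abs_of_pos hμ, ← mul_pow,
      mul_inv_cancel₀ hμ.ne', one_pow, one_mul]
  · simp [hμ]

theorem WaveGroup.IsRoot.exists_pow_eq (hW : W.IsRoot A) (hA : HypA1 A) (k : ℕ) {u : H}
    (hu : u ∈ powDomain A k) : ∃ x, (W.S ^ k) x = u := by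
  have hu' : Summable fun μ : ℝ => |μ| ^ k * ‖specProj A μ u‖ ^ 2 := hu
  obtain ⟨x, hx⟩ := hA.exists_specProj_eq (f := fun μ => (√μ) ^ k • specProj A μ u)
    (fun μ => Submodule.smul_mem _ _ (specProj_mem μ u)) (hu'.congr fun μ => by
      rcases hA.pos_or μ with hμ | hμ
      · rw [norm_smul, mul_pow, Real.norm_of_nonneg (by positivity), ← pow_mul,
          mul_comm k, pow_mul, Real.sq_sqrt hμ.le, abs_of_pos hμ]
      · simp [hμ])
  refine ⟨x, hA.ext fun μ => ?_⟩
  rcases hA.pos_or μ with hμ | hμ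
  · rw [hW.pow, hx, smul_smul, ← mul_pow, inv_mul_cancel₀ (Real.sqrt_pos.mpr hμ).ne', one_pow,
      one_smul]
  · simp [hμ]

/-- Membership in the domain comes from the range of the resolvent: comparing spectral components
gives `S² x = R (x - z S² x)`. The division by `μ - z` is legitimate because `z` is not an
eigenvalue. -/
theorem WaveGroup.IsRoot.apply_sq (hW : W.IsRoot A) (hA : HypA1 A) (x : H) :
    ∃ h : (W.S ^ 2) x ∈ A.domain, A ⟨(W.S ^ 2) x, h⟩ = x := by
  obtain ⟨z, R, -, h1, h2⟩ := hA.compactResolvent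
  have hRp : ∀ μ y, (μ - z) • specProj A μ (R y) = specProj A μ y := by
    intro μ y
    obtain ⟨hd, hy⟩ := h1 y
    have := congrArg (specProj A μ) hy
    rw [map_sub, hA.specProj_apply, map_smul, ← sub_smul] at this
    exact this
  have hz : ∀ u, specProj A z u = 0 := by
    refine specProj_eq_zero_of_bot ((Submodule.eq_bot_iff _).mpr fun e he => ?_)
    obtain ⟨hd, he⟩ := (mem_eigenspace A z e).mp he
    have := h2 ⟨e, hd⟩
    rw [he, sub_self, map_zero] at this
    exact this.symm
  have hk : (W.S ^ 2) x = R (x - z • (W.S ^ 2) x) := by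
    refine hA.ext fun μ => ?_
    rcases hA.pos_or μ with hμ | hμ
    · rcases eq_or_ne μ z with rfl | hne
      · simp [hz]
      · have h3 := hRp μ (x - z • (W.S ^ 2) x)
        have hne' : μ - z ≠ 0 := sub_ne_zero.mpr hne
        refine smul_right_injective H hne' ?_
        simp only
        rw [h3, map_sub, map_smul, hW.pow, inv_pow, Real.sq_sqrt hμ.le, smul_smul, smul_smul,
          sub_mul, sub_smul, mul_inv_cancel₀ hμ.ne', one_smul]
    · simp [hμ]
  obtain ⟨hd, hy⟩ := h1 (x - z • (W.S ^ 2) x)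
  have hd' : (W.S ^ 2) x ∈ A.domain := by rw [hk]; exact hd
  refine ⟨hd', ?_⟩
  have hs : (⟨(W.S ^ 2) x, hd'⟩ : A.domain) = ⟨R (x - z • (W.S ^ 2) x), hd⟩ := Subtype.ext hk
  rw [hs, sub_eq_iff_eq_add.mp hy, ← hk, sub_add_cancel]

end Spectral

end Cascade

/-! ### Strong solutions and the spaces `H_k` in the variables `(α, β)`. -/

namespace Cascade

namespace WaveGroup

variable {H : Type*} [NormedAddCommGroup H] [InnerProductSpace ℝ H]

theorem pow_symm (W : WaveGroup H) (k : ℕ) (x y : H) :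
    inner ℝ ((W.S ^ k) x) y = inner ℝ x ((W.S ^ k) y) := by
  induction k generalizing x y with
  | zero => simp
  | succ k ih =>
    conv_lhs => rw [pow_succ, mul_apply_eq_comp, ih, W.S_symm]
    rw [pow_succ', mul_apply_eq_comp]

theorem pow_inj (W : WaveGroup H) (k : ℕ) {x : H} (h : (W.S ^ k) x = 0) : x = 0 := by
  induction k with
  | zero => simpa using h
  | succ k ih =>
    rw [pow_succ', mul_apply_eq_comp] at h
    exact ih (W.S_inj _ h)

theorem pow_injective (W : WaveGroup H) (k : ℕ) : Function.Injective (W.S ^ k) :=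
  (injective_iff_map_eq_zero _).mpr fun _ => W.pow_inj k

theorem S_sq (W : WaveGroup H) (x : H) : (W.S ^ 2) x = W.S (W.S x) := by
  rw [pow_two, mul_apply_eq_comp]

/-- Strong solutions `w = S² α`, `w' = S β` of `w'' + A w = f` on `[0, T]`. -/
structure StrongOn (W : WaveGroup H) (T : ℝ) (f α β : ℝ → H) : Prop where
  source : ContinuousOn f (Set.Icc 0 T)
  cont : ContinuousOn α (Set.Icc 0 T)
  cont' : ContinuousOn β (Set.Icc 0 T)
  deriv : ∀ t ∈ Set.Icc 0 T,
    HasDerivWithinAt (fun s => W.S (W.S (α s))) (W.S (β t)) (Set.Icc 0 T) t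
  eqn : ∀ t ∈ Set.Icc 0 T, HasDerivWithinAt (fun s => W.S (β s)) (f t - α t) (Set.Icc 0 T) t

variable [CompleteSpace H] {A : H →ₗ.[ℝ] H} {W : WaveGroup H}

/-- The isometry `S^k` of `H` onto `H_k`. -/
def IsRoot.equiv (hW : W.IsRoot A) (hA : HypA1 A) (k : ℕ) : H ≃ₗᵢ[ℝ] HSp A k where
  toLinearEquiv := LinearEquiv.ofBijective
    (((W.S ^ k : H →L[ℝ] H) : H →ₗ[ℝ] H).codRestrict (powDomain A k) (hW.pow_mem hA k) :
      H →ₗ[ℝ] HSp A k)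
    ⟨fun _ _ h => W.pow_injective k (congrArg (HSp.val (A := A) (k := k)) h), fun u => by
      obtain ⟨x, hx⟩ := hW.exists_pow_eq hA k u.2
      exact ⟨x, Subtype.ext hx⟩⟩
  norm_map' x := by
    refine (sq_eq_sq₀ (norm_nonneg _) (norm_nonneg _)).mp ?_
    rw [HSp.norm_sq]
    have := hW.powNormSq hA k 0 x
    rw [Nat.cast_zero, sub_zero, pow_zero] at this
    exact this

theorem IsRoot.val_equiv (hW : W.IsRoot A) (hA : HypA1 A) (k : ℕ) (x : H) :
    HSp.val (hW.equiv hA k x) = (W.S ^ k) x := rfl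

theorem IsRoot.pow_val_symm (hW : W.IsRoot A) (hA : HypA1 A) (k : ℕ) (u : HSp A k) :
    (W.S ^ k) ((hW.equiv hA k).symm u) = HSp.val u := by
  rw [← hW.val_equiv hA, LinearIsometryEquiv.apply_symm_apply]

/-- Since `A S² = 1`, the equation `w'' + A w = f` loses its unbounded operator: it reads `(S² α)' =
S β`, `(S β)' = f - α` with `α`, `β` merely continuous in `H`. -/
theorem IsRoot.isStrongSol_iff (hW : W.IsRoot A) (hA : HypA1 A) {T : ℝ} {f α β : ℝ → H} :
    IsStrongSol A T f (fun t => hW.equiv hA 2 (α t)) (fun t => hW.equiv hA 1 (β t)) ↔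
      W.StrongOn T f α β := by
  constructor
  · intro h
    refine ⟨h.source, ?_, ?_, ?_, ?_⟩
    · exact ((hW.equiv hA 2).toHomeomorph.comp_continuousOn_iff _ _).mp h.cont
    · exact ((hW.equiv hA 1).toHomeomorph.comp_continuousOn_iff _ _).mp h.cont'
    · intro t ht
      simpa only [hW.val_equiv, S_sq, pow_one] using h.deriv t ht
    · intro t ht
      obtain ⟨hd, h1⟩ := h.eqn t ht
      obtain ⟨hd', h2⟩ := hW.apply_sq hA (α t)
      simp only [hW.val_equiv, h2, pow_one] at h1
      exact h1
  · intro h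
    refine ⟨h.source, ?_, ?_, ?_, ?_⟩
    · exact (hW.equiv hA 2).continuous.comp_continuousOn h.cont
    · exact (hW.equiv hA 1).continuous.comp_continuousOn h.cont'
    · intro t ht
      simpa only [hW.val_equiv, S_sq, pow_one] using h.deriv t ht
    · intro t ht
      obtain ⟨hd', h2⟩ := hW.apply_sq hA (α t)
      refine ⟨hd', ?_⟩
      simp only [hW.val_equiv, h2, pow_one]
      exact h.eqn t ht

theorem IsRoot.strongOn (hW : W.IsRoot A) (hA : HypA1 A) {T : ℝ} {f : ℝ → H} {w : ℝ → HSp A 2}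
    {w' : ℝ → HSp A 1} (h : IsStrongSol A T f w w') :
    W.StrongOn T f (fun t => (hW.equiv hA 2).symm (w t)) (fun t => (hW.equiv hA 1).symm (w' t)) := by
  rw [← hW.isStrongSol_iff hA]
  simpa using h

/-- Here `K` stands for `S^k L S^{-k}`. The conjugate `S^{-k} L* S^k` is bounded because `L*` acts
on `H_k`, and `K` is its adjoint; this is why regularity is assumed of adjoints. -/
theorem IsRoot.exists_boundedOn (hW : W.IsRoot A) (hA : HypA1 A) {k : ℕ} {L : H →L[ℝ] H}
    (h : BoundedOn A k (ContinuousLinearMap.adjoint L)) :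
    ∃ K : H →L[ℝ] H, ∀ x, (W.S ^ k) (L x) = K ((W.S ^ k) x) := by
  obtain ⟨L', hL⟩ := h
  let e := (hW.equiv hA k).toContinuousLinearEquiv
  let D : H →L[ℝ] H := (e.symm : HSp A k →L[ℝ] H).comp (L'.comp (e : H →L[ℝ] HSp A k))
  have hD : ∀ y, (W.S ^ k) (D y) = ContinuousLinearMap.adjoint L ((W.S ^ k) y) := by
    intro y
    have := hW.pow_val_symm hA k (L' (hW.equiv hA k y))
    rw [hL, hW.val_equiv] at this
    exact this
  refine ⟨ContinuousLinearMap.adjoint D, fun x => ext_inner_right ℝ fun y => ?_⟩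
  rw [ContinuousLinearMap.adjoint_inner_left, W.pow_symm, W.pow_symm, hD,
    ContinuousLinearMap.adjoint_inner_right]

theorem IsRoot.energy (hW : W.IsRoot A) (hA : HypA1 A) (j : ℕ) (α β : H) :
    energy A (1 - (j : ℤ)) ((W.S ^ 2) α) ((W.S ^ 1) β)
      = (‖(W.S ^ (j + 1)) α‖ ^ 2 + ‖(W.S ^ (j + 1)) β‖ ^ 2) / 2 := by
  rw [Cascade.energy, ← hW.powNormSq hA 2 (j + 1) α, ← hW.powNormSq hA 1 (j + 1) β]
  congr 3 <;> push_cast <;> ring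

end WaveGroup

end Cascade

/-! ### Unitary groups with a bounded perturbation. -/

namespace Cascade

/-- A strongly continuous group of isometries of a Hilbert space. -/
structure UnitaryGroup (X : Type*) [NormedAddCommGroup X] [InnerProductSpace ℝ X] where
  U : ℝ → X →L[ℝ] X
  zero : ∀ x, U 0 x = x
  add : ∀ t r x, U (t + r) x = U t (U r x)
  inner_map : ∀ t x y, inner ℝ (U t x) (U t y) = inner ℝ x y
  cont : ∀ x, Continuous fun t => U t x

namespace UnitaryGroup

variable {X : Type*} [NormedAddCommGroup X] [InnerProductSpace ℝ X] (G : UnitaryGroup X)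

theorem norm_map (t : ℝ) (x : X) : ‖G.U t x‖ = ‖x‖ := by
  rw [← sq_eq_sq₀ (norm_nonneg _) (norm_nonneg _), ← real_inner_self_eq_norm_sq, G.inner_map,
    real_inner_self_eq_norm_sq]

theorem neg_apply (t : ℝ) (x : X) : G.U (-t) (G.U t x) = x := by
  rw [← G.add, neg_add_cancel, G.zero]

theorem apply_neg (t : ℝ) (x : X) : G.U t (G.U (-t) x) = x := by
  rw [← G.add, add_neg_cancel, G.zero]

theorem inner_right (t : ℝ) (x y : X) : inner ℝ (G.U t x) y = inner ℝ x (G.U (-t) y) := by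
  rw [← G.inner_map (-t), G.neg_apply]

theorem inner_neg_left (t : ℝ) (x y : X) : inner ℝ (G.U (-t) x) y = inner ℝ x (G.U t y) := by
  rw [G.inner_right, neg_neg]

theorem continuousOn_apply {I : Set ℝ} {x : ℝ → X} (hx : ContinuousOn x I) :
    ContinuousOn (fun t => G.U t (x t)) I := by
  intro t₀ ht₀
  have h1 : Filter.Tendsto (fun t => ‖x t - x t₀‖) (nhdsWithin t₀ I) (nhds 0) :=
    tendsto_iff_norm_sub_tendsto_zero.mp (hx t₀ ht₀)
  have h2 : Filter.Tendsto (fun t => ‖G.U t (x t₀) - G.U t₀ (x t₀)‖) (nhdsWithin t₀ I) (nhds 0) :=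
    tendsto_iff_norm_sub_tendsto_zero.mp ((G.cont (x t₀)).continuousAt.continuousWithinAt)
  refine tendsto_iff_norm_sub_tendsto_zero.mpr ?_
  refine squeeze_zero (fun _ => norm_nonneg _) (fun t => ?_) (by simpa using h1.add h2)
  calc ‖G.U t (x t) - G.U t₀ (x t₀)‖
      = ‖G.U t (x t - x t₀) + (G.U t (x t₀) - G.U t₀ (x t₀))‖ := by rw [map_sub]; congr 1; abel
    _ ≤ _ := by rw [← G.norm_map t (x t - x t₀)]; exact norm_add_le _ _

/-- The time reversed group. -/
def rev : UnitaryGroup X where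
  U t := G.U (-t)
  zero x := by rw [neg_zero, G.zero]
  add t r x := by rw [neg_add, G.add]
  inner_map t := G.inner_map (-t)
  cont x := (G.cont x).comp continuous_neg

theorem continuousOn_neg_apply {I : Set ℝ} {x : ℝ → X} (hx : ContinuousOn x I) :
    ContinuousOn (fun t => G.U (-t) (x t)) I := G.rev.continuousOn_apply hx

theorem continuous_apply {x : ℝ → X} (hx : Continuous x) : Continuous fun t => G.U t (x t) := by
  rw [← continuousOn_univ] at *; exact G.continuousOn_apply hx

theorem continuous_neg_apply {x : ℝ → X} (hx : Continuous x) :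
    Continuous fun t => G.U (-t) (x t) := G.rev.continuous_apply hx

/-- The generator of the perturbed group in the interaction picture. -/
def conj (K : X →L[ℝ] X) (t : ℝ) : X →L[ℝ] X := (G.U (-t)).comp (K.comp (G.U t))

theorem conj_apply (K : X →L[ℝ] X) (t : ℝ) (x : X) : G.conj K t x = G.U (-t) (K (G.U t x)) := rfl

theorem norm_conj_le (K : X →L[ℝ] X) (t : ℝ) (x : X) : ‖G.conj K t x‖ ≤ ‖K‖ * ‖x‖ := by
  rw [conj_apply, G.norm_map, ← G.norm_map t x]
  exact K.le_opNorm _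

theorem continuous_conj (K : X →L[ℝ] X) {x : ℝ → X} (hx : Continuous x) :
    Continuous fun t => G.conj K t (x t) :=
  G.continuous_neg_apply (K.continuous.comp (G.continuous_apply hx))

theorem lipschitzWith_conj (K : X →L[ℝ] X) (t : ℝ) : LipschitzWith ‖K‖₊ (G.conj K t) := by
  refine LipschitzWith.of_dist_le_mul fun x y => ?_
  rw [dist_eq_norm, dist_eq_norm, ← map_sub]
  exact G.norm_conj_le K t _

section Existence

variable [CompleteSpace X] (K : X →L[ℝ] X)

open BoundedContinuousFunction

omit [CompleteSpace X] in
-- Integrating `cosh (κ r)` gains a factor `1/κ` on both sides of zero. The gain makes the Picard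
-- map contracting for large `κ`; for small `κ` the same bound measures the growth of chains.
theorem norm_integral_cosh_le {κ M : ℝ} (hκ : 0 < κ) {f : ℝ → X} (t : ℝ) (hM : 0 ≤ M)
    (hf : ∀ r, ‖f r‖ ≤ M * Real.cosh (κ * r)) :
    ‖∫ r in (0 : ℝ)..t, f r‖ ≤ M / κ * Real.cosh (κ * t) := by
  have hd : ∀ r, HasDerivAt (fun r => M / κ * Real.sinh (κ * r)) (M * Real.cosh (κ * r)) r := by
    intro r
    convert! (((hasDerivAt_id' r).const_mul κ).sinh).const_mul (M / κ) using 1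
    field_simp
  have hi : IntervalIntegrable (fun r => M * Real.cosh (κ * r)) MeasureTheory.volume 0 t :=
    (by fun_prop : Continuous fun r => M * Real.cosh (κ * r)).intervalIntegrable _ _
  refine (intervalIntegral.norm_integral_le_abs_of_norm_le
    (Filter.Eventually.of_forall hf) hi).trans ?_
  rw [intervalIntegral.integral_eq_sub_of_hasDerivAt (fun r _ => hd r) hi]
  simp only [mul_zero, Real.sinh_zero, sub_zero]
  rw [abs_mul, abs_of_nonneg (by positivity)]
  gcongr
  rw [abs_le]
  constructor
  · have := Real.exp_pos (κ * t)
    rw [Real.cosh_eq, Real.sinh_eq]; linarith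
  · exact (Real.sinh_lt_cosh _).le

/-- Picard iteration in a weighted norm: write `ξ = cosh (κ t) g` with `g` bounded. The choice `κ =
2 (‖K‖ + 1)` makes the integral operator contract by `1/2`, so the solution is global at once, with
an explicit bound. -/
theorem exists_integral_solution (x₀ : X) : ∃ ξ : ℝ → X, Continuous ξ ∧
    (∀ t, ξ t = x₀ + ∫ r in (0 : ℝ)..t, G.conj K r (ξ r)) ∧
    ∀ t, ‖ξ t‖ ≤ 2 * Real.cosh (2 * (‖K‖ + 1) * t) * ‖x₀‖ := by
  set κ : ℝ := 2 * (‖K‖ + 1) with hκdef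
  have hκ : 0 < κ := by positivity
  have hcosh : ∀ t, 0 < Real.cosh (κ * t) := fun t => Real.cosh_pos _
  have hcc : Continuous fun t => Real.cosh (κ * t) := by fun_prop
  have hint : ∀ g : ℝ →ᵇ X, Continuous fun r => Real.cosh (κ * r) • G.conj K r (g r) := fun g =>
    hcc.smul (G.continuous_conj K g.continuous)
  have hintc : ∀ g : ℝ →ᵇ X, Continuous fun t =>
      ∫ r in (0 : ℝ)..t, Real.cosh (κ * r) • G.conj K r (g r) := fun g =>
    intervalIntegral.continuous_primitive (fun a b => (hint g).intervalIntegrable a b) 0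
  have hb : ∀ (g : ℝ → X) (M : ℝ), 0 ≤ M → (∀ r, ‖g r‖ ≤ M) → ∀ t,
      ‖∫ r in (0 : ℝ)..t, Real.cosh (κ * r) • G.conj K r (g r)‖ ≤ M / 2 * Real.cosh (κ * t) := by
    intro g M hM hg t
    refine (norm_integral_cosh_le (M := ‖K‖ * M) hκ t (by positivity) fun r => ?_).trans ?_
    · rw [norm_smul, Real.norm_of_nonneg (hcosh r).le, mul_comm]
      gcongr
      refine (G.norm_conj_le K r _).trans ?_
      gcongr
      exact hg r
    · gcongr ?_ * _
      rw [div_le_div_iff₀ hκ two_pos, hκdef]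
      nlinarith [norm_nonneg K]
  have hnorm : ∀ (t : ℝ) (y : X), ‖(Real.cosh (κ * t))⁻¹ • y‖ = (Real.cosh (κ * t))⁻¹ * ‖y‖ := by
    intro t y
    rw [norm_smul, Real.norm_of_nonneg (inv_nonneg.mpr (hcosh t).le)]
  have hb2 : ∀ (y : X) (M t : ℝ), ‖y‖ ≤ M * Real.cosh (κ * t) →
      ‖(Real.cosh (κ * t))⁻¹ • y‖ ≤ M := by
    intro y M t h
    rw [hnorm, inv_mul_le_iff₀ (hcosh t), mul_comm]
    exact h
  have hb3 : ∀ (t : ℝ) (y : X), ‖(Real.cosh (κ * t))⁻¹ • y‖ ≤ ‖y‖ := by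
    intro t y
    refine hb2 _ _ t (le_mul_of_one_le_right (norm_nonneg _) (Real.one_le_cosh _))
  let Φ : (ℝ →ᵇ X) → (ℝ →ᵇ X) := fun g => BoundedContinuousFunction.ofNormedAddCommGroup
    (fun t => (Real.cosh (κ * t))⁻¹ • x₀
      + (Real.cosh (κ * t))⁻¹ • ∫ r in (0 : ℝ)..t, Real.cosh (κ * r) • G.conj K r (g r))
    ((hcc.inv₀ fun t => (hcosh t).ne').smul continuous_const |>.add
      ((hcc.inv₀ fun t => (hcosh t).ne').smul (hintc g)))
    (‖x₀‖ + ‖g‖ / 2)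
    fun t => (norm_add_le _ _).trans (add_le_add (hb3 t x₀)
      (hb2 _ _ t (hb g ‖g‖ (norm_nonneg _) (g.norm_coe_le_norm) t)))
  have hΦt : ∀ g t, Φ g t = (Real.cosh (κ * t))⁻¹ • x₀
      + (Real.cosh (κ * t))⁻¹ • ∫ r in (0 : ℝ)..t, Real.cosh (κ * r) • G.conj K r (g r) :=
    fun g t => rfl
  have hΦ : ContractingWith (1 / 2) Φ := by
    refine ⟨by norm_num, LipschitzWith.of_dist_le_mul fun g h => ?_⟩
    rw [BoundedContinuousFunction.dist_le (by positivity)]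
    intro t
    have : Φ g t - Φ h t = (Real.cosh (κ * t))⁻¹ •
        ∫ r in (0 : ℝ)..t, Real.cosh (κ * r) • G.conj K r (g r - h r) := by
      rw [hΦt, hΦt, add_sub_add_left_eq_sub, ← smul_sub, ← intervalIntegral.integral_sub
        ((hint g).intervalIntegrable _ _) ((hint h).intervalIntegrable _ _)]
      simp only [map_sub, smul_sub]
    rw [dist_eq_norm, this]
    refine hb2 _ _ t ?_
    have := hb (fun r => g r - h r) (dist g h) dist_nonneg (fun r => by
      rw [← dist_eq_norm]; exact BoundedContinuousFunction.dist_coe_le_dist r) t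
    refine this.trans_eq ?_
    push_cast; ring
  obtain ⟨g, hg⟩ : ∃ g, Φ g = g := ⟨hΦ.fixedPoint Φ, hΦ.fixedPoint_isFixedPt⟩
  have hgt : ∀ t, g t = (Real.cosh (κ * t))⁻¹ • x₀
      + (Real.cosh (κ * t))⁻¹ • ∫ r in (0 : ℝ)..t, Real.cosh (κ * r) • G.conj K r (g r) := by
    intro t
    conv_lhs => rw [← hg]
    exact hΦt g t
  have hgn : ‖g‖ ≤ 2 * ‖x₀‖ := by
    have : ‖g‖ ≤ ‖x₀‖ + ‖g‖ / 2 := by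
      refine (BoundedContinuousFunction.norm_le (by positivity)).mpr fun t => ?_
      rw [hgt t]
      exact (norm_add_le _ _).trans (add_le_add (hb3 t x₀)
        (hb2 _ _ t (hb g ‖g‖ (norm_nonneg _) (g.norm_coe_le_norm) t)))
    linarith
  refine ⟨fun t => Real.cosh (κ * t) • g t, hcc.smul g.continuous, fun t => ?_, fun t => ?_⟩
  · simp only [map_smul]
    conv_lhs => rw [hgt t]
    rw [smul_add, smul_smul, smul_smul, mul_inv_cancel₀ (hcosh t).ne', one_smul, one_smul]
  · rw [norm_smul, Real.norm_of_nonneg (hcosh t).le]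
    nlinarith [g.norm_coe_le_norm t, hcosh t]

theorem hasDerivAt_of_integral_eq {ξ : ℝ → X} (hc : Continuous ξ) {x₀ : X}
    (h : ∀ t, ξ t = x₀ + ∫ r in (0 : ℝ)..t, G.conj K r (ξ r)) (t : ℝ) :
    HasDerivAt ξ (G.conj K t (ξ t)) t := by
  have hc' := G.continuous_conj K hc
  have := (intervalIntegral.integral_hasDerivAt_right (hc'.intervalIntegrable 0 t)
    hc'.aestronglyMeasurable.stronglyMeasurableAtFilter hc'.continuousAt).const_add x₀
  rwa [← funext h] at this

omit [CompleteSpace X] in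
theorem conj_unique {ξ η : ℝ → X} (hξ : ∀ t, HasDerivAt ξ (G.conj K t (ξ t)) t)
    (hη : ∀ t, HasDerivAt η (G.conj K t (η t)) t) (h : ξ 0 = η 0) : ξ = η :=
  ODE_solution_unique_univ (v := fun t => G.conj K t) (s := fun _ => Set.univ) (t₀ := 0)
    (fun t => (G.lipschitzWith_conj K t).lipschitzOnWith)
    (fun t => ⟨hξ t, trivial⟩) (fun t => ⟨hη t, trivial⟩) h

omit [CompleteSpace X] in
theorem conj_unique_Icc {T : ℝ} {ξ η : ℝ → X}
    (hξ : ∀ t ∈ Set.Icc 0 T, HasDerivWithinAt ξ (G.conj K t (ξ t)) (Set.Icc 0 T) t)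
    (hη : ∀ t ∈ Set.Icc 0 T, HasDerivWithinAt η (G.conj K t (η t)) (Set.Icc 0 T) t)
    (h : ξ 0 = η 0) : Set.EqOn ξ η (Set.Icc 0 T) := by
  have aux : ∀ ζ : ℝ → X,
      (∀ t ∈ Set.Icc 0 T, HasDerivWithinAt ζ (G.conj K t (ζ t)) (Set.Icc 0 T) t) →
      ∀ t ∈ Set.Ico 0 T, HasDerivWithinAt ζ (G.conj K t (ζ t)) (Set.Ici t) t := by
    intro ζ hζ t ht
    exact (hζ t ⟨ht.1, ht.2.le⟩).mono_of_mem_nhdsWithin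
      (Filter.mem_of_superset (Icc_mem_nhdsGE ht.2) (Set.Icc_subset_Icc_left ht.1))
  exact ODE_solution_unique (v := fun t => G.conj K t) (fun t => G.lipschitzWith_conj K t)
    (fun t ht => (hξ t ht).continuousWithinAt) (aux ξ hξ)
    (fun t ht => (hη t ht).continuousWithinAt) (aux η hη) h

theorem exists_propagator : ∃ Ξ : ℝ → X →L[ℝ] X, (∀ x, Ξ 0 x = x) ∧
    (∀ x t, HasDerivAt (fun t => Ξ t x) (G.conj K t (Ξ t x)) t) ∧
    ∀ t x, ‖Ξ t x‖ ≤ 2 * Real.cosh (2 * (‖K‖ + 1) * t) * ‖x‖ := by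
  choose ξ hc hi hb using G.exists_integral_solution K
  have hd := fun x => G.hasDerivAt_of_integral_eq K (hc x) (hi x)
  have h0 : ∀ x, ξ x 0 = x := fun x => by simpa using hi x 0
  have hadd : ∀ x y, ξ (x + y) = fun t => ξ x t + ξ y t := fun x y =>
    G.conj_unique K (hd _) (fun t => by rw [map_add]; exact (hd x t).add (hd y t))
      (by simp [h0])
  have hsmul : ∀ (r : ℝ) x, ξ (r • x) = fun t => r • ξ x t := fun r x =>
    G.conj_unique K (hd _) (fun t => by rw [map_smul]; exact (hd x t).const_smul r)
      (by simp [h0])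
  refine ⟨fun t => LinearMap.mkContinuous
    { toFun := fun x => ξ x t
      map_add' := fun x y => by rw [hadd]
      map_smul' := fun r x => by rw [hsmul]; rfl } _ fun x => hb x t, h0, hd, fun t x => hb x t⟩

/-- The propagator of the perturbed equation in the interaction picture. -/
def prop (t : ℝ) : X →L[ℝ] X := Classical.choose (G.exists_propagator K) t

theorem prop_zero (x : X) : G.prop K 0 x = x := (Classical.choose_spec (G.exists_propagator K)).1 x

theorem hasDerivAt_prop (x : X) (t : ℝ) :
    HasDerivAt (fun t => G.prop K t x) (G.conj K t (G.prop K t x)) t :=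
  (Classical.choose_spec (G.exists_propagator K)).2.1 x t

theorem norm_prop_le (t : ℝ) (x : X) :
    ‖G.prop K t x‖ ≤ 2 * Real.cosh (2 * (‖K‖ + 1) * t) * ‖x‖ :=
  (Classical.choose_spec (G.exists_propagator K)).2.2 t x

/-- The group generated by the bounded perturbation `K` of the generator of `G`. -/
def evol (t : ℝ) : X →L[ℝ] X := (G.U t).comp (G.prop K t)

theorem neg_evol (t : ℝ) (x : X) : G.U (-t) (G.evol K t x) = G.prop K t x := G.neg_apply _ _

theorem evol_zero (x : X) : G.evol K 0 x = x := by
  change G.U 0 (G.prop K 0 x) = x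
  rw [G.zero, prop_zero]

theorem continuous_prop (x : X) : Continuous fun t => G.prop K t x :=
  continuous_iff_continuousAt.mpr fun t => (G.hasDerivAt_prop K x t).continuousAt

theorem continuous_evol (x : X) : Continuous fun t => G.evol K t x :=
  G.continuous_apply (G.continuous_prop K x)

theorem norm_evol_le (t : ℝ) (x : X) :
    ‖G.evol K t x‖ ≤ 2 * Real.cosh (2 * (‖K‖ + 1) * t) * ‖x‖ :=
  (G.norm_map _ _).trans_le (G.norm_prop_le K t x)

theorem exists_evol_bound (T : ℝ) : ∃ M, 0 < M ∧ ∀ t, |t| ≤ T → ∀ x, ‖G.evol K t x‖ ≤ M * ‖x‖ := by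
  refine ⟨2 * Real.cosh (2 * (‖K‖ + 1) * T), by have := Real.cosh_pos (2 * (‖K‖ + 1) * T); positivity,
    fun t ht x => (G.norm_evol_le K t x).trans ?_⟩
  gcongr 2 * ?_ * _
  rw [Real.cosh_le_cosh]
  simp only [abs_mul]
  exact mul_le_mul_of_nonneg_left (ht.trans (le_abs_self T)) (by positivity)

theorem hasDerivAt_neg_evol (x : X) (t : ℝ) :
    HasDerivAt (fun t => G.U (-t) (G.evol K t x)) (G.U (-t) (K (G.evol K t x))) t := by
  simp only [neg_evol]
  exact G.hasDerivAt_prop K x t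

/-- In the interaction picture `U(-t) x(t)` the unbounded generator disappears and a linear equation
with bounded coefficients remains; uniqueness there is Grönwall's. -/
theorem eq_evol {x : ℝ → X}
    (hx : ∀ t, HasDerivAt (fun t => G.U (-t) (x t)) (G.U (-t) (K (x t))) t) (t : ℝ) :
    x t = G.evol K t (x 0) := by
  have h := G.conj_unique K (ξ := fun t => G.U (-t) (x t)) (η := fun t => G.prop K t (x 0))
    (fun t => by rw [conj_apply, apply_neg]; exact hx t) (G.hasDerivAt_prop K (x 0))
    (by simp [prop_zero, G.zero])
  have h2 := congrArg (G.U t) (congrFun h t)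
  simp only [apply_neg] at h2
  exact h2

theorem eqOn_evol {T : ℝ} {x : ℝ → X} (hx : ∀ t ∈ Set.Icc 0 T,
    HasDerivWithinAt (fun t => G.U (-t) (x t)) (G.U (-t) (K (x t))) (Set.Icc 0 T) t) {t : ℝ}
    (ht : t ∈ Set.Icc 0 T) : x t = G.evol K t (x 0) := by
  have h := G.conj_unique_Icc K (ξ := fun t => G.U (-t) (x t)) (η := fun t => G.prop K t (x 0))
    (fun t ht => by rw [conj_apply, apply_neg]; exact hx t ht)
    (fun t ht => (G.hasDerivAt_prop K (x 0) t).hasDerivWithinAt)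
    (by simp [prop_zero, G.zero])
  have h2 := congrArg (G.U t) (h ht)
  simp only [apply_neg] at h2
  exact h2

theorem evol_add (t r : ℝ) (x : X) : G.evol K (t + r) x = G.evol K t (G.evol K r x) := by
  have h := G.eq_evol K (x := fun t => G.evol K (t + r) x) (fun t => ?_) t
  · simpa using h
  · have h1 := (G.U r).hasFDerivAt.comp_hasDerivAt t
      ((G.hasDerivAt_neg_evol K x (t + r)).comp_add_const t r)
    have h2 : ∀ (t : ℝ) y, G.U r (G.U (-(t + r)) y) = G.U (-t) y := by
      intro t y
      rw [← G.add]; congr 2; ring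
    simpa only [Function.comp_def, h2] using h1

theorem evol_evol_neg (t : ℝ) (x : X) : G.evol K t (G.evol K (-t) x) = x := by
  rw [← evol_add, add_neg_cancel, evol_zero]

/-- If `Λ` intertwines the free group with itself and `K` with `K'`, the image of a `K`-evolution
solves the `K'`-equation. No injectivity or inverse of `Λ` is needed. -/
theorem map_evol {K' Λ : X →L[ℝ] X} (hU : ∀ t x, Λ (G.U t x) = G.U t (Λ x))
    (hK : ∀ x, Λ (K x) = K' (Λ x)) (t : ℝ) (x : X) :
    Λ (G.evol K t x) = G.evol K' t (Λ x) := by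
  have h := G.eq_evol K' (x := fun t => Λ (G.evol K t x)) (fun t => ?_) t
  · simpa [evol_zero] using h
  · have h1 := Λ.hasFDerivAt.comp_hasDerivAt t (G.hasDerivAt_neg_evol K x t)
    simpa only [Function.comp_def, hU, hK] using h1

/-- In the interaction picture the derivatives of the two factors cancel, since one generator is
minus the adjoint of the other. This conserved pairing carries the duality between observation and
control. -/
theorem inner_evol_adjoint (t : ℝ) (p x : X) :
    inner ℝ (G.evol (-ContinuousLinearMap.adjoint K) t p) (G.evol K t x) = inner ℝ p x := by
  set K' := -ContinuousLinearMap.adjoint K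
  have hd : ∀ t, HasDerivAt (fun t => inner ℝ (G.prop K' t p) (G.prop K t x)) 0 t := by
    intro t
    convert! (G.hasDerivAt_prop K' p t).inner ℝ (G.hasDerivAt_prop K x t) using 1
    rw [conj_apply, conj_apply, ← G.inner_right, G.inner_neg_left]
    simp [K', ContinuousLinearMap.adjoint_inner_left]
  have hc := is_const_of_deriv_eq_zero (fun t => (hd t).differentiableAt)
    (fun t => (hd t).deriv) t 0
  simp only [prop_zero] at hc
  rw [← hc]
  exact G.inner_map _ _ _

end Existence

end UnitaryGroup

end Cascade

/-! ### The phase space and its wave group. -/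

namespace Cascade

/-- A product rule for operators that are only uniformly bounded and strongly continuous.
Differentiability of `L` is required at the single vector `y t`, so it applies to unitary groups on
smooth data. -/
theorem hasDerivWithinAt_clm_apply {E F : Type*} [NormedAddCommGroup E] [NormedSpace ℝ E]
    [NormedAddCommGroup F] [NormedSpace ℝ F] {L : ℝ → E →L[ℝ] F} {C : ℝ}
    (hb : ∀ r x, ‖L r x‖ ≤ C * ‖x‖) (hc : ∀ x, Continuous fun r => L r x) {y : ℝ → E} {y' : E}
    {d : F} {I : Set ℝ} {t : ℝ} (hd : HasDerivAt (fun r => L r (y t)) d t)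
    (hy : HasDerivWithinAt y y' I t) :
    HasDerivWithinAt (fun r => L r (y r)) (d + L t y') I t := by
  have h2 : HasDerivWithinAt (fun r => L r (y r - y t)) (L t y') I t := by
    rw [hasDerivWithinAt_iff_isLittleO] at hy ⊢
    have h1 : (fun r => L r (y r - y t - (r - t) • y')) =o[nhdsWithin t I] fun r => r - t := by
      refine Asymptotics.IsBigO.trans_isLittleO ?_ hy
      exact Asymptotics.IsBigO.of_bound C (Filter.Eventually.of_forall fun r => hb r _)
    have h3 : (fun r => (r - t) • (L r y' - L t y')) =o[nhdsWithin t I] fun r => r - t := by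
      have h4 : (fun r => L r y' - L t y') =o[nhdsWithin t I] fun _ => (1 : ℝ) := by
        rw [Asymptotics.isLittleO_one_iff]
        have := ((hc y').continuousAt (x := t)).continuousWithinAt (s := I)
        simpa using this.tendsto.sub_const (L t y')
      simpa using (Asymptotics.isBigO_refl (fun r : ℝ => r - t) (nhdsWithin t I)).smul_isLittleO h4
    refine (h1.add h3).congr_left fun r => ?_
    simp only [map_sub, map_smul, smul_sub, sub_self, map_zero, sub_zero]
    abel
  have e : (fun r => L r (y r)) = (fun r => L r (y t)) + fun r => L r (y r - y t) := by
    funext r; simp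
  rw [e]
  exact hd.hasDerivWithinAt.add h2

/-- The phase space `H × H` with its Hilbert structure. -/
abbrev Ph (H : Type*) := WithLp 2 (H × H)

section Ph

variable {H : Type*} [NormedAddCommGroup H] [InnerProductSpace ℝ H]

/-- The pair `(a, b)` as an element of the phase space. -/
abbrev ph (a b : H) : Ph H := WithLp.toLp 2 (a, b)

theorem Ph.ext {x y : Ph H} (h1 : x.fst = y.fst) (h2 : x.snd = y.snd) : x = y :=
  WithLp.ofLp_injective 2 (Prod.ext h1 h2)

theorem Ph.norm_sq (x : Ph H) : ‖x‖ ^ 2 = ‖x.fst‖ ^ 2 + ‖x.snd‖ ^ 2 :=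
  WithLp.prod_norm_sq_eq_of_L2 x

theorem Ph.inner_def (x y : Ph H) :
    inner ℝ x y = inner ℝ x.fst y.fst + inner ℝ x.snd y.snd := rfl

theorem Ph.norm_fst_le (x : Ph H) : ‖x.fst‖ ≤ ‖x‖ := by
  rw [← sq_le_sq₀ (norm_nonneg _) (norm_nonneg _), Ph.norm_sq]
  nlinarith [sq_nonneg ‖x.snd‖]

/-- The operator on the phase space given by a two by two matrix of operators. -/
def phMat (L₁ L₂ L₃ L₄ : H →L[ℝ] H) : Ph H →L[ℝ] Ph H :=
  ((WithLp.prodContinuousLinearEquiv 2 ℝ H H).symm : H × H →L[ℝ] Ph H).comp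
    (((L₁.comp (WithLp.fstL 2 ℝ H H) + L₂.comp (WithLp.sndL 2 ℝ H H)).prod
      (L₃.comp (WithLp.fstL 2 ℝ H H) + L₄.comp (WithLp.sndL 2 ℝ H H))))

@[simp]
theorem phMat_fst (L₁ L₂ L₃ L₄ : H →L[ℝ] H) (x : Ph H) :
    (phMat L₁ L₂ L₃ L₄ x).fst = L₁ x.fst + L₂ x.snd := rfl

@[simp]
theorem phMat_snd (L₁ L₂ L₃ L₄ : H →L[ℝ] H) (x : Ph H) :
    (phMat L₁ L₂ L₃ L₄ x).snd = L₃ x.fst + L₄ x.snd := rfl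

theorem Ph.hasDerivWithinAt {f : ℝ → Ph H} {f' : Ph H} {I : Set ℝ} {t : ℝ}
    (h1 : HasDerivWithinAt (fun t => (f t).fst) f'.fst I t)
    (h2 : HasDerivWithinAt (fun t => (f t).snd) f'.snd I t) : HasDerivWithinAt f f' I t :=
  (WithLp.prodContinuousLinearEquiv 2 ℝ H H).symm.hasFDerivAt.comp_hasDerivWithinAt t
    (h1.prodMk h2)

theorem Ph.hasDerivAt {f : ℝ → Ph H} {f' : Ph H} {t : ℝ}
    (h1 : HasDerivAt (fun t => (f t).fst) f'.fst t)
    (h2 : HasDerivAt (fun t => (f t).snd) f'.snd t) : HasDerivAt f f' t :=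
  (WithLp.prodContinuousLinearEquiv 2 ℝ H H).symm.hasFDerivAt.comp_hasDerivAt t
    (h1.prodMk h2)

theorem _root_.HasDerivWithinAt.phFst {f : ℝ → Ph H} {f' : Ph H} {I : Set ℝ} {t : ℝ}
    (h : HasDerivWithinAt f f' I t) : HasDerivWithinAt (fun t => (f t).fst) f'.fst I t :=
  (WithLp.fstL 2 ℝ H H).hasFDerivAt.comp_hasDerivWithinAt t h

theorem _root_.HasDerivWithinAt.phSnd {f : ℝ → Ph H} {f' : Ph H} {I : Set ℝ} {t : ℝ}
    (h : HasDerivWithinAt f f' I t) : HasDerivWithinAt (fun t => (f t).snd) f'.snd I t :=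
  (WithLp.sndL 2 ℝ H H).hasFDerivAt.comp_hasDerivWithinAt t h

theorem _root_.Continuous.phFst {α : Type*} [TopologicalSpace α] {f : α → Ph H}
    (h : Continuous f) : Continuous fun t => (f t).fst := (WithLp.fstL 2 ℝ H H).continuous.comp h

theorem _root_.Continuous.phSnd {α : Type*} [TopologicalSpace α] {f : α → Ph H}
    (h : Continuous f) : Continuous fun t => (f t).snd := (WithLp.sndL 2 ℝ H H).continuous.comp h

theorem _root_.Continuous.ph {α : Type*} [TopologicalSpace α] {f g : α → H}
    (hf : Continuous f) (hg : Continuous g) : Continuous fun t => ph (f t) (g t) :=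
  (WithLp.prodContinuousLinearEquiv 2 ℝ H H).symm.continuous.comp (hf.prodMk hg)

theorem _root_.ContinuousOn.ph {α : Type*} [TopologicalSpace α] {f g : α → H} {I : Set α}
    (hf : ContinuousOn f I) (hg : ContinuousOn g I) : ContinuousOn (fun t => ph (f t) (g t)) I :=
  (WithLp.prodContinuousLinearEquiv 2 ℝ H H).symm.continuous.comp_continuousOn (hf.prodMk hg)

end Ph

namespace WaveGroup

variable {H : Type*} [NormedAddCommGroup H] [InnerProductSpace ℝ H] (W : WaveGroup H)

/-- The unitary group of `a' = S⁻¹ b`, `b' = - S⁻¹ a`. -/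
def phase : UnitaryGroup (Ph H) where
  U t := phMat (W.c t) (W.s t) (-W.s t) (W.c t)
  zero x := Ph.ext (by simp [W.c_zero, W.s_zero]) (by simp [W.c_zero, W.s_zero])
  add t r x := by
    refine Ph.ext ?_ ?_
    · simp [W.c_add, W.s_add]; abel
    · simp [W.c_add, W.s_add]; abel
  inner_map t x y := by
    have h1 : ∀ u, W.c t (W.c t u) + W.s t (W.s t u) = u := by
      intro u
      have := W.c_add t (-t) u
      rw [add_neg_cancel, W.c_zero, W.c_neg, W.s_neg, map_neg] at this
      rw [sub_neg_eq_add] at this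
      exact this.symm
    have h2 : ∀ u, W.c t (W.s t u) = W.s t (W.c t u) := by
      intro u
      have := W.s_add t (-t) u
      rw [add_neg_cancel, W.s_zero, W.c_neg, W.s_neg, map_neg] at this
      rw [eq_comm, add_neg_eq_zero] at this
      exact this.symm
    simp only [Ph.inner_def, phMat_fst, phMat_snd, neg_apply, inner_add_left,
      inner_add_right, inner_neg_left, inner_neg_right, W.c_symm, W.s_symm]
    conv_rhs => rw [← h1 y.fst, ← h1 y.snd]
    simp only [inner_add_right, h2]
    ring
  cont x := by
    have h1 := W.c_cont
    have h2 := W.s_cont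
    exact Continuous.ph ((h1 _).add (h2 _)) ((h2 _).neg.add (h1 _))

/-- The operator `S` acting on both components. -/
def Sph : Ph H →L[ℝ] Ph H := phMat W.S 0 0 W.S

/-- The rotation `(a, b) ↦ (b, -a)`. -/
def rot (H : Type*) [NormedAddCommGroup H] [InnerProductSpace ℝ H] : Ph H →L[ℝ] Ph H :=
  phMat 0 (.id ℝ H) (-.id ℝ H) 0

theorem U_fst (t : ℝ) (x : Ph H) : (W.phase.U t x).fst = W.c t x.fst + W.s t x.snd := rfl

theorem U_snd (t : ℝ) (x : Ph H) : (W.phase.U t x).snd = -W.s t x.fst + W.c t x.snd := rfl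

theorem Sph_fst (x : Ph H) : (W.Sph x).fst = W.S x.fst := by simp [Sph]

theorem Sph_snd (x : Ph H) : (W.Sph x).snd = W.S x.snd := by simp [Sph]

theorem rot_fst (x : Ph H) : (rot H x).fst = x.snd := by simp [rot]

theorem rot_snd (x : Ph H) : (rot H x).snd = -x.fst := by simp [rot]

theorem Sph_inj {x : Ph H} (h : W.Sph x = 0) : x = 0 :=
  Ph.ext (W.S_inj _ (by rw [← Sph_fst, h]; rfl)) (W.S_inj _ (by rw [← Sph_snd, h]; rfl))

theorem Sph_injective : Function.Injective W.Sph :=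
  (injective_iff_map_eq_zero _).mpr fun _ => W.Sph_inj

theorem rot_rot (x : Ph H) : rot H (rot H x) = -x :=
  Ph.ext (by rw [rot_fst, rot_snd]; rfl) (by rw [rot_snd, rot_fst]; rfl)

theorem rot_Sph (x : Ph H) : rot H (W.Sph x) = W.Sph (rot H x) :=
  Ph.ext (by simp [rot_fst, Sph_fst, Sph_snd]) (by simp [rot_snd, Sph_fst, Sph_snd])

theorem rot_U (t : ℝ) (x : Ph H) : rot H (W.phase.U t x) = W.phase.U t (rot H x) := by
  refine Ph.ext ?_ ?_
  · simp only [rot_fst, rot_snd, U_fst, U_snd, map_neg]; abel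
  · simp only [rot_fst, rot_snd, U_fst, U_snd, map_neg]; abel

theorem Sph_U (t : ℝ) (x : Ph H) : W.Sph (W.phase.U t x) = W.phase.U t (W.Sph x) := by
  refine Ph.ext ?_ ?_ <;>
  simp only [Sph_fst, Sph_snd, U_fst, U_snd, map_neg, map_add, W.c_comm, W.s_comm]

theorem inner_rot (x y : Ph H) : inner ℝ (rot H x) (rot H y) = inner ℝ x y := by
  simp only [Ph.inner_def, rot_fst, rot_snd, inner_neg_neg]; ring

theorem norm_rot (x : Ph H) : ‖rot H x‖ = ‖x‖ := by
  rw [← sq_eq_sq₀ (norm_nonneg _) (norm_nonneg _), ← real_inner_self_eq_norm_sq, inner_rot,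
    real_inner_self_eq_norm_sq]

theorem hasDerivAt_U (x : Ph H) (t : ℝ) :
    HasDerivAt (fun t => W.phase.U t (W.Sph x)) (rot H (W.phase.U t x)) t := by
  simp only [← Sph_U]
  refine Ph.hasDerivAt ?_ ?_
  · simp only [Sph_fst, U_fst, rot_fst, U_snd, map_add]
    exact (W.c_deriv _ t).add (W.s_deriv _ t)
  · simp only [Sph_snd, U_fst, rot_snd, U_snd, map_add, map_neg, neg_add]
    convert! (W.s_deriv x.fst t).neg.add (W.c_deriv x.snd t) using 1

theorem hasDerivAt_U_neg (x : Ph H) (t : ℝ) :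
    HasDerivAt (fun t => W.phase.U (-t) (W.Sph x)) (-rot H (W.phase.U (-t) x)) t := by
  have := (W.hasDerivAt_U x (-t)).scomp t (hasDerivAt_neg t)
  simpa [Function.comp_def] using this

end WaveGroup

end Cascade

/-! ### Finite powers of `H`. -/

namespace Cascade

section PiLift

variable {H : Type*} [NormedAddCommGroup H] [InnerProductSpace ℝ H] {ι : Type*} [Fintype ι]

/-- The Hilbert space `H^ι`. -/
abbrev Pw (ι H : Type*) := PiLp 2 fun _ : ι => H

theorem Pw.hasDerivWithinAt {f : ℝ → Pw ι H} {f' : Pw ι H} {I : Set ℝ} {t : ℝ}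
    (h : ∀ i, HasDerivWithinAt (fun t => f t i) (f' i) I t) : HasDerivWithinAt f f' I t :=
  (PiLp.continuousLinearEquiv 2 ℝ fun _ : ι => H).symm.hasFDerivAt.comp_hasDerivWithinAt t
    (hasDerivWithinAt_pi.mpr h)

theorem Pw.hasDerivAt {f : ℝ → Pw ι H} {f' : Pw ι H} {t : ℝ}
    (h : ∀ i, HasDerivAt (fun t => f t i) (f' i) t) : HasDerivAt f f' t :=
  (PiLp.continuousLinearEquiv 2 ℝ fun _ : ι => H).symm.hasFDerivAt.comp_hasDerivAt t
    (hasDerivAt_pi.mpr h)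

theorem Pw.continuous {α : Type*} [TopologicalSpace α] {f : α → Pw ι H}
    (h : ∀ i, Continuous fun t => f t i) : Continuous f :=
  (PiLp.continuousLinearEquiv 2 ℝ fun _ : ι => H).symm.continuous.comp (continuous_pi h)

theorem Pw.continuousOn {α : Type*} [TopologicalSpace α] {f : α → Pw ι H} {I : Set α}
    (h : ∀ i, ContinuousOn (fun t => f t i) I) : ContinuousOn f I :=
  (PiLp.continuousLinearEquiv 2 ℝ fun _ : ι => H).symm.continuous.comp_continuousOn
    (continuousOn_pi.mpr h)

/-- The operator given by a matrix of operators. -/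
def pwMat (K : ι → ι → H →L[ℝ] H) : Pw ι H →L[ℝ] Pw ι H :=
  ((PiLp.continuousLinearEquiv 2 ℝ fun _ : ι => H).symm : (ι → H) →L[ℝ] Pw ι H).comp
    (ContinuousLinearMap.pi fun i => ∑ j, (K i j).comp (PiLp.proj 2 (fun _ : ι => H) j))

theorem pwMat_apply (K : ι → ι → H →L[ℝ] H) (x : Pw ι H) (i : ι) :
    pwMat K x i = ∑ j, K i j (x j) := by
  change (∑ j, (K i j).comp (PiLp.proj 2 (fun _ : ι => H) j)) x = _
  rw [sum_apply]
  rfl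

/-- The operator acting diagonally. -/
def pwDiag (L : ι → H →L[ℝ] H) : Pw ι H →L[ℝ] Pw ι H :=
  ((PiLp.continuousLinearEquiv 2 ℝ fun _ : ι => H).symm : (ι → H) →L[ℝ] Pw ι H).comp
    (ContinuousLinearMap.pi fun i => (L i).comp (PiLp.proj 2 (fun _ : ι => H) i))

theorem pwDiag_apply (L : ι → H →L[ℝ] H) (x : Pw ι H) (i : ι) : pwDiag L x i = L i (x i) := rfl

/-- The wave group acting componentwise on `H^ι`. -/
def WaveGroup.pi (W : WaveGroup H) (ι : Type*) [Fintype ι] : WaveGroup (Pw ι H) where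
  S := pwDiag fun _ => W.S
  c t := pwDiag fun _ => W.c t
  s t := pwDiag fun _ => W.s t
  S_symm x y := by simp only [PiLp.inner_apply, pwDiag_apply, W.S_symm]
  S_inj x h := PiLp.ext fun i => W.S_inj _ (congrArg (fun z : Pw ι H => z i) h)
  c_symm t x y := by simp only [PiLp.inner_apply, pwDiag_apply, W.c_symm]
  s_symm t x y := by simp only [PiLp.inner_apply, pwDiag_apply, W.s_symm]
  c_comm t x := PiLp.ext fun i => W.c_comm t (x i)
  s_comm t x := PiLp.ext fun i => W.s_comm t (x i)
  c_zero x := PiLp.ext fun i => W.c_zero (x i)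
  s_zero x := PiLp.ext fun i => W.s_zero (x i)
  c_add t r x := PiLp.ext fun i => W.c_add t r (x i)
  s_add t r x := PiLp.ext fun i => W.s_add t r (x i)
  c_neg t x := PiLp.ext fun i => W.c_neg t (x i)
  s_neg t x := PiLp.ext fun i => W.s_neg t (x i)
  c_cont x := Pw.continuous fun i => W.c_cont (x i)
  s_cont x := Pw.continuous fun i => W.s_cont (x i)
  c_deriv x t := Pw.hasDerivAt fun i => W.c_deriv (x i) t
  s_deriv x t := Pw.hasDerivAt fun i => W.s_deriv (x i) t

theorem WaveGroup.pi_S_apply (W : WaveGroup H) (x : Pw ι H) (i : ι) :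
    (W.pi ι).S x i = W.S (x i) := rfl

end PiLift

/-! ### Mild solutions of the wave equation. -/

namespace WaveGroup

variable {H : Type*} [NormedAddCommGroup H] [InnerProductSpace ℝ H] (W : WaveGroup H)

/-- Mild solutions of `x' = 𝒜 x + g` on `I`, where `𝒜 (a, b) = (S⁻¹ b, - S⁻¹ a)`, in the
form `(S x)' = (b, -a) + S g`. -/
structure MildOn (I : Set ℝ) (x g : ℝ → Ph H) : Prop where
  cont : ContinuousOn x I
  source : ContinuousOn g I
  deriv : ∀ t ∈ I, HasDerivWithinAt (fun t => W.Sph (x t)) (rot H (x t) + W.Sph (g t)) I t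

variable {W}

theorem MildOn.mono {I I' : Set ℝ} {x g : ℝ → Ph H} (h : W.MildOn I x g) (hI : I' ⊆ I) :
    W.MildOn I' x g :=
  ⟨h.cont.mono hI, h.source.mono hI, fun t ht => (h.deriv t (hI ht)).mono hI⟩

/-- After smoothing by `S` the product rule applies, and the two generator terms `±rot` cancel,
leaving the source alone. -/
theorem MildOn.hasDerivWithinAt_Sph {I : Set ℝ} {x g : ℝ → Ph H} (h : W.MildOn I x g) {t : ℝ}
    (ht : t ∈ I) : HasDerivWithinAt (fun t => W.Sph (W.Sph (W.phase.U (-t) (x t))))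
      (W.Sph (W.Sph (W.phase.U (-t) (g t)))) I t := by
  have key := hasDerivWithinAt_clm_apply (L := fun r => W.Sph.comp (W.phase.U (-r))) (C := ‖W.Sph‖)
    (fun r x => (W.Sph.le_opNorm _).trans_eq
      (congrArg (‖W.Sph‖ * ·) (W.phase.norm_map _ _)))
    (fun x => W.Sph.continuous.comp ((W.phase.cont x).comp continuous_neg))
    (y := fun r => W.Sph (x r)) (t := t) (d := -W.Sph (rot H (W.phase.U (-t) (x t)))) ?_
    (h.deriv t ht)
  · simp only [ContinuousLinearMap.comp_apply, map_add, ← W.Sph_U] at key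
    convert! key using 1
    rw [← W.rot_U, neg_add_cancel_left]
  · have := W.Sph.hasFDerivAt.comp_hasDerivAt t (W.hasDerivAt_U_neg (x t) t)
    simpa [Function.comp_def] using this

variable [CompleteSpace H]

/-- Duhamel's formula. The candidate `U(-t) x(t) - ∫ U(-r) g(r)` has zero derivative after the
injective smoothing `Sph ∘ Sph`, so it is constant. The integrand is extended continuously outside
the interval to make its primitive differentiable everywhere. -/
theorem MildOn.hasDerivWithinAt_Icc {p q : ℝ} {x g : ℝ → Ph H} (h : W.MildOn (Set.Icc p q) x g)
    {t : ℝ} (ht : t ∈ Set.Icc p q) : HasDerivWithinAt (fun t => W.phase.U (-t) (x t))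
      (W.phase.U (-t) (g t)) (Set.Icc p q) t := by
  have hpq : p ≤ q := ht.1.trans ht.2
  set F : ℝ → Ph H := Set.IccExtend hpq ((Set.Icc p q).domRestrict fun t => W.phase.U (-t) (g t))
  have hF : Continuous F := by
    refine Continuous.Icc_extend' ?_
    exact (W.phase.continuousOn_neg_apply h.source).domRestrict
  have hFe : ∀ t ∈ Set.Icc p q, F t = W.phase.U (-t) (g t) := fun t ht =>
    Set.IccExtend_of_mem hpq _ ht
  have hd : ∀ t, HasDerivAt (fun t => ∫ r in p..t, F r) (F t) t := fun t =>
    intervalIntegral.integral_hasDerivAt_right (hF.intervalIntegrable _ _)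
      hF.aestronglyMeasurable.stronglyMeasurableAtFilter hF.continuousAt
  set D : ℝ → Ph H := fun t => W.Sph (W.Sph (W.phase.U (-t) (x t) - ∫ r in p..t, F r))
  have hD : ∀ t ∈ Set.Icc p q, HasDerivWithinAt D 0 (Set.Icc p q) t := by
    intro t ht
    have h1 := h.hasDerivWithinAt_Sph ht
    have h2 := (W.Sph.comp W.Sph).hasFDerivAt.comp_hasDerivWithinAt t
      ((hd t).hasDerivWithinAt (s := Set.Icc p q))
    have h3 := h1.sub h2
    rw [ContinuousLinearMap.comp_apply, hFe t ht, sub_self] at h3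
    convert! h3 using 1
    funext r
    simp [D]
  have hconst : ∀ t ∈ Set.Icc p q, D t = D p :=
    constant_of_has_deriv_right_zero (fun t ht => (hD t ht).continuousWithinAt) fun t ht =>
      (hD t ⟨ht.1, ht.2.le⟩).mono_of_mem_nhdsWithin
        (Filter.mem_of_superset (Icc_mem_nhdsGE ht.2) (Set.Icc_subset_Icc_left ht.1))
  have heq : ∀ t ∈ Set.Icc p q,
      W.phase.U (-t) (x t) = W.phase.U (-p) (x p) + ∫ r in p..t, F r := by
    intro t ht
    have := W.Sph_injective (W.Sph_injective (hconst t ht))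
    rw [intervalIntegral.integral_same, sub_zero] at this
    rw [← this]; abel
  rw [← hFe t ht]
  exact (((hd t).const_add _).hasDerivWithinAt).congr heq (heq t ht)

theorem MildOn.hasDerivAt {x g : ℝ → Ph H} (h : W.MildOn Set.univ x g) (t : ℝ) :
    HasDerivAt (fun t => W.phase.U (-t) (x t)) (W.phase.U (-t) (g t)) t :=
  ((h.mono (Set.subset_univ (Set.Icc (t - 1) (t + 1)))).hasDerivWithinAt_Icc
    ⟨by linarith, by linarith⟩).hasDerivAt (Icc_mem_nhds (by linarith) (by linarith))

theorem mildOn_of_hasDerivAt {x g : ℝ → Ph H} (hg : Continuous g)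
    (h : ∀ t, HasDerivAt (fun t => W.phase.U (-t) (x t)) (W.phase.U (-t) (g t)) t) :
    W.MildOn Set.univ x g := by
  have hx : Continuous x := by
    have h1 : Continuous fun t => W.phase.U (-t) (x t) :=
      continuous_iff_continuousAt.mpr fun t => (h t).continuousAt
    have h2 := W.phase.continuous_apply h1
    simpa only [W.phase.apply_neg] using h2
  refine ⟨hx.continuousOn, hg.continuousOn, fun t _ => ?_⟩
  have key := hasDerivWithinAt_clm_apply (L := fun r => W.Sph.comp (W.phase.U r)) (C := ‖W.Sph‖)
    (fun r x => (W.Sph.le_opNorm _).trans_eq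
      (congrArg (‖W.Sph‖ * ·) (W.phase.norm_map _ _)))
    (fun x => W.Sph.continuous.comp (W.phase.cont x))
    (y := fun r => W.phase.U (-r) (x r)) (t := t) (d := rot H (x t)) ?_
    ((h t).hasDerivWithinAt (s := Set.univ))
  · simpa only [ContinuousLinearMap.comp_apply, W.phase.apply_neg] using key
  · have := W.hasDerivAt_U (W.phase.U (-t) (x t)) t
    simpa only [ContinuousLinearMap.comp_apply, W.Sph_U, W.phase.apply_neg] using this

/-- The bounded perturbation `(a, b) ↦ (0, - K a)`. -/
def pert (K : H →L[ℝ] H) : Ph H →L[ℝ] Ph H := phMat 0 0 (-K) 0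

theorem pert_fst (K : H →L[ℝ] H) (x : Ph H) : (pert K x).fst = 0 := by simp [pert]

theorem pert_snd (K : H →L[ℝ] H) (x : Ph H) : (pert K x).snd = -K x.fst := by simp [pert]

theorem evol_mildOn (K : Ph H →L[ℝ] Ph H) (x : Ph H) :
    W.MildOn Set.univ (fun t => W.phase.evol K t x) (fun t => K (W.phase.evol K t x)) :=
  mildOn_of_hasDerivAt (K.continuous.comp (W.phase.continuous_evol K x))
    (W.phase.hasDerivAt_neg_evol K x)

theorem MildOn.eq_evol {T : ℝ} {K : Ph H →L[ℝ] Ph H} {x : ℝ → Ph H}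
    (h : W.MildOn (Set.Icc 0 T) x fun t => K (x t)) {t : ℝ} (ht : t ∈ Set.Icc 0 T) :
    x t = W.phase.evol K t (x 0) :=
  W.phase.eqOn_evol K (fun _ ht => h.hasDerivWithinAt_Icc ht) ht

end WaveGroup

end Cascade

/-! ### Weighted integrals over the whole time line. -/

namespace Cascade

open MeasureTheory

section Weight

/-- The weight `exp (-λ √(1 + t²))`. -/
def wt (l t : ℝ) : ℝ := Real.exp (-l * √(1 + t ^ 2))

theorem wt_pos (l t : ℝ) : 0 < wt l t := Real.exp_pos _

theorem continuous_wt (l : ℝ) : Continuous (wt l) := by unfold wt; fun_prop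

theorem wt_le {l : ℝ} (hl : 0 ≤ l) (t : ℝ) : wt l t ≤ Real.exp (-l * |t|) := by
  refine Real.exp_le_exp.mpr ?_
  have : |t| ≤ √(1 + t ^ 2) := Real.abs_le_sqrt (by linarith)
  nlinarith

theorem wt_le_mul {l : ℝ} (hl : 0 ≤ l) (t r : ℝ) : wt l t ≤ Real.exp (l * |r|) * wt l (t + r) := by
  rw [wt, wt, ← Real.exp_add]
  refine Real.exp_le_exp.mpr ?_
  have : √(1 + (t + r) ^ 2) ≤ √(1 + t ^ 2) + |r| := by
    refine Real.sqrt_le_iff.mpr ⟨by positivity, ?_⟩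
    have h1 : |t| ≤ √(1 + t ^ 2) := Real.abs_le_sqrt (by linarith)
    have h2 := Real.sq_sqrt (show (0 : ℝ) ≤ 1 + t ^ 2 by positivity)
    have h3 : t * r ≤ |t| * |r| := by rw [← abs_mul]; exact le_abs_self _
    nlinarith [abs_nonneg r, sq_abs r, mul_le_mul_of_nonneg_right h1 (abs_nonneg r)]
  nlinarith

/-- The function `√(1 + t²)` replaces `|t|` to have a derivative at the origin, and the logarithmic
derivative of the weight still lies between `-l` and `l`. -/
theorem hasDerivAt_wt (l t : ℝ) : HasDerivAt (wt l) (-l * (t / √(1 + t ^ 2)) * wt l t) t := by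
  have h1 : HasDerivAt (fun t : ℝ => 1 + t ^ 2) (2 * t) t := by
    simpa using (hasDerivAt_pow 2 t).const_add 1
  have h2 := ((h1.sqrt (by positivity)).const_mul (-l)).exp
  unfold wt
  convert! h2 using 1
  have : √(1 + t ^ 2) ≠ 0 := (Real.sqrt_pos.mpr (by positivity)).ne'
  field_simp

theorem abs_div_sqrt_le (t : ℝ) : |t / √(1 + t ^ 2)| ≤ 1 := by
  rw [abs_div, abs_of_nonneg (Real.sqrt_nonneg _), div_le_one (Real.sqrt_pos.mpr (by positivity))]
  exact Real.abs_le_sqrt (by linarith)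

theorem integrable_exp_neg_abs {c : ℝ} (hc : 0 < c) :
    Integrable fun t : ℝ => Real.exp (-c * |t|) := by
  have hd : ∀ t : ℝ, Real.exp (-c * |t|) ≤ (1 + 2 / c ^ 2) * (1 + t ^ 2)⁻¹ := by
    intro t
    rw [neg_mul, Real.exp_neg, ← div_eq_mul_inv, inv_eq_one_div,
      div_le_div_iff₀ (Real.exp_pos _) (by positivity), one_mul]
    have h1 := Real.quadratic_le_exp_of_nonneg (show 0 ≤ c * |t| by positivity)
    have h2 : (0 : ℝ) ≤ c * |t| := by positivity
    calc 1 + t ^ 2 ≤ (1 + 2 / c ^ 2) * (1 + c * |t| + (c * |t|) ^ 2 / 2) := by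
          have : (2 / c ^ 2) * ((c * |t|) ^ 2 / 2) = t ^ 2 := by
            rw [mul_pow, sq_abs]; field_simp
          have h3 : 0 ≤ 2 / c ^ 2 := by positivity
          nlinarith [mul_nonneg h3 h2, sq_nonneg (c * |t|)]
      _ ≤ _ := by gcongr
  refine (integrable_inv_one_add_sq.const_mul (1 + 2 / c ^ 2)).mono' ?_
    (Filter.Eventually.of_forall fun t => ?_)
  · exact (by fun_prop : Continuous fun t : ℝ => Real.exp (-c * |t|)).aestronglyMeasurable
  · rw [Real.norm_of_nonneg (Real.exp_pos _).le]; exact hd t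

/-- Continuous functions of subexponential growth. -/
def Tame (h : ℝ → ℝ) : Prop :=
  Continuous h ∧ ∀ ε > (0 : ℝ), ∃ B, 0 ≤ B ∧ ∀ t, |h t| ≤ B * Real.exp (ε * |t|)

theorem Tame.of_le {h k : ℝ → ℝ} (hk : Tame k) (hc : Continuous h) {C : ℝ}
    (hle : ∀ t, |h t| ≤ C * |k t|) : Tame h := by
  refine ⟨hc, fun ε hε => ?_⟩
  obtain ⟨B, hB, h1⟩ := hk.2 ε hε
  refine ⟨|C| * B, by positivity, fun t => (hle t).trans ?_⟩
  rw [mul_assoc]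
  exact mul_le_mul (le_abs_self C) (h1 t) (abs_nonneg _) (abs_nonneg _)

theorem Tame.mul {h k : ℝ → ℝ} (hh : Tame h) (hk : Tame k) : Tame fun t => h t * k t := by
  refine ⟨hh.1.mul hk.1, fun ε hε => ?_⟩
  obtain ⟨B, hB, h1⟩ := hh.2 (ε / 2) (by positivity)
  obtain ⟨B', hB', h2⟩ := hk.2 (ε / 2) (by positivity)
  refine ⟨B * B', by positivity, fun t => ?_⟩
  rw [abs_mul]
  refine (mul_le_mul (h1 t) (h2 t) (abs_nonneg _) (by positivity)).trans_eq ?_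
  have : Real.exp (ε * |t|) = Real.exp (ε / 2 * |t|) * Real.exp (ε / 2 * |t|) := by
    rw [← Real.exp_add]; ring_nf
  rw [this]; ring

theorem Tame.add {h k : ℝ → ℝ} (hh : Tame h) (hk : Tame k) : Tame fun t => h t + k t := by
  refine ⟨hh.1.add hk.1, fun ε hε => ?_⟩
  obtain ⟨B, hB, h1⟩ := hh.2 ε hε
  obtain ⟨B', hB', h2⟩ := hk.2 ε hε
  refine ⟨B + B', by positivity, fun t => (abs_add_le _ _).trans ?_⟩
  rw [add_mul]
  exact add_le_add (h1 t) (h2 t)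

theorem Tame.const_mul {h : ℝ → ℝ} (hh : Tame h) (c : ℝ) : Tame fun t => c * h t :=
  hh.of_le (hh.1.const_mul c) (C := |c|) fun _ => (abs_mul _ _).le

theorem Tame.sq {h : ℝ → ℝ} (hh : Tame h) : Tame fun t => h t ^ 2 := by
  simpa only [pow_two] using hh.mul hh

theorem Tame.integrable {h : ℝ → ℝ} (hh : Tame h) {l : ℝ} (hl : 0 < l) :
    Integrable fun t => wt l t * h t := by
  obtain ⟨B, hB, h1⟩ := hh.2 (l / 2) (by positivity)
  refine ((integrable_exp_neg_abs (c := l / 2) (by positivity)).const_mul B).mono'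
    ((continuous_wt l).mul hh.1).aestronglyMeasurable (Filter.Eventually.of_forall fun t => ?_)
  rw [norm_mul, Real.norm_of_nonneg (wt_pos _ _).le, Real.norm_eq_abs]
  refine (mul_le_mul (wt_le hl.le t) (h1 t) (abs_nonneg _) (Real.exp_pos _).le).trans_eq ?_
  rw [mul_left_comm, ← Real.exp_add]; ring_nf

/-- The weighted integral. -/
def wint (l : ℝ) (h : ℝ → ℝ) : ℝ := ∫ t, wt l t * h t

theorem wint_nonneg {l : ℝ} {h : ℝ → ℝ} (hh : ∀ t, 0 ≤ h t) : 0 ≤ wint l h :=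
  integral_nonneg fun t => mul_nonneg (wt_pos l t).le (hh t)

theorem wint_mono {l : ℝ} (hl : 0 < l) {h k : ℝ → ℝ} (hh : Tame h) (hk : Tame k)
    (hle : ∀ t, h t ≤ k t) : wint l h ≤ wint l k :=
  integral_mono (hh.integrable hl) (hk.integrable hl) fun t =>
    mul_le_mul_of_nonneg_left (hle t) (wt_pos l t).le

theorem wint_add {l : ℝ} (hl : 0 < l) {h k : ℝ → ℝ} (hh : Tame h) (hk : Tame k) :
    wint l (fun t => h t + k t) = wint l h + wint l k := by
  rw [wint, wint, wint, ← integral_add (hh.integrable hl) (hk.integrable hl)]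
  simp only [mul_add]

theorem wint_const_mul (l c : ℝ) (h : ℝ → ℝ) : wint l (fun t => c * h t) = c * wint l h := by
  rw [wint, wint, ← integral_const_mul]
  simp only [mul_left_comm]

/-- Sliding averages are controlled by the weighted integral. -/
theorem integral_window_le {l τ : ℝ} (hl : 0 < l) (hτ : 0 < τ) (hlτ : l * τ ≤ 1) {h F : ℝ → ℝ}
    (hh : Tame h) (h0 : ∀ t, 0 ≤ h t) (hF : Tame F)
    (hle : ∀ s, F s ≤ ∫ r in (0 : ℝ)..τ, h (s + r)) :
    wint l F ≤ Real.exp 1 * τ * wint l h := by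
  -- Integrability on the strip allows the integrals over time and over the window to be exchanged.
  -- The growth bound with rate `l / 2` leaves half of the exponential decay.
  have hint : Integrable (Function.uncurry fun s r : ℝ => wt l s * h (s + r))
      (volume.prod (volume.restrict (Set.Ioc 0 τ))) := by
    obtain ⟨B, hB, h1⟩ := hh.2 (l / 2) (by positivity)
    have hdom : Integrable (fun z : ℝ × ℝ => B * Real.exp (l / 2 * τ) * Real.exp (-(l / 2) * |z.1|))
        (volume.prod (volume.restrict (Set.Ioc 0 τ))) :=
      ((integrable_exp_neg_abs (c := l / 2) (by positivity)).const_mul _).comp_fst _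
    refine hdom.mono' ?_ ?_
    · have hc1 := continuous_wt l
      have hc2 := hh.1
      exact (by fun_prop : Continuous fun z : ℝ × ℝ => wt l z.1 * h (z.1 + z.2)).aestronglyMeasurable
    · have hae : ∀ᵐ z : ℝ × ℝ ∂(volume.prod (volume.restrict (Set.Ioc 0 τ))), z.2 ∈ Set.Ioc 0 τ :=
        Measure.quasiMeasurePreserving_snd.ae (ae_restrict_mem measurableSet_Ioc)
      filter_upwards [hae] with z hz
      simp only [Function.uncurry]
      rw [norm_mul, Real.norm_of_nonneg (wt_pos _ _).le, Real.norm_eq_abs]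
      refine (mul_le_mul (wt_le hl.le _) (h1 _) (abs_nonneg _) (Real.exp_pos _).le).trans ?_
      rw [mul_left_comm, ← Real.exp_add, mul_assoc, ← Real.exp_add]
      refine mul_le_mul_of_nonneg_left (Real.exp_le_exp.mpr ?_) hB
      have h3 : |z.1 + z.2| ≤ |z.1| + τ :=
        (abs_add_le _ _).trans (by rw [abs_of_pos hz.1]; linarith [hz.2])
      nlinarith
  have h1 : wint l F ≤ ∫ s, ∫ r in Set.Ioc 0 τ, wt l s * h (s + r) := by
    refine integral_mono (hF.integrable hl) hint.integral_prod_left fun s => ?_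
    simp only
    rw [integral_const_mul, ← intervalIntegral.integral_of_le hτ.le]
    exact mul_le_mul_of_nonneg_left (hle s) (wt_pos _ _).le
  refine h1.trans ?_
  rw [integral_integral_swap hint]
  have h2 : ∫ r in Set.Ioc 0 τ, ∫ s, wt l s * h (s + r)
      ≤ ∫ r in Set.Ioc 0 τ, Real.exp 1 * wint l h := by
    refine setIntegral_mono_on hint.integral_prod_right (integrable_const _) measurableSet_Ioc fun r hr => ?_
    have h3 : Integrable fun s => wt l (s + r) * h (s + r) := (hh.integrable hl).comp_add_right r
    have h4 : ∫ s, wt l (s + r) * h (s + r) = wint l h :=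
      integral_add_right_eq_self (fun s => wt l s * h s) r
    rw [← h4, ← integral_const_mul]
    refine integral_mono_of_nonneg (Filter.Eventually.of_forall fun s =>
      mul_nonneg (wt_pos _ _).le (h0 _)) (h3.const_mul _) (Filter.Eventually.of_forall fun s => ?_)
    simp only
    rw [← mul_assoc]
    -- Translating the weight by `r ≤ τ` costs `exp (l r)`, at most `exp 1` because `l τ ≤ 1`. The
    -- final constant thus does not depend on `l`.
    refine mul_le_mul_of_nonneg_right ((wt_le_mul hl.le s r).trans ?_) (h0 _)
    refine mul_le_mul_of_nonneg_right (Real.exp_le_exp.mpr ?_) (wt_pos _ _).le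
    rw [abs_of_pos hr.1]
    nlinarith [hr.2]
  refine h2.trans_eq ?_
  rw [setIntegral_const, measureReal_def, Real.volume_Ioc, sub_zero, ENNReal.toReal_ofReal hτ.le,
    smul_eq_mul]
  ring

/-- The derivative of `wt l * φ` has integral zero over the line, so the integral of `φ'` is paid
for by the derivative of the weight, at most `l` times the weight. This factor `l` is the smallness
on which the induction rests. -/
theorem wint_deriv {l : ℝ} (hl : 0 < l) {φ φ' k : ℝ → ℝ} (hφ : ∀ t, HasDerivAt φ (φ' t) t)
    (hφt : Tame φ) (hφt' : Tame φ') (hk : Tame k) (hle : ∀ t, |φ t| ≤ k t) :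
    wint l φ' ≤ l * wint l k := by
  have hd : ∀ t, HasDerivAt (fun t => wt l t * φ t)
      (-l * (t / √(1 + t ^ 2)) * wt l t * φ t + wt l t * φ' t) t := fun t =>
    (hasDerivAt_wt l t).mul (hφ t)
  have hs : Continuous fun t : ℝ => t / √(1 + t ^ 2) := by
    refine continuous_id.div (by fun_prop) fun t => (Real.sqrt_pos.mpr (by positivity)).ne'
  have hT : Tame fun t => -l * (t / √(1 + t ^ 2)) * φ t := by
    refine hφt.of_le (by have := hφt.1; fun_prop) (C := l) fun t => ?_
    rw [abs_mul, abs_mul, abs_neg, abs_of_pos hl]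
    have := abs_div_sqrt_le t
    have : l * |t / √(1 + t ^ 2)| ≤ l := by nlinarith
    exact mul_le_mul_of_nonneg_right this (abs_nonneg _)
  have hi1 : Integrable fun t => -l * (t / √(1 + t ^ 2)) * wt l t * φ t :=
    (hT.integrable hl).congr (Filter.Eventually.of_forall fun t => by simp only; ring)
  have hz := integral_eq_zero_of_hasDerivAt_of_integrable hd (hi1.add (hφt'.integrable hl))
    (hφt.integrable hl)
  rw [integral_add hi1 (hφt'.integrable hl)] at hz
  have e1 : wint l φ' = wint l fun t => -(-l * (t / √(1 + t ^ 2)) * φ t) := by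
    have : ∫ t, -l * (t / √(1 + t ^ 2)) * wt l t * φ t
        = -wint l fun t => -(-l * (t / √(1 + t ^ 2)) * φ t) := by
      rw [wint, ← integral_neg]; congr 1; funext t; ring
    rw [this] at hz
    simp only [wint] at hz ⊢
    linarith
  rw [e1, ← wint_const_mul]
  refine wint_mono hl ?_ (hk.const_mul l) fun t => ?_
  · have := hT.const_mul (-1)
    simpa using this
  · refine (le_abs_self _).trans ?_
    rw [abs_neg, abs_mul, abs_mul, abs_neg, abs_of_pos hl, mul_assoc]
    refine mul_le_mul_of_nonneg_left ?_ hl.le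
    exact (mul_le_of_le_one_left (abs_nonneg _) (abs_div_sqrt_le t)).trans (hle t)

end Weight

end Cascade

/-! ### Chains, growth and the symplectic multiplier. -/

namespace Cascade

open MeasureTheory

namespace WaveGroup

variable {H : Type*} [NormedAddCommGroup H] [InnerProductSpace ℝ H] {W : WaveGroup H}

theorem MildOn.shift {x g : ℝ → Ph H} (h : W.MildOn Set.univ x g) (s : ℝ) :
    W.MildOn Set.univ (fun t => x (t + s)) (fun t => g (t + s)) := by
  have hx := continuousOn_univ.mp h.cont
  have hg := continuousOn_univ.mp h.source
  refine ⟨(by fun_prop : Continuous fun t => x (t + s)).continuousOn,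
    (by fun_prop : Continuous fun t => g (t + s)).continuousOn, fun t _ => ?_⟩
  rw [hasDerivWithinAt_univ]
  have := h.deriv (t + s) trivial
  rw [hasDerivWithinAt_univ] at this
  exact this.comp_add_const t s

variable [CompleteSpace H]

/-- Duhamel: the deviation from the free evolution is `U q` applied to an integral of `U(-r) g(r)`,
and all the operators involved are isometries. -/
theorem MildOn.norm_sub_le {p q : ℝ} (hpq : p ≤ q) {x g : ℝ → Ph H}
    (h : W.MildOn (Set.Icc p q) x g) :
    ‖x q - W.phase.U (q - p) (x p)‖ ≤ ∫ r in p..q, ‖g r‖ := by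
  have hc := W.phase.continuousOn_neg_apply h.source
  have h1 := intervalIntegral.integral_eq_sub_of_hasDeriv_right_of_le hpq
    (fun t ht => (h.hasDerivWithinAt_Icc ht).continuousWithinAt)
    (fun t ht => (h.hasDerivWithinAt_Icc ⟨ht.1.le, ht.2.le⟩).mono_of_mem_nhdsWithin
        (Filter.mem_of_superset (Icc_mem_nhdsGT ht.2) (Set.Icc_subset_Icc_left ht.1.le)))
    (hc.intervalIntegrable_of_Icc hpq)
  have h2 : x q - W.phase.U (q - p) (x p)
      = W.phase.U q (W.phase.U (-q) (x q) - W.phase.U (-p) (x p)) := by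
    rw [map_sub, W.phase.apply_neg, ← W.phase.add, sub_eq_add_neg q p]
  rw [h2, W.phase.norm_map, ← h1]
  refine (intervalIntegral.norm_integral_le_integral_norm hpq).trans_eq ?_
  simp only [W.phase.norm_map]

theorem MildOn.norm_le {p q : ℝ} (hpq : p ≤ q) {x g : ℝ → Ph H}
    (h : W.MildOn (Set.Icc p q) x g) : ‖x q‖ ≤ ‖x p‖ + ∫ r in p..q, ‖g r‖ := by
  have := norm_le_insert' (x q) (W.phase.U (q - p) (x p))
  rw [W.phase.norm_map] at this
  linarith [h.norm_sub_le hpq]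

theorem MildOn.norm_le_cosh {x g : ℝ → Ph H} (h : W.MildOn Set.univ x g) {ε M : ℝ} (hε : 0 < ε)
    (hM : 0 ≤ M) (hg : ∀ t, ‖g t‖ ≤ M * Real.cosh (ε * t)) (t : ℝ) :
    ‖x t‖ ≤ ‖x 0‖ + M / ε * Real.cosh (ε * t) := by
  have hc := W.phase.continuous_neg_apply (continuousOn_univ.mp h.source)
  have h1 := intervalIntegral.integral_eq_sub_of_hasDerivAt (a := 0) (b := t)
    (fun r _ => h.hasDerivAt r) (hc.intervalIntegrable _ _)
  rw [neg_zero, W.phase.zero] at h1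
  have h2 := UnitaryGroup.norm_integral_cosh_le (f := fun r => W.phase.U (-r) (g r)) hε t hM
    fun r => by rw [W.phase.norm_map]; exact hg r
  rw [h1] at h2
  have h3 := norm_le_insert' (W.phase.U (-t) (x t)) (x 0)
  rw [W.phase.norm_map] at h3
  linarith

theorem MildOn.hasDerivAt_inner {x y g k : ℝ → Ph H} (hx : W.MildOn Set.univ x g)
    (hy : W.MildOn Set.univ y k) (t : ℝ) :
    HasDerivAt (fun t => inner ℝ (x t) (rot H (y t)))
      (inner ℝ (g t) (rot H (y t)) + inner ℝ (x t) (rot H (k t))) t := by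
  have h1 := (hx.hasDerivAt t).inner ℝ ((rot H).hasFDerivAt.comp_hasDerivAt t (hy.hasDerivAt t))
  simp only [Function.comp_def, rot_U, W.phase.inner_map] at h1
  rw [add_comm]
  exact h1

/-- Solutions of a bidiagonal cascade system of length `m` in normalised variables: the `i`-th
component has the source `- K_{m-i,i} a_{i-1}`. -/
structure Chain (W : WaveGroup H) (K : ℕ → ℕ → H →L[ℝ] H) (m : ℕ) (x : ℕ → ℝ → Ph H) : Prop where
  zero : ∀ t, x 0 t = 0
  mild : ∀ i, 1 ≤ i → i ≤ m →
    W.MildOn Set.univ (x i) fun t => ph 0 (-K (m - i) i (x (i - 1) t).fst)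

theorem norm_ph_zero (a : H) : ‖ph 0 a‖ = ‖a‖ := by
  rw [← sq_eq_sq₀ (norm_nonneg _) (norm_nonneg _), Ph.norm_sq]
  simp

theorem norm_ph_neg_le (L : H →L[ℝ] H) (x : Ph H) : ‖ph 0 (-L x.fst)‖ ≤ ‖L‖ * ‖x‖ := by
  rw [norm_ph_zero, norm_neg]
  exact (L.le_opNorm _).trans (mul_le_mul_of_nonneg_left x.norm_fst_le (norm_nonneg _))

variable {K : ℕ → ℕ → H →L[ℝ] H} {m : ℕ}

theorem Chain.continuous {x : ℕ → ℝ → Ph H} (h : W.Chain K m x) {i : ℕ} (hi : i ≤ m) :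
    Continuous (x i) := by
  rcases Nat.eq_zero_or_pos i with rfl | hi0
  · rw [funext h.zero]; exact continuous_const
  · exact continuousOn_univ.mp (h.mild i hi0 hi).cont

/-- The free group is isometric and each component is driven only by the previous one, so a bound
`cosh (ε t)` passes up the chain at the price of `1/ε` each time. Any rate `ε > 0` is possible
because the coupling is nilpotent. -/
theorem exists_chain_growth (W : WaveGroup H) (K : ℕ → ℕ → H →L[ℝ] H) (m : ℕ) {ε : ℝ}
    (hε : 0 < ε) (i : ℕ) (hi : i ≤ m) : ∃ M, 0 ≤ M ∧ ∀ x, W.Chain K m x → ∀ t,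
      ‖x i t‖ ≤ M * (∑ j ∈ Finset.range (i + 1), ‖x j 0‖) * Real.cosh (ε * t) := by
  induction i with
  | zero =>
    refine ⟨0, le_rfl, fun x hx t => ?_⟩
    rw [hx.zero]; simp
  | succ i ih =>
    obtain ⟨M, hM, h⟩ := ih (by omega)
    refine ⟨1 + ‖K (m - (i + 1)) (i + 1)‖ * M / ε, by positivity, fun x hx t => ?_⟩
    set E := ∑ j ∈ Finset.range (i + 1), ‖x j 0‖
    have h0 : 0 ≤ E := Finset.sum_nonneg fun _ _ => norm_nonneg _
    have h1 := (hx.mild (i + 1) (by omega) hi).norm_le_cosh hε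
      (M := ‖K (m - (i + 1)) (i + 1)‖ * (M * E)) (by positivity) (fun t => by
        refine (norm_ph_neg_le _ _).trans ?_
        rw [mul_assoc]
        exact mul_le_mul_of_nonneg_left (h x hx t) (norm_nonneg _)) t
    rw [Finset.sum_range_succ]
    have hc := Real.one_le_cosh (ε * t)
    set c := Real.cosh (ε * t)
    set k := ‖K (m - (i + 1)) (i + 1)‖ * M / ε with hk
    have hk0 : 0 ≤ k := by positivity
    have e : ‖K (m - (i + 1)) (i + 1)‖ * (M * E) / ε = k * E := by rw [hk]; ring
    rw [e] at h1
    have hn := norm_nonneg (x (i + 1) 0)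
    nlinarith [mul_nonneg hk0 hn, mul_nonneg h0 (by linarith : 0 ≤ c),
      mul_nonneg (mul_nonneg hk0 hn) (by linarith : 0 ≤ c),
      mul_nonneg hn (by linarith : 0 ≤ c - 1)]

theorem cosh_le_exp_abs (ε t : ℝ) (hε : 0 ≤ ε) : Real.cosh (ε * t) ≤ Real.exp (ε * |t|) := by
  rw [← Real.cosh_abs, abs_mul, abs_of_nonneg hε, Real.cosh_eq]
  have : Real.exp (-(ε * |t|)) ≤ Real.exp (ε * |t|) :=
    Real.exp_le_exp.mpr (by have : 0 ≤ ε * |t| := by positivity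
                            linarith)
  linarith

theorem Chain.tame {x : ℕ → ℝ → Ph H} (h : W.Chain K m x) {i : ℕ} (hi : i ≤ m) :
    Tame fun t => ‖x i t‖ := by
  refine ⟨(h.continuous hi).norm, fun ε hε => ?_⟩
  obtain ⟨M, hM, h1⟩ := exists_chain_growth W K m hε i hi
  refine ⟨M * ∑ j ∈ Finset.range (i + 1), ‖x j 0‖, by positivity, fun t => ?_⟩
  rw [abs_of_nonneg (norm_nonneg _)]
  refine (h1 x h t).trans ?_
  gcongr
  exact cosh_le_exp_abs ε t hε.le

/-- The weighted energy. -/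
def wen (l : ℝ) (x : ℝ → Ph H) : ℝ := wint l fun t => ‖x t‖ ^ 2

theorem wen_nonneg (l : ℝ) (x : ℝ → Ph H) : 0 ≤ wen l x := wint_nonneg fun _ => by positivity

theorem tame_inner_apply (C : H →L[ℝ] H) {x : ℝ → Ph H} (hc : Continuous x)
    (hx : Tame fun t => ‖x t‖) : Tame fun t => inner ℝ (C (x t).fst) (x t).fst := by
  refine hx.sq.of_le (C := ‖C‖) ((C.continuous.comp hc.phFst).inner hc.phFst) fun t => ?_
  refine (abs_real_inner_le_norm _ _).trans ?_
  rw [abs_of_nonneg (by positivity), pow_two, ← mul_assoc]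
  exact mul_le_mul ((C.le_opNorm _).trans
    (mul_le_mul_of_nonneg_left (x t).norm_fst_le (norm_nonneg _))) (x t).norm_fst_le
    (norm_nonneg _) (by positivity)

/-- Observability on windows `[s, s + τ]` implies a weighted estimate. -/
theorem wen_le_of_obs {τ d : ℝ} (hτ : 0 < τ) (hd : 0 ≤ d) {C : H →L[ℝ] H}
    (hpos : ∀ w, 0 ≤ inner ℝ (C w) w)
    (hobs : ∀ x g, W.MildOn Set.univ x g → ‖x 0‖ ^ 2 ≤
      d * ((∫ t in (0 : ℝ)..τ, inner ℝ (C (x t).fst) (x t).fst) + ∫ t in (0 : ℝ)..τ, ‖g t‖ ^ 2))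
    {x g : ℝ → Ph H} (h : W.MildOn Set.univ x g) (hx : Tame fun t => ‖x t‖)
    (hg : Tame fun t => ‖g t‖) {l : ℝ} (hl : 0 < l) (hlτ : l * τ ≤ 1) :
    wen l x ≤ Real.exp 1 * τ * d *
      (wint l (fun t => inner ℝ (C (x t).fst) (x t).fst) + wint l fun t => ‖g t‖ ^ 2) := by
  have hxc := continuousOn_univ.mp h.cont
  have hgc := continuousOn_univ.mp h.source
  have hq := tame_inner_apply C hxc hx
  have key := integral_window_le hl hτ hlτ (F := fun t => ‖x t‖ ^ 2)
    (h := fun t => d * (inner ℝ (C (x t).fst) (x t).fst + ‖g t‖ ^ 2))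
    ((hq.add hg.sq).const_mul d)
    (fun t => mul_nonneg hd (add_nonneg (hpos _) (by positivity))) hx.sq fun s => ?_
  · rw [wint_const_mul, wint_add hl hq hg.sq] at key
    refine key.trans_eq (by ring)
  · have h1 := hobs _ _ (h.shift s)
    simp only [zero_add] at h1
    refine h1.trans_eq ?_
    have hq' := hq.1
    rw [intervalIntegral.integral_const_mul, ← intervalIntegral.integral_add]
    · simp only [add_comm s]
    · exact (hq'.comp (continuous_id.add continuous_const)).intervalIntegrable _ _
    · exact (by fun_prop : Continuous fun t => ‖g (t + s)‖ ^ 2).intervalIntegrable _ _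

/-- The weighted multiplier estimate for two consecutive components. -/
theorem wint_coupling_le {C L : H →L[ℝ] H} {x y : ℝ → Ph H} {a : ℝ → Ph H} (ha : Continuous a)
    (hx : W.MildOn Set.univ x fun t => ph 0 (-C (y t).fst))
    (hy : W.MildOn Set.univ y fun t => ph 0 (-L (a t).fst)) (hxt : Tame fun t => ‖x t‖)
    (hyt : Tame fun t => ‖y t‖) (hat : Tame fun t => ‖a t‖) {l : ℝ} (hl : 0 < l) :
    wint l (fun t => inner ℝ (C (y t).fst) (y t).fst) ≤
      l * wint l (fun t => ‖x t‖ * ‖y t‖) + ‖L‖ * wint l fun t => ‖x t‖ * ‖a t‖ := by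
  have hxc := continuousOn_univ.mp hx.cont
  have hyc := continuousOn_univ.mp hy.cont
  -- The free evolution commutes with `rot` and preserves the scalar product, so only the sources
  -- contribute: that of `x` gives the coupling form of `y`, that of `y` an error containing `a`.
  have hd : ∀ t, HasDerivAt (fun t => inner ℝ (x t) (rot H (y t)))
      (inner ℝ (C (y t).fst) (y t).fst + -inner ℝ (x t).fst (L (a t).fst)) t := by
    intro t
    convert! hx.hasDerivAt_inner hy t using 1
    simp only [Ph.inner_def, rot_fst, rot_snd]
    simp
  have hq := tame_inner_apply C hyc hyt
  have hxa := hxt.mul hat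
  have hle : ∀ t, |inner ℝ (x t).fst (L (a t).fst)| ≤ ‖L‖ * (‖x t‖ * ‖a t‖) := by
    intro t
    refine (abs_real_inner_le_norm _ _).trans ?_
    rw [mul_left_comm]
    exact mul_le_mul (x t).norm_fst_le ((L.le_opNorm _).trans
      (mul_le_mul_of_nonneg_left (a t).norm_fst_le (norm_nonneg _))) (norm_nonneg _) (norm_nonneg _)
  have hc := hxc.phFst.inner (𝕜 := ℝ) (L.continuous.comp ha.phFst)
  have hr : Tame fun t => -inner ℝ (x t).fst (L (a t).fst) := by
    refine hxa.of_le (C := ‖L‖) hc.neg fun t => ?_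
    rw [abs_neg, abs_of_nonneg (by positivity : 0 ≤ ‖x t‖ * ‖a t‖)]
    exact hle t
  have hφ : ∀ t, |inner ℝ (x t) (rot H (y t))| ≤ ‖x t‖ * ‖y t‖ := fun t =>
    (abs_real_inner_le_norm _ _).trans_eq (by rw [norm_rot])
  have key := wint_deriv hl hd ((hxt.mul hyt).of_le (C := 1)
    (hxc.inner ((rot H).continuous.comp hyc)) fun t => by
      rw [one_mul, abs_of_nonneg (by positivity : 0 ≤ ‖x t‖ * ‖y t‖)]; exact hφ t)
    (hq.add hr) (hxt.mul hyt) hφ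
  rw [wint_add hl hq hr] at key
  have h2 := wint_mono hl (hr.const_mul (-1)) (hxa.const_mul ‖L‖) fun t => by
    have := (le_abs_self _).trans (hle t)
    linarith
  rw [wint_const_mul, wint_const_mul] at h2
  linarith

/-- Young's inequality with a free parameter `r`, chosen below so that the `y` part can be absorbed
and the `x` part carries `l²`. -/
theorem wint_mul_le {l : ℝ} (hl : 0 < l) {x y : ℝ → Ph H} (hx : Tame fun t => ‖x t‖)
    (hy : Tame fun t => ‖y t‖) {r : ℝ} (hr : 0 < r) (k : ℝ) :
    k * wint l (fun t => ‖x t‖ * ‖y t‖) ≤ r * wen l y + k ^ 2 / (4 * r) * wen l x := by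
  rw [wen, wen, ← wint_const_mul, ← wint_const_mul, ← wint_const_mul,
    ← wint_add hl (hy.sq.const_mul r) (hx.sq.const_mul _)]
  refine wint_mono hl ((hx.mul hy).const_mul k) ((hy.sq.const_mul r).add (hx.sq.const_mul _))
    fun t => ?_
  have : r * ‖y t‖ ^ 2 + k ^ 2 / (4 * r) * ‖x t‖ ^ 2 - k * (‖x t‖ * ‖y t‖)
      = r * (‖y t‖ - k / (2 * r) * ‖x t‖) ^ 2 := by field_simp; ring
  nlinarith [mul_nonneg hr.le (sq_nonneg (‖y t‖ - k / (2 * r) * ‖x t‖))]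

end WaveGroup

end Cascade

/-! ### Lower components are dominated by the last one. -/

namespace Cascade

open MeasureTheory

namespace WaveGroup

variable {H : Type*} [NormedAddCommGroup H] [InnerProductSpace ℝ H] [CompleteSpace H]
  {W : WaveGroup H} {K : ℕ → ℕ → H →L[ℝ] H}

/-- The first components of the time antiderivative of a chain. -/
def antiFst (W : WaveGroup H) (K : ℕ → ℕ → H →L[ℝ] H) (m : ℕ) (x : ℕ → ℝ → Ph H) : ℕ → ℝ → H
  | 0, _ => 0
  | i + 1, t => -(x (i + 1) t).snd - K (m - i) (i + 1) (W.S (antiFst W K m x i t))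

/-- The time antiderivative of a chain. -/
def anti (W : WaveGroup H) (K : ℕ → ℕ → H →L[ℝ] H) (m : ℕ) (x : ℕ → ℝ → Ph H) (i : ℕ) (t : ℝ) :
    Ph H := ph (antiFst W K m x i t) (x i t).fst

/-- The antiderivative is algebraic: solving the second equation of a component for its first entry
writes that entry as the derivative of `S` times a combination of known terms. Dropping the last
component leaves a chain with one power of `S` less, because `S K k i = K (k+1) i S`. -/
theorem Chain.anti {m : ℕ} (hcomm : ∀ i, 1 ≤ i → i ≤ m → ∀ x, W.S (K (m - i) i x) =
    K (m - i + 1) i (W.S x)) {x : ℕ → ℝ → Ph H} (h : W.Chain K (m + 1) x) :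
    W.Chain K m (W.anti K m x) := by
  have hfst : ∀ i ≤ m, Continuous (W.antiFst K m x i) ∧
      ∀ t, HasDerivAt (fun t => W.S (W.antiFst K m x i t)) (x i t).fst t := by
    intro i
    induction i with
    | zero =>
      intro _
      refine ⟨continuous_const, fun t => ?_⟩
      rw [h.zero]
      simpa [antiFst] using hasDerivAt_const t (0 : H)
    | succ i ih =>
      intro hi
      obtain ⟨hc, hd⟩ := ih (by omega)
      have hxc := h.continuous (i := i + 1) (by omega)
      refine ⟨hxc.phSnd.neg.sub ((K _ _).continuous.comp (W.S.continuous.comp hc)), fun t => ?_⟩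
      have h1 := (((h.mild (i + 1) (by omega) (by omega)).deriv t trivial).phSnd)
      rw [hasDerivWithinAt_univ] at h1
      simp only [Sph_snd] at h1
      have h2 := (W.S.comp (K (m - i) (i + 1))).hasFDerivAt.comp_hasDerivAt t (hd t)
      have h3 := h1.neg.sub h2
      convert! h3 using 1
      · funext r
        simp [antiFst]
      · have e : m + 1 - (i + 1) = m - i := by omega
        simp [rot_snd, Sph_snd, e]
  refine ⟨fun t => ?_, fun i hi him => ?_⟩
  · rw [WaveGroup.anti, h.zero]; rfl
  · obtain ⟨hc, hd⟩ := hfst i him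
    have hxc := (h.continuous (i := i) (by omega)).phFst
    refine ⟨(hc.ph hxc).continuousOn, (continuous_const.ph
      ((K _ _).continuous.comp (hfst (i - 1) (by omega)).1).neg).continuousOn, fun t _ => ?_⟩
    rw [hasDerivWithinAt_univ]
    refine Ph.hasDerivAt ?_ ?_
    · simp only [Sph_fst, WaveGroup.anti]
      convert! hd t using 1
      simp [rot_fst, Sph_fst]
    · simp only [Sph_snd, WaveGroup.anti]
      have h1 := (((h.mild i hi (by omega)).deriv t trivial).phFst)
      rw [hasDerivWithinAt_univ] at h1
      simp only [Sph_fst] at h1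
      convert! h1 using 1
      obtain ⟨j, rfl⟩ : ∃ j, i = j + 1 := ⟨i - 1, by omega⟩
      have e : m - (j + 1) + 1 = m - j := by omega
      simp [rot_fst, rot_snd, Sph_fst, Sph_snd, antiFst, hcomm (j + 1) hi him, e]

/-- A state and its antiderivative share an entry, up to position; the other entries agree up to
sign and a bounded multiple of the preceding antiderivative. Hence their norms are comparable modulo
lower components. -/
theorem norm_sq_le_anti {m i : ℕ} (x : ℕ → ℝ → Ph H) (t : ℝ) :
    ‖x (i + 1) t‖ ^ 2 ≤ 2 * ‖W.anti K m x (i + 1) t‖ ^ 2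
      + 2 * (‖K (m - i) (i + 1)‖ * ‖W.S‖) ^ 2 * ‖W.anti K m x i t‖ ^ 2 ∧
    ‖W.anti K m x (i + 1) t‖ ^ 2 ≤ 2 * ‖x (i + 1) t‖ ^ 2
      + 2 * (‖K (m - i) (i + 1)‖ * ‖W.S‖) ^ 2 * ‖W.anti K m x i t‖ ^ 2 := by
  have e := Ph.norm_sq (x (i + 1) t)
  have e' := Ph.norm_sq (W.anti K m x (i + 1) t)
  set c := ‖K (m - i) (i + 1)‖ * ‖W.S‖
  set v := K (m - i) (i + 1) (W.S (W.antiFst K m x i t))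
  have hv : ‖v‖ ≤ c * ‖W.anti K m x i t‖ := by
    refine ((K _ _).le_opNorm _).trans ?_
    rw [mul_assoc]
    refine mul_le_mul_of_nonneg_left ((W.S.le_opNorm _).trans ?_) (norm_nonneg _)
    exact mul_le_mul_of_nonneg_left (Ph.norm_fst_le (W.anti K m x i t)) (norm_nonneg _)
  have hv2 : ‖v‖ ^ 2 ≤ c ^ 2 * ‖W.anti K m x i t‖ ^ 2 := by
    rw [← mul_pow]; exact pow_le_pow_left₀ (norm_nonneg _) hv 2
  set z := W.antiFst K m x (i + 1) t with hz
  have e2 : (x (i + 1) t).snd = -z - v := by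
    simp only [hz, antiFst, v]; abel
  have e3 : z = -(x (i + 1) t).snd - v := rfl
  change ‖W.anti K m x (i + 1) t‖ ^ 2 = ‖z‖ ^ 2 + ‖(x (i + 1) t).fst‖ ^ 2 at e'
  have h1 : ‖(x (i + 1) t).snd‖ ≤ ‖z‖ + ‖v‖ := by
    rw [e2, ← norm_neg z]; exact norm_sub_le _ _
  have h2 : ‖z‖ ≤ ‖(x (i + 1) t).snd‖ + ‖v‖ := by
    rw [e3, ← norm_neg (x (i + 1) t).snd]; exact norm_sub_le _ _
  have n1 := norm_nonneg (x (i + 1) t).snd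
  have n2 := norm_nonneg z
  have n3 := norm_nonneg v
  constructor
  · nlinarith [sq_nonneg (‖z‖ - ‖v‖), sq_nonneg ‖(x (i + 1) t).fst‖]
  · nlinarith [sq_nonneg (‖(x (i + 1) t).snd‖ - ‖v‖), sq_nonneg ‖(x (i + 1) t).fst‖]

/-- The estimates of lower components of a chain of length `m` by its last component. -/
def LowerBound (W : WaveGroup H) (K : ℕ → ℕ → H →L[ℝ] H) (m : ℕ) : Prop :=
  ∃ C l₀ : ℝ, 0 ≤ C ∧ 0 < l₀ ∧ ∀ l, 0 < l → l ≤ l₀ → ∀ x, W.Chain K m x →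
    ∑ i ∈ Finset.range m, wen l (x i) ≤ C * l ^ 2 * wen l (x m)

theorem wen_zero_of_chain {m : ℕ} {x : ℕ → ℝ → Ph H} (h : W.Chain K m x) (l : ℝ) :
    wen l (x 0) = 0 := by
  simp [wen, wint, h.zero]

theorem wen_le_anti {m : ℕ} {c l : ℝ} (hl : 0 < l) {x : ℕ → ℝ → Ph H}
    (h : W.Chain K (m + 1) x) (hz : W.Chain K m (W.anti K m x)) {i : ℕ} (hi : i + 1 ≤ m)
    (hc : ‖K (m - i) (i + 1)‖ * ‖W.S‖ ≤ c) :
    wen l (x (i + 1)) ≤ 2 * wen l (W.anti K m x (i + 1)) + 2 * c ^ 2 * wen l (W.anti K m x i) ∧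
    wen l (W.anti K m x (i + 1)) ≤ 2 * wen l (x (i + 1)) + 2 * c ^ 2 * wen l (W.anti K m x i) := by
  have t1 := (h.tame (i := i + 1) (by omega)).sq
  have t2 := (hz.tame (i := i + 1) (by omega)).sq
  have t3 := (hz.tame (i := i) (by omega)).sq
  have hc2 : (‖K (m - i) (i + 1)‖ * ‖W.S‖) ^ 2 ≤ c ^ 2 :=
    pow_le_pow_left₀ (by positivity) hc 2
  have hle : ∀ t, 2 * (‖K (m - i) (i + 1)‖ * ‖W.S‖) ^ 2 * ‖W.anti K m x i t‖ ^ 2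
      ≤ 2 * c ^ 2 * ‖W.anti K m x i t‖ ^ 2 := fun t => by gcongr
  simp only [wen, ← wint_const_mul]
  rw [← wint_add hl (t2.const_mul _) (t3.const_mul _), ← wint_add hl (t1.const_mul _) (t3.const_mul _)]
  constructor
  · refine wint_mono hl t1 ((t2.const_mul _).add (t3.const_mul _)) fun t => ?_
    have := (norm_sq_le_anti (W := W) (K := K) (m := m) (i := i) x t).1
    linarith [hle t]
  · refine wint_mono hl t2 ((t1.const_mul _).add (t3.const_mul _)) fun t => ?_
    have := (norm_sq_le_anti (W := W) (K := K) (m := m) (i := i) x t).2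
    linarith [hle t]

/-- The lower components of a chain of length `m + 1` are also controlled by its `m`-th one. -/
theorem LowerBound.shift {m : ℕ} (hm : 1 ≤ m) (hcomm : ∀ i, 1 ≤ i → i ≤ m → ∀ x,
    W.S (K (m - i) i x) = K (m - i + 1) i (W.S x)) (hL : LowerBound W K m) :
    ∃ C l₀ : ℝ, 0 ≤ C ∧ 0 < l₀ ∧ ∀ l, 0 < l → l ≤ l₀ → ∀ x, W.Chain K (m + 1) x →
      ∑ i ∈ Finset.range m, wen l (x i) ≤ C * l ^ 2 * wen l (x m) := by
  obtain ⟨C, l₀, hC, hl₀, h⟩ := hL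
  set c : ℝ := ∑ i ∈ Finset.range m, ‖K (m - i) (i + 1)‖ * ‖W.S‖ with hcdef
  have hcle : ∀ i < m, ‖K (m - i) (i + 1)‖ * ‖W.S‖ ≤ c := fun i hi =>
    Finset.single_le_sum (f := fun i => ‖K (m - i) (i + 1)‖ * ‖W.S‖)
      (fun _ _ => by positivity) (Finset.mem_range.mpr hi)
  set D : ℝ := 2 + 2 * c ^ 2
  have hD : 0 < D := by positivity
  -- The second bound on `l` gives `2 c² C l² ≤ 1/2`. The preceding antiderivative, already of
  -- relative size `C l²`, can then be absorbed when the antiderivative of the `m`-th component is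
  -- replaced by that component.
  refine ⟨D * C * 4, min l₀ (1 / (2 * (c ^ 2 * C + 1))), by positivity, by positivity,
    fun l hl hll x hx => ?_⟩
  have hz := hx.anti hcomm
  have hll0 := hll.trans (min_le_left _ _)
  have hll1 := hll.trans (min_le_right _ _)
  have key := h l hl hll0 _ hz
  obtain ⟨j, rfl⟩ : ∃ j, m = j + 1 := ⟨m - 1, by omega⟩
  set z := W.anti K (j + 1) x
  have hzn := fun i => wen_nonneg l (z i)
  have h0 : wen l (x 0) = 0 := wen_zero_of_chain hx l
  have hz0 : wen l (z 0) = 0 := wen_zero_of_chain hz l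
  have s1 : ∑ i ∈ Finset.range (j + 1), wen l (x i) ≤ D * ∑ i ∈ Finset.range (j + 1), wen l (z i) := by
    rw [Finset.sum_range_succ', h0, add_zero]
    have : ∀ i ∈ Finset.range j, wen l (x (i + 1)) ≤ 2 * wen l (z (i + 1)) + 2 * c ^ 2 * wen l (z i) := by
      intro i hi
      have hi' := Finset.mem_range.mp hi
      exact (wen_le_anti hl hx hz (by omega) (hcle i (by omega))).1
    refine (Finset.sum_le_sum this).trans ?_
    rw [Finset.sum_add_distrib, ← Finset.mul_sum, ← Finset.mul_sum]
    have a1 : ∑ i ∈ Finset.range j, wen l (z (i + 1)) = ∑ i ∈ Finset.range (j + 1), wen l (z i) := by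
      rw [Finset.sum_range_succ', hz0, add_zero]
    have a2 : ∑ i ∈ Finset.range j, wen l (z i) ≤ ∑ i ∈ Finset.range (j + 1), wen l (z i) := by
      rw [Finset.sum_range_succ]; linarith [hzn j]
    rw [a1]
    have a3 : 0 ≤ 2 * c ^ 2 := by positivity
    have := mul_le_mul_of_nonneg_left a2 a3
    simp only [D]; linarith
  have s2 := (wen_le_anti hl hx hz le_rfl (hcle j (by omega))).2
  have s3 : wen l (z j) ≤ ∑ i ∈ Finset.range (j + 1), wen l (z i) :=
    Finset.single_le_sum (f := fun i => wen l (z i)) (fun i _ => hzn i) (Finset.self_mem_range_succ j)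
  have s4 : 2 * c ^ 2 * (C * l ^ 2) ≤ 1 / 2 := by
    have hq : 0 ≤ c ^ 2 * C := by positivity
    have hp : 0 < c ^ 2 * C + 1 := by positivity
    have h1 : l * (2 * (c ^ 2 * C + 1)) ≤ 1 := (le_div_iff₀ (by positivity)).mp hll1
    have h2 : l * (c ^ 2 * C + 1) ≤ 1 / 2 := by linarith
    have h3 : 0 ≤ l * (c ^ 2 * C + 1) := by positivity
    have h4 : (l * (c ^ 2 * C + 1)) ^ 2 ≤ 1 / 4 := by nlinarith
    have h5 : c ^ 2 * C ≤ (c ^ 2 * C + 1) ^ 2 := by nlinarith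
    have h6 : l ^ 2 * (c ^ 2 * C) ≤ l ^ 2 * (c ^ 2 * C + 1) ^ 2 :=
      mul_le_mul_of_nonneg_left h5 (sq_nonneg l)
    nlinarith
  have s5 : 2 * c ^ 2 * wen l (z j) ≤ 1 / 2 * wen l (z (j + 1)) := by
    have := mul_le_mul_of_nonneg_left (s3.trans key) (show 0 ≤ 2 * c ^ 2 by positivity)
    have := mul_le_mul_of_nonneg_right s4 (hzn (j + 1))
    linarith
  have s6 : wen l (z (j + 1)) ≤ 4 * wen l (x (j + 1)) := by linarith
  refine s1.trans ?_
  have s7 := mul_le_mul_of_nonneg_left key hD.le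
  have s8 := mul_le_mul_of_nonneg_left s6 (show 0 ≤ D * (C * l ^ 2) by positivity)
  linarith

/-- Observability windows for the coupling operators of a chain. -/
def CouplingObs (W : WaveGroup H) (C : H →L[ℝ] H) : Prop :=
  (∀ w, 0 ≤ inner ℝ (C w) w) ∧ ∃ τ d : ℝ, 0 < τ ∧ 0 ≤ d ∧
    ∀ x g, W.MildOn Set.univ x g → ‖x 0‖ ^ 2 ≤
      d * ((∫ t in (0 : ℝ)..τ, inner ℝ (C (x t).fst) (x t).fst) + ∫ t in (0 : ℝ)..τ, ‖g t‖ ^ 2)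

/-- `X`, `Y`, `Z` are the weighted energies of the last three components in descending order.
Observability bounds `Y` by the coupling form `q` and the source `g`; the multiplier bounds `q` by
the cross terms `P`, `R`. Since `Z` is of order `l² Y`, everything on the right except a multiple of
`l² X` is absorbed into `Y`. -/
theorem le_mul_of_absorb {E k C l X Y Z P R q g : ℝ} (hE : 0 ≤ E) (hC : 0 ≤ C)
    (hl : 0 < l) (hl1 : l ≤ 1) (hlq : l ≤ 1 / (4 * (E * k ^ 2 * C + 1))) (hY : 0 ≤ Y)
    (hZY : Z ≤ C * l ^ 2 * Y) (h1 : Y ≤ E * (q + g)) (hg : g ≤ k ^ 2 * Z)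
    (h2 : q ≤ l * P + k * R) (hP : ∀ r > 0, ∀ c, c * P ≤ r * Y + c ^ 2 / (4 * r) * X)
    (hR : ∀ r > 0, ∀ c, c * R ≤ r * Z + c ^ 2 / (4 * r) * X) :
    Y ≤ 4 * (E + 1) * E * (1 + k ^ 2 * (C + 1)) * l ^ 2 * X := by
  -- Both cross terms cost `δ Y`; the choice of `δ` makes their total `E * (2 δ) Y` at most `Y / 4`,
  -- and the source term will cost another `Y / 4`.
  set δ : ℝ := 1 / (8 * (E + 1)) with hδ
  have hδ0 : 0 < δ := by positivity
  have hEδ : E * (2 * δ) ≤ 1 / 4 := by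
    rw [hδ, mul_one_div, ← mul_div_assoc, div_le_div_iff₀ (by positivity) (by norm_num)]
    nlinarith
  have hδi : 1 / (4 * δ) = 2 * (E + 1) := by rw [hδ]; field_simp; norm_num
  have r3 := hP δ hδ0 l
  -- A parameter as large as `l⁻²` is affordable because `Z` is of order `l² Y`; in exchange the
  -- coefficient of `X` acquires the factor `l²`, which `k` alone would not provide.
  have r4 := hR (δ / ((C + 1) * l ^ 2)) (by positivity) k
  have hC' : δ / ((C + 1) * l ^ 2) * Z ≤ δ * Y := by
    rw [div_mul_eq_mul_div, div_le_iff₀ (by positivity)]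
    have h3 : Z ≤ (C + 1) * l ^ 2 * Y :=
      hZY.trans (mul_le_mul_of_nonneg_right (by nlinarith [sq_nonneg l]) hY)
    have := mul_le_mul_of_nonneg_left h3 hδ0.le
    linarith
  have e3 : k ^ 2 / (4 * (δ / ((C + 1) * l ^ 2))) = l ^ 2 * (k ^ 2 * (C + 1) * (1 / (4 * δ))) := by
    field_simp
  have e4 : l ^ 2 / (4 * δ) = l ^ 2 * (1 / (4 * δ)) := by ring
  rw [e3, hδi] at r4
  rw [e4, hδi] at r3
  have r5 : q ≤ 2 * δ * Y + l ^ 2 * (2 * (E + 1)) * (1 + k ^ 2 * (C + 1)) * X := by linarith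
  have r6 := h1.trans (mul_le_mul_of_nonneg_left (add_le_add r5 hg) hE)
  have r7 : E * (k ^ 2 * Z) ≤ 1 / 4 * Y := by
    have a0 : 0 ≤ E * k ^ 2 * C := by positivity
    have a1 : l * (4 * (E * k ^ 2 * C + 1)) ≤ 1 := (le_div_iff₀ (by positivity)).mp hlq
    have a2 : l * (E * k ^ 2 * C) ≤ 1 / 4 := by linarith
    have a3 : l * (l * (E * k ^ 2 * C)) ≤ 1 * (l * (E * k ^ 2 * C)) :=
      mul_le_mul_of_nonneg_right hl1 (by positivity)
    have a4 : l ^ 2 * (E * k ^ 2 * C) ≤ 1 / 4 := by rw [pow_two, mul_assoc]; linarith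
    have a5 := mul_le_mul_of_nonneg_left hZY (show 0 ≤ E * k ^ 2 by positivity)
    have a6 := mul_le_mul_of_nonneg_right a4 hY
    linarith
  have r8 := mul_le_mul_of_nonneg_right hEδ hY
  linarith

/-- The shifted induction hypothesis controls everything below the `m`-th component by that
component; multiplier and coupling observability then control the `m`-th by the last. -/
theorem lowerBound_succ {m : ℕ} (hcomm : ∀ i, 1 ≤ i → i ≤ m → ∀ x,
    W.S (K (m - i) i x) = K (m - i + 1) i (W.S x)) (hL : LowerBound W K m)
    (hobs : 1 ≤ m → CouplingObs W (K 0 (m + 1))) : LowerBound W K (m + 1) := by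
  rcases Nat.eq_zero_or_pos m with rfl | hm
  -- In a chain of length one, only the zero component lies below the last.
  · refine ⟨0, 1, le_rfl, one_pos, fun l hl _ x hx => ?_⟩
    simp [wen_zero_of_chain hx]
  obtain ⟨C, l₀, hC, hl₀, h⟩ := hL.shift hm hcomm
  obtain ⟨hpos, τ, d, hτ, hd, hob⟩ := hobs hm
  obtain ⟨j, rfl⟩ : ∃ j, m = j + 1 := ⟨m - 1, by omega⟩
  set k := ‖K 1 (j + 1)‖
  have hk : 0 ≤ k := norm_nonneg _
  set E := Real.exp 1 * τ * d
  have hE : 0 ≤ E := by positivity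
  set B : ℝ := 4 * (E + 1) * E * (1 + k ^ 2 * (C + 1))
  have hB : 0 ≤ B := by positivity
  refine ⟨(C + 1) * B, min (min l₀ 1) (min (1 / τ) (1 / (4 * (E * k ^ 2 * C + 1)))),
    by positivity, by positivity, fun l hl hll x hx => ?_⟩
  have hll0 := hll.trans ((min_le_left _ _).trans (min_le_left _ _))
  have hll1 := hll.trans ((min_le_left _ _).trans (min_le_right _ _))
  have hllτ := hll.trans ((min_le_right _ _).trans (min_le_left _ _))
  have hllq := hll.trans ((min_le_right _ _).trans (min_le_right _ _))
  have low := h l hl hll0 x hx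
  have tX := hx.tame (i := j + 1 + 1) le_rfl
  have tY := hx.tame (i := j + 1) (by omega)
  have tZ := hx.tame (i := j) (by omega)
  have mX := hx.mild (j + 1 + 1) (by omega) le_rfl
  have mY := hx.mild (j + 1) (by omega) (by omega)
  have e1 : j + 1 + 1 - (j + 1 + 1) = 0 := by omega
  have e2 : j + 1 + 1 - (j + 1) = 1 := by omega
  simp only [e1, Nat.add_sub_cancel] at mX
  simp only [e2, Nat.add_sub_cancel] at mY
  have hZY : wen l (x j) ≤ C * l ^ 2 * wen l (x (j + 1)) :=
    (Finset.single_le_sum (f := fun i => wen l (x i)) (fun i _ => wen_nonneg _ _)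
      (Finset.self_mem_range_succ j)).trans low
  have hg : ∀ t, ‖ph 0 (-(K 1 (j + 1)) (x j t).fst)‖ ≤ k * ‖x j t‖ := fun t => norm_ph_neg_le _ _
  have tg : Tame fun t => ‖ph 0 (-(K 1 (j + 1)) (x j t).fst)‖ :=
    tZ.of_le (C := k) (continuousOn_univ.mp mY.source).norm fun t => by
      rw [abs_of_nonneg (norm_nonneg _), abs_of_nonneg (norm_nonneg _)]; exact hg t
  have hg2 : wint l (fun t => ‖ph 0 (-(K 1 (j + 1)) (x j t).fst)‖ ^ 2) ≤ k ^ 2 * wen l (x j) := by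
    simp only [wen]
    rw [← wint_const_mul]
    refine wint_mono hl tg.sq (tZ.sq.const_mul _) fun t => ?_
    rw [← mul_pow]
    exact pow_le_pow_left₀ (norm_nonneg _) (hg t) 2
  have key := le_mul_of_absorb hE hC hl hll1 hllq (wen_nonneg l (x (j + 1))) hZY
    (wen_le_of_obs hτ hd hpos hob mY tY tg hl ((le_div_iff₀ hτ).mp hllτ)) hg2
    (wint_coupling_le (hx.continuous (i := j) (by omega)) mX mY tX tY tZ hl)
    (fun r hr c => wint_mul_le hl tX tY hr c) (fun r hr c => wint_mul_le hl tX tZ hr c)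
  rw [Finset.sum_range_succ]
  have hY := wen_nonneg l (x (j + 1))
  have r9 : C * l ^ 2 * wen l (x (j + 1)) ≤ C * wen l (x (j + 1)) :=
    mul_le_mul_of_nonneg_right (mul_le_of_le_one_right hC (pow_le_one₀ hl.le hll1)) hY
  have r10 := mul_le_mul_of_nonneg_left key (show 0 ≤ C + 1 by positivity)
  linarith

theorem lowerBound {n : ℕ} (hcomm : ∀ i, 1 ≤ i → i ≤ n → ∀ k, k + i < n → ∀ x,
    W.S (K k i x) = K (k + 1) i (W.S x))
    (hobs : ∀ m, 2 ≤ m → m ≤ n → CouplingObs W (K 0 m)) {m : ℕ} (hm : m ≤ n) :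
    LowerBound W K m := by
  induction m with
  | zero => exact ⟨0, 1, le_rfl, one_pos, fun l hl _ x hx => by simp⟩
  | succ m ih =>
    exact lowerBound_succ (fun i hi him x => hcomm i hi (by omega) _ (by omega) x) (ih (by omega))
      fun h => hobs _ (by omega) hm

end WaveGroup

end Cascade

/-! ### Observability of forced solutions on a time window. -/

namespace Cascade

open MeasureTheory

theorem integral_add_on {τ : ℝ} (hτ : 0 ≤ τ) {f g : ℝ → ℝ} (hf : ContinuousOn f (Set.Icc 0 τ))
    (hg : ContinuousOn g (Set.Icc 0 τ)) :
    ∫ t in (0 : ℝ)..τ, (f t + g t) = (∫ t in (0 : ℝ)..τ, f t) + ∫ t in (0 : ℝ)..τ, g t :=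
  intervalIntegral.integral_add (hf.intervalIntegrable_of_Icc hτ) (hg.intervalIntegrable_of_Icc hτ)

theorem sq_integral_le {τ : ℝ} (hτ : 0 ≤ τ) {h : ℝ → ℝ} (hc : ContinuousOn h (Set.Icc 0 τ)) :
    (∫ t in (0 : ℝ)..τ, h t) ^ 2 ≤ τ * ∫ t in (0 : ℝ)..τ, h t ^ 2 := by
  rcases hτ.eq_or_lt with rfl | hτ0
  · simp
  set I := ∫ t in (0 : ℝ)..τ, h t with hI
  have h1 : ∫ t in (0 : ℝ)..τ, (2 * (I / τ)) * h t ≤ ∫ t in (0 : ℝ)..τ, (h t ^ 2 + (I / τ) ^ 2) := by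
    refine intervalIntegral.integral_mono_on hτ
      ((continuousOn_const.mul hc).intervalIntegrable_of_Icc hτ)
      (((hc.pow 2).add continuousOn_const).intervalIntegrable_of_Icc hτ) fun t _ => ?_
    nlinarith [sq_nonneg (h t - I / τ)]
  rw [intervalIntegral.integral_const_mul, integral_add_on hτ (f := fun t => h t ^ 2) (hc.pow 2)
    continuousOn_const, intervalIntegral.integral_const, ← hI, sub_zero, smul_eq_mul] at h1
  have h2 : 2 * (I / τ) * I = 2 * (I ^ 2 / τ) := by ring
  have h3 : τ * (I / τ) ^ 2 = I ^ 2 / τ := by field_simp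
  rw [h2, h3] at h1
  have h4 : I ^ 2 / τ ≤ ∫ t in (0 : ℝ)..τ, h t ^ 2 := by linarith
  rwa [div_le_iff₀' hτ0] at h4

theorem integral_le_of_le {τ s : ℝ} (hs : s ∈ Set.Icc 0 τ) {h : ℝ → ℝ}
    (hc : ContinuousOn h (Set.Icc 0 τ)) (h0 : ∀ t, 0 ≤ h t) :
    ∫ t in (0 : ℝ)..s, h t ≤ ∫ t in (0 : ℝ)..τ, h t :=
  intervalIntegral.integral_mono_interval le_rfl hs.1 hs.2 (Filter.Eventually.of_forall h0)
    (hc.intervalIntegrable_of_Icc (hs.1.trans hs.2))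

/-- The orthogonal complement of the range of a symmetric operator is its kernel. -/
theorem denseRange_of_symm {X : Type*} [NormedAddCommGroup X] [InnerProductSpace ℝ X]
    [CompleteSpace X] {L : X →L[ℝ] X} (hs : ∀ x y, inner ℝ (L x) y = inner ℝ x (L y))
    (hi : ∀ x, L x = 0 → x = 0) : DenseRange L := by
  have h : (LinearMap.range (L : X →ₗ[ℝ] X)).topologicalClosure = ⊤ := by
    rw [Submodule.topologicalClosure_eq_top_iff, Submodule.eq_bot_iff]
    intro y hy
    refine hi y (ext_inner_left ℝ fun x => ?_)
    rw [← hs, inner_zero_right]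
    exact (Submodule.mem_orthogonal _ _).mp hy _ ⟨x, rfl⟩
  intro x
  have : x ∈ (LinearMap.range (L : X →ₗ[ℝ] X)).topologicalClosure := h ▸ Submodule.mem_top
  exact this

namespace WaveGroup

variable {H : Type*} [NormedAddCommGroup H] [InnerProductSpace ℝ H]
  {W : WaveGroup H}

theorem MildOn.map_rot {I : Set ℝ} {x g : ℝ → Ph H} (h : W.MildOn I x g) :
    W.MildOn I (fun t => rot H (x t)) fun t => rot H (g t) := by
  refine ⟨(rot H).continuous.comp_continuousOn h.cont,
    (rot H).continuous.comp_continuousOn h.source, fun t ht => ?_⟩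
  have := (rot H).hasFDerivAt.comp_hasDerivWithinAt t (h.deriv t ht)
  simpa only [Function.comp_def, rot_Sph, map_add] using this

theorem StrongOn.sub {T : ℝ} {f α β f' α' β' : ℝ → H} (h : W.StrongOn T f α β)
    (h' : W.StrongOn T f' α' β') :
    W.StrongOn T (fun t => f t - f' t) (fun t => α t - α' t) fun t => β t - β' t := by
  refine ⟨h.source.sub h'.source, h.cont.sub h'.cont, h.cont'.sub h'.cont', fun t ht => ?_,
    fun t ht => ?_⟩
  · simp only [map_sub]
    exact (h.deriv t ht).sub (h'.deriv t ht)
  · have := (h.eqn t ht).sub (h'.eqn t ht)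
    rw [sub_sub_sub_comm] at this
    simp only [map_sub]
    exact this

theorem StrongOn.shift {T s τ : ℝ} (hs : 0 ≤ s) (hsτ : s + τ ≤ T) {f α β : ℝ → H}
    (h : W.StrongOn T f α β) :
    W.StrongOn τ (fun t => f (t + s)) (fun t => α (t + s)) fun t => β (t + s) := by
  have hm : Set.MapsTo (fun t => t + s) (Set.Icc 0 τ) (Set.Icc 0 T) := fun t ht =>
    ⟨by have := ht.1; positivity, by linarith [ht.2]⟩
  have hd : ∀ t, HasDerivWithinAt (fun t : ℝ => t + s) 1 (Set.Icc 0 τ) t := fun t =>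
    ((hasDerivAt_id t).add_const s).hasDerivWithinAt
  have hc : ContinuousOn (fun t : ℝ => t + s) (Set.Icc 0 τ) := by fun_prop
  refine ⟨h.source.comp hc hm, h.cont.comp hc hm, h.cont'.comp hc hm, fun t ht => ?_,
    fun t ht => ?_⟩
  · have := (h.deriv (t + s) (hm ht)).scomp t (hd t) hm
    rwa [one_smul] at this
  · have := (h.eqn (t + s) (hm ht)).scomp t (hd t) hm
    rwa [one_smul] at this

theorem S_pow_comm (W : WaveGroup H) (k : ℕ) (x : H) : W.S ((W.S ^ k) x) = (W.S ^ k) (W.S x) := by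
  rw [← mul_apply_eq_comp, ← mul_apply_eq_comp, ← pow_succ, ← pow_succ']

theorem Sph_ph (W : WaveGroup H) (a b : H) : W.Sph (ph a b) = ph (W.S a) (W.S b) :=
  Ph.ext (W.Sph_fst _) (W.Sph_snd _)

/-- Normalised states of strong solutions are mild solutions. -/
theorem StrongOn.mildOn {T : ℝ} {f α β : ℝ → H} (h : W.StrongOn T f α β) (k : ℕ) :
    W.MildOn (Set.Icc 0 T) (fun t => ph ((W.S ^ k) (W.S (α t))) ((W.S ^ k) (W.S (β t))))
      fun t => ph 0 ((W.S ^ k) (f t)) := by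
  refine ⟨((W.S ^ k).continuous.comp_continuousOn (W.S.continuous.comp_continuousOn h.cont)).ph
    ((W.S ^ k).continuous.comp_continuousOn (W.S.continuous.comp_continuousOn h.cont')),
    continuousOn_const.ph ((W.S ^ k).continuous.comp_continuousOn h.source), fun t ht => ?_⟩
  refine Ph.hasDerivWithinAt ?_ ?_
  · have := (W.S ^ k).hasFDerivAt.comp_hasDerivWithinAt t (h.deriv t ht)
    simp only [Sph_ph, W.S_pow_comm]
    convert! this using 1
    simp [rot_fst]
  · have := (W.S ^ k).hasFDerivAt.comp_hasDerivWithinAt t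
      (W.S.hasFDerivAt.comp_hasDerivWithinAt t (h.eqn t ht))
    simp only [Sph_ph, W.S_pow_comm]
    convert! this using 1
    rw [WithLp.add_snd, rot_snd, map_sub, map_sub, ← neg_add_eq_sub]
    rfl

theorem norm_ph_sq (a b : H) : ‖ph a b‖ ^ 2 = ‖a‖ ^ 2 + ‖b‖ ^ 2 := Ph.norm_sq _

theorem strongOn_free (z : Ph H) (T : ℝ) :
    W.StrongOn T (fun _ => 0) (fun t => (W.phase.U t z).fst) fun t => (W.phase.U t z).snd := by
  have hc := W.phase.cont z
  have hd := fun t => (W.hasDerivAt_U z t).hasDerivWithinAt (s := Set.Icc 0 T)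
  refine ⟨continuousOn_const, hc.phFst.continuousOn, hc.phSnd.continuousOn, fun t _ => ?_,
    fun t _ => ?_⟩
  · have := W.S.hasFDerivAt.comp_hasDerivWithinAt t (hd t).phFst
    simpa only [Function.comp_def, ← Sph_U, Sph_fst, rot_fst] using this
  · have := (hd t).phSnd
    simpa only [← Sph_U, Sph_snd, rot_snd, zero_sub] using this

variable [CompleteSpace H]

theorem denseRange_S (W : WaveGroup H) : DenseRange W.S := denseRange_of_symm W.S_symm W.S_inj

theorem denseRange_Sph (W : WaveGroup H) : DenseRange W.Sph :=
  denseRange_of_symm (fun x y => by simp only [Ph.inner_def, Sph_fst, Sph_snd, W.S_symm])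
    fun _ => W.Sph_inj

theorem MildOn.norm_sub_sq_le {τ : ℝ} {x g : ℝ → Ph H} (h : W.MildOn (Set.Icc 0 τ) x g) {t : ℝ}
    (ht : t ∈ Set.Icc 0 τ) :
    ‖x t - W.phase.U t (x 0)‖ ^ 2 ≤ τ * ∫ r in (0 : ℝ)..τ, ‖g r‖ ^ 2 := by
  have h1 := (h.mono (Set.Icc_subset_Icc_right ht.2)).norm_sub_le ht.1
  rw [sub_zero] at h1
  have h2 := h1.trans (integral_le_of_le ht h.source.norm fun _ => norm_nonneg _)
  exact (pow_le_pow_left₀ (norm_nonneg _) h2 2).trans (sq_integral_le (ht.1.trans ht.2) h.source.norm)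

/-- A bounded observation of the free system that is observable on smooth data observes the
forced system. -/
theorem MildOn.le_of_obs {F : Type*} [NormedAddCommGroup F] [NormedSpace ℝ F] {τ γ : ℝ}
    (hτ : 0 ≤ τ) (L : Ph H →L[ℝ] F)
    (hobs : ∀ z, γ * ‖W.Sph z‖ ^ 2 ≤ ∫ t in (0 : ℝ)..τ, ‖L (W.phase.U t (W.Sph z))‖ ^ 2)
    {x g : ℝ → Ph H} (h : W.MildOn (Set.Icc 0 τ) x g) :
    γ * ‖x 0‖ ^ 2 ≤ 3 * (∫ t in (0 : ℝ)..τ, ‖L (x t)‖ ^ 2)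
      + 3 * ‖L‖ ^ 2 * τ ^ 2 * ∫ t in (0 : ℝ)..τ, ‖g t‖ ^ 2 := by
  set J := ∫ t in (0 : ℝ)..τ, ‖g t‖ ^ 2
  -- The hypothesis is known for smooth data only. Comparing with the free solution issued from an
  -- arbitrary `y`, at a penalty `‖y - x 0‖²`, gives an inequality closed in `y`; it can be tested
  -- on the dense range of `Sph` and then read at `y = x 0`.
  suffices hy : ∀ y, γ * ‖y‖ ^ 2 ≤ 3 * (∫ t in (0 : ℝ)..τ, ‖L (x t)‖ ^ 2)
      + 3 * ‖L‖ ^ 2 * τ ^ 2 * J + 3 * ‖L‖ ^ 2 * τ * ‖y - x 0‖ ^ 2 by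
    simpa using hy (x 0)
  intro y
  refine W.denseRange_Sph.induction_on (p := fun y => γ * ‖y‖ ^ 2 ≤
    3 * (∫ t in (0 : ℝ)..τ, ‖L (x t)‖ ^ 2) + 3 * ‖L‖ ^ 2 * τ ^ 2 * J
      + 3 * ‖L‖ ^ 2 * τ * ‖y - x 0‖ ^ 2) y
    (isClosed_le (by fun_prop) (by fun_prop)) fun z => (hobs z).trans ?_
  set y := W.Sph z
  have hcx : ContinuousOn (fun t => ‖L (x t)‖ ^ 2) (Set.Icc 0 τ) :=
    (L.continuous.comp_continuousOn h.cont).norm.pow 2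
  have key : ∫ t in (0 : ℝ)..τ, ‖L (W.phase.U t y)‖ ^ 2 ≤ ∫ t in (0 : ℝ)..τ, (3 * ‖L (x t)‖ ^ 2
      + (3 * ‖L‖ ^ 2 * ‖y - x 0‖ ^ 2 + 3 * ‖L‖ ^ 2 * (τ * J))) := by
    refine intervalIntegral.integral_mono_on hτ
      ((L.continuous.comp (W.phase.cont y)).norm.pow 2 |>.intervalIntegrable _ _)
      (((continuousOn_const.mul hcx).add continuousOn_const).intervalIntegrable_of_Icc hτ)
      fun t ht => ?_
    have e : L (W.phase.U t y) = L (x t) + L (W.phase.U t (y - x 0))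
        - L (x t - W.phase.U t (x 0)) := by simp only [map_sub]; abel
    have h1 : ‖L (W.phase.U t (y - x 0))‖ ≤ ‖L‖ * ‖y - x 0‖ := by
      simpa only [W.phase.norm_map] using L.le_opNorm (W.phase.U t (y - x 0))
    have h2 := L.le_opNorm (x t - W.phase.U t (x 0))
    have h3 := h.norm_sub_sq_le ht
    have h4 : ‖L (W.phase.U t y)‖ ≤ ‖L (x t)‖ + ‖L‖ * ‖y - x 0‖
        + ‖L‖ * ‖x t - W.phase.U t (x 0)‖ := by
      rw [e]
      exact (_root_.norm_sub_le _ _).trans (add_le_add ((norm_add_le _ _).trans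
        (add_le_add_right h1 _)) h2)
    set a := ‖L (x t)‖
    set b := ‖L‖ * ‖y - x 0‖
    set c := ‖L‖ * ‖x t - W.phase.U t (x 0)‖ with hc
    have h5 : c ^ 2 ≤ ‖L‖ ^ 2 * (τ * J) := by
      rw [hc, mul_pow]; exact mul_le_mul_of_nonneg_left h3 (by positivity)
    have h6 : b ^ 2 = ‖L‖ ^ 2 * ‖y - x 0‖ ^ 2 := mul_pow _ _ _
    have h7 := pow_le_pow_left₀ (norm_nonneg _) h4 2
    nlinarith [sq_nonneg (a - b), sq_nonneg (a - c), sq_nonneg (b - c)]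
  refine key.trans_eq ?_
  rw [integral_add_on hτ (f := fun t => 3 * ‖L (x t)‖ ^ 2) (continuousOn_const.mul hcx)
    continuousOn_const, intervalIntegral.integral_const_mul, intervalIntegral.integral_const,
    smul_eq_mul]
  ring

variable {A : H →ₗ.[ℝ] H}

theorem IsRoot.energy_one (hW : W.IsRoot A) (hA : HypA1 A) (α β : H) :
    Cascade.energy A 1 (HSp.val (hW.equiv hA 2 α)) (HSp.val (hW.equiv hA 1 β))
      = ‖ph (W.S α) (W.S β)‖ ^ 2 / 2 := by
  have := hW.energy hA 0 α β
  rw [Nat.cast_zero, sub_zero, zero_add, pow_one] at this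
  rw [hW.val_equiv, hW.val_equiv, norm_ph_sq, pow_one, this]

/-- (A3) observes the velocity, whereas the coupling form contains the first entry. The rotation
`(a, b) ↦ (b, -a)` commutes with the evolution and exchanges the two, so (A3) applied to `rot x`
observes `x.fst`; the operator inequality between `P` and `C` does the rest. -/
theorem couplingObs (hW : W.IsRoot A) (hA : HypA1 A) {C P : H →L[ℝ] H} {α T₀ : ℝ} (hα : 0 < α)
    (hP : ∀ w, α * ‖P w‖ ^ 2 ≤ inner ℝ (C w) w)
    (hobs : ∀ T > T₀, ∃ γ : ℝ, 0 < γ ∧ ∀ w w', IsStrongSol A T (fun _ => 0) w w' →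
      γ * energy A 1 (HSp.val (w 0)) (HSp.val (w' 0))
        ≤ ∫ t in (0 : ℝ)..T, ‖P (HSp.val (w' t))‖ ^ 2) : CouplingObs W C := by
  refine ⟨fun w => le_trans (by positivity) (hP w), ?_⟩
  obtain ⟨γ, hγ, h⟩ := hobs (max T₀ 0 + 1) (by have := le_max_left T₀ 0; linarith)
  set τ := max T₀ 0 + 1
  have hτ : 0 < τ := by have := le_max_right T₀ 0; positivity
  set L : Ph H →L[ℝ] H := P.comp (WithLp.sndL 2 ℝ H H)
  have hL : ∀ z, γ / 2 * ‖W.Sph z‖ ^ 2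
      ≤ ∫ t in (0 : ℝ)..τ, ‖L (W.phase.U t (W.Sph z))‖ ^ 2 := by
    intro z
    have h1 := h _ _ ((hW.isStrongSol_iff hA).mpr (W.strongOn_free z τ))
    rw [hW.energy_one, W.phase.zero] at h1
    have e : ph (W.S z.fst) (W.S z.snd) = W.Sph z :=
      (W.Sph_ph _ _).symm
    have e2 : ∀ t, HSp.val (hW.equiv hA 1 (W.phase.U t z).snd) = (W.phase.U t (W.Sph z)).snd := by
      intro t
      rw [hW.val_equiv, pow_one, ← Sph_U, Sph_snd]
    simp only [e, e2] at h1
    refine le_trans (by linarith) h1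
  refine ⟨τ, 2 / γ * (3 / α + 3 * ‖L‖ ^ 2 * τ ^ 2), hτ, by positivity, fun x g hx => ?_⟩
  have h1 := (hx.mono (Set.subset_univ (Set.Icc 0 τ))).map_rot.le_of_obs hτ.le L hL
  simp only [norm_rot] at h1
  have hxc := continuousOn_univ.mp hx.cont
  have hgc := continuousOn_univ.mp hx.source
  have h2 : ∫ t in (0 : ℝ)..τ, ‖L (rot H (x t))‖ ^ 2
      ≤ ∫ t in (0 : ℝ)..τ, 1 / α * inner ℝ (C (x t).fst) (x t).fst := by
    refine intervalIntegral.integral_mono_on hτ.le ?_ ?_ fun t _ => ?_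
    · exact (L.continuous.comp ((rot H).continuous.comp hxc)).norm.pow 2
        |>.intervalIntegrable _ _
    · exact (continuous_const.mul ((C.continuous.comp hxc.phFst).inner hxc.phFst))
        |>.intervalIntegrable _ _
    · have e : L (rot H (x t)) = -P (x t).fst := by
        change P (rot H (x t)).snd = _
        rw [rot_snd, map_neg]
      rw [e, norm_neg, one_div, inv_mul_eq_div, le_div_iff₀' hα]
      exact hP _
  rw [intervalIntegral.integral_const_mul] at h2
  set Q := ∫ t in (0 : ℝ)..τ, inner ℝ (C (x t).fst) (x t).fst
  set J := ∫ t in (0 : ℝ)..τ, ‖g t‖ ^ 2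
  have hQ : 0 ≤ Q := intervalIntegral.integral_nonneg hτ.le fun t _ => le_trans (by positivity) (hP _)
  have hJ : 0 ≤ J := intervalIntegral.integral_nonneg hτ.le fun t _ => by positivity
  have h3 : γ / 2 * ‖x 0‖ ^ 2 ≤ (3 / α + 3 * ‖L‖ ^ 2 * τ ^ 2) * (Q + J) := by
    refine h1.trans ?_
    have a1 : 0 ≤ 3 / α * J := by positivity
    have a2 : 0 ≤ 3 * ‖L‖ ^ 2 * τ ^ 2 * Q := by positivity
    have a3 : 3 * (1 / α * Q) = 3 / α * Q := by ring
    linarith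
  calc ‖x 0‖ ^ 2 = 2 / γ * (γ / 2 * ‖x 0‖ ^ 2) := by field_simp
    _ ≤ 2 / γ * ((3 / α + 3 * ‖L‖ ^ 2 * τ ^ 2) * (Q + J)) := by gcongr
    _ = _ := by ring

variable {G : Type*} [NormedAddCommGroup G] [InnerProductSpace ℝ G]

/-- The observation `𝐁* (S² α, S β)` in terms of `(α, β)`. -/
def IsRoot.obs (hW : W.IsRoot A) (hA : HypA1 A) (Bs : HSp A 2 × H →L[ℝ] G) : Ph H →L[ℝ] G :=
  Bs.comp ((((hW.equiv hA 2).toContinuousLinearEquiv : H →L[ℝ] HSp A 2).comp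
    (WithLp.fstL 2 ℝ H H)).prod (W.S.comp (WithLp.sndL 2 ℝ H H)))

theorem IsRoot.obs_apply (hW : W.IsRoot A) (hA : HypA1 A) (Bs : HSp A 2 × H →L[ℝ] G) (α β : H) :
    hW.obs hA Bs (ph α β) = Bs (hW.equiv hA 2 α, HSp.val (hW.equiv hA 1 β)) := by
  rw [hW.val_equiv, pow_one]; rfl

theorem IsRoot.obs_of_val (hW : W.IsRoot A) (hA : HypA1 A) (Bs : HSp A 2 × H →L[ℝ] G)
    (w : HSp A 2) (w' : HSp A 1) :
    hW.obs hA Bs (ph ((hW.equiv hA 2).symm w) ((hW.equiv hA 1).symm w')) = Bs (w, HSp.val w') := by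
  rw [hW.obs_apply, LinearIsometryEquiv.apply_symm_apply, LinearIsometryEquiv.apply_symm_apply]

/-- Observability of forced strong solutions through an admissible observation. -/
theorem IsRoot.exists_window_obs (hW : W.IsRoot A) (hA : HypA1 A) {Bs : HSp A 2 × H →L[ℝ] G}
    (h4 : HypA4 A Bs) (h5 : HypA5 A Bs) : ∃ τ c : ℝ, 0 < τ ∧ 0 ≤ c ∧
      ∀ f α β, W.StrongOn τ f α β → ‖ph (W.S (α 0)) (W.S (β 0))‖ ^ 2 ≤
        c * ((∫ t in (0 : ℝ)..τ, ‖hW.obs hA Bs (ph (α t) (β t))‖ ^ 2)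
          + ∫ t in (0 : ℝ)..τ, ‖f t‖ ^ 2) := by
  obtain ⟨T₀, hT₀, h5⟩ := h5
  obtain ⟨R, hR, h5⟩ := h5 (T₀ + 1) (by linarith)
  obtain ⟨D, hD, h4⟩ := h4 (T₀ + 1) (by linarith)
  set τ := T₀ + 1
  have hτ : 0 < τ := by positivity
  set L := hW.obs hA Bs
  refine ⟨τ, 2 / R * (2 + 2 * (D * (τ / 2 + τ ^ 2 / 2 + 1))), hτ, by positivity,
    fun f α β h => ?_⟩
  set z := ph (α 0) (β 0)
  have hz : ph (W.S (α 0)) (W.S (β 0)) = W.Sph z :=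
      (W.Sph_ph _ _).symm
  -- The free solution with the same initial data is observed by (A5). The difference starts from
  -- zero, so Duhamel bounds its energy by the source, and (A4) bounds its observation; (A4) is
  -- indispensable since `Bs` need not be bounded in the energy norm.
  have hfree := W.strongOn_free z τ
  have h5' := h5 _ _ ((hW.isStrongSol_iff hA).mpr hfree)
  have hdiff := h.sub hfree
  have h4' := h4 _ _ _ ((hW.isStrongSol_iff hA).mpr hdiff)
  simp only [hW.energy_one, sub_zero, W.phase.zero, ← hW.obs_apply] at h4' h5'
  have hzf : z.fst = α 0 := rfl
  have hzs : z.snd = β 0 := rfl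
  set J := ∫ t in (0 : ℝ)..τ, ‖f t‖ ^ 2 with hJ
  have hJ0 : 0 ≤ J := intervalIntegral.integral_nonneg hτ.le fun t _ => by positivity
  have hm := h.mildOn 0
  simp only [pow_zero, one_apply_eq_self] at hm
  have hen : ∀ t ∈ Set.Icc 0 τ, ‖ph (W.S (α t - (W.phase.U t z).fst))
      (W.S (β t - (W.phase.U t z).snd))‖ ^ 2 ≤ τ * J := by
    intro t ht
    have := hm.norm_sub_sq_le ht
    simp only [norm_ph_zero] at this
    refine le_trans (le_of_eq ?_) this
    congr 2
    rw [hz, ← Sph_U]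
    exact Ph.ext (by simp [Sph_fst]) (by simp [Sph_snd])
  have hdc : ContinuousOn (fun t => ‖ph (W.S (α t - (W.phase.U t z).fst))
      (W.S (β t - (W.phase.U t z).snd))‖ ^ 2) (Set.Icc 0 τ) :=
    (((W.S.continuous.comp_continuousOn hdiff.cont).ph
      (W.S.continuous.comp_continuousOn hdiff.cont')).norm.pow 2)
  have hint : ∫ t in (0 : ℝ)..τ, ‖ph (W.S (α t - (W.phase.U t z).fst))
      (W.S (β t - (W.phase.U t z).snd))‖ ^ 2 / 2 ≤ τ * (τ * J / 2) := by
    have := intervalIntegral.integral_mono_on (μ := volume) hτ.le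
      (hdc.div_const 2 |>.intervalIntegrable_of_Icc hτ.le)
      (intervalIntegrable_const (c := τ * J / 2)) fun t ht => by
        have := hen t ht
        linarith
    rwa [intervalIntegral.integral_const, sub_zero, smul_eq_mul] at this
  have hτmem : τ ∈ Set.Icc 0 τ := ⟨hτ.le, le_rfl⟩
  have e0 : ‖ph (W.S (α 0 - z.fst)) (W.S (β 0 - z.snd))‖ = 0 := by
    simp [hzf, hzs]
  rw [e0] at h4'
  have h6 : ∫ t in (0 : ℝ)..τ, ‖L (ph (α t - (W.phase.U t z).fst) (β t - (W.phase.U t z).snd))‖ ^ 2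
      ≤ D * (τ / 2 + τ ^ 2 / 2 + 1) * J := by
    refine h4'.trans ?_
    rw [mul_assoc]
    refine mul_le_mul_of_nonneg_left ?_ hD.le
    have := hen τ hτmem
    nlinarith
  have hc1 : ContinuousOn (fun t => ‖L (ph (α t) (β t))‖ ^ 2) (Set.Icc 0 τ) :=
    (L.continuous.comp_continuousOn (h.cont.ph h.cont')).norm.pow 2
  have hc2 : ContinuousOn (fun t => ‖L (ph (α t - (W.phase.U t z).fst)
      (β t - (W.phase.U t z).snd))‖ ^ 2) (Set.Icc 0 τ) :=
    (L.continuous.comp_continuousOn (hdiff.cont.ph hdiff.cont')).norm.pow 2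
  have h7 : ∫ t in (0 : ℝ)..τ, ‖L (ph (W.phase.U t z).fst (W.phase.U t z).snd)‖ ^ 2
      ≤ ∫ t in (0 : ℝ)..τ, (2 * ‖L (ph (α t) (β t))‖ ^ 2
        + 2 * ‖L (ph (α t - (W.phase.U t z).fst) (β t - (W.phase.U t z).snd))‖ ^ 2) := by
    refine intervalIntegral.integral_mono_on hτ.le ?_ ?_ fun t _ => ?_
    · exact (L.continuous.comp ((W.phase.cont z).phFst.ph (W.phase.cont z).phSnd)).norm.pow 2
        |>.intervalIntegrable _ _
    · exact ((continuousOn_const.mul hc1).add (continuousOn_const.mul hc2))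
        |>.intervalIntegrable_of_Icc hτ.le
    · have e : ph (W.phase.U t z).fst (W.phase.U t z).snd = ph (α t) (β t)
          - ph (α t - (W.phase.U t z).fst) (β t - (W.phase.U t z).snd) :=
        Ph.ext (by simp) (by simp)
      rw [e, map_sub]
      set a := L (ph (α t) (β t))
      set b := L (ph (α t - (W.phase.U t z).fst) (β t - (W.phase.U t z).snd))
      have := pow_le_pow_left₀ (norm_nonneg _) (norm_sub_le a b) 2
      nlinarith [sq_nonneg (‖a‖ - ‖b‖)]
  rw [integral_add_on hτ.le (f := fun t => 2 * ‖L (ph (α t) (β t))‖ ^ 2)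
    (g := fun t => 2 * ‖L (ph (α t - (W.phase.U t z).fst) (β t - (W.phase.U t z).snd))‖ ^ 2)
    (continuousOn_const.mul hc1) (continuousOn_const.mul hc2),
    intervalIntegral.integral_const_mul, intervalIntegral.integral_const_mul] at h7
  set O := ∫ t in (0 : ℝ)..τ, ‖L (ph (α t) (β t))‖ ^ 2
  have hO : 0 ≤ O := intervalIntegral.integral_nonneg hτ.le fun t _ => by positivity
  have h8 := h5'.trans h7
  set k := D * (τ / 2 + τ ^ 2 / 2 + 1)
  have hk : 0 ≤ k := by positivity
  have hα : ph (W.S z.fst) (W.S z.snd) = ph (W.S (α 0)) (W.S (β 0)) := rfl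
  rw [hα] at h8
  set y := ‖ph (W.S (α 0)) (W.S (β 0))‖ ^ 2
  have h9 : R / 2 * y ≤ (2 + 2 * k) * (O + J) := by nlinarith [mul_nonneg hk hO]
  calc y = 2 / R * (R / 2 * y) := by field_simp
    _ ≤ 2 / R * ((2 + 2 * k) * (O + J)) := by gcongr
    _ = _ := by ring

end WaveGroup

end Cascade

/-! ### From weighted estimates to observability in finite time. -/

namespace Cascade

open MeasureTheory

theorem tame_pow_two : Tame fun t => t ^ 2 := by
  have h : Tame fun t : ℝ => t := by
    refine ⟨continuous_id, fun ε hε => ⟨1 / ε, by positivity, fun t => ?_⟩⟩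
    rw [one_div, inv_mul_eq_div, le_div_iff₀' hε]
    linarith [Real.add_one_le_exp (ε * |t|)]
  exact h.sq

theorem tame_of_bounded {h : ℝ → ℝ} (hc : Continuous h) {B : ℝ} (hB : ∀ t, |h t| ≤ B) :
    Tame h := by
  have hB0 : 0 ≤ B := (abs_nonneg _).trans (hB 0)
  refine ⟨hc, fun ε hε => ⟨B, hB0, fun t => (hB t).trans ?_⟩⟩
  exact le_mul_of_one_le_right hB0 (Real.one_le_exp (by positivity))

namespace WaveGroup

variable {H : Type*} [NormedAddCommGroup H] [InnerProductSpace ℝ H] [CompleteSpace H]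
  {W : WaveGroup H} {K : ℕ → ℕ → H →L[ℝ] H} {n : ℕ}

omit [CompleteSpace H] in
theorem Chain.translate {x : ℕ → ℝ → Ph H} (h : W.Chain K n x) (s : ℝ) :
    W.Chain K n fun i t => x i (t + s) :=
  ⟨fun _ => h.zero _, fun i hi him => (h.mild i hi him).shift s⟩

theorem exists_chain_growth_sum (W : WaveGroup H) (K : ℕ → ℕ → H →L[ℝ] H) (n : ℕ) {ε : ℝ}
    (hε : 0 < ε) : ∃ M, 0 ≤ M ∧ ∀ x, W.Chain K n x → ∀ s t,
      ∑ j ∈ Finset.range (n + 1), ‖x j (t + s)‖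
        ≤ M * (∑ j ∈ Finset.range (n + 1), ‖x j s‖) * Real.cosh (ε * t) := by
  have h := fun i : ℕ => fun hi : i ≤ n => exists_chain_growth W K n hε i hi
  choose M hM hb using h
  refine ⟨∑ j : Fin (n + 1), M j (by omega), Finset.sum_nonneg fun j _ => hM _ _,
    fun x hx s t => ?_⟩
  rw [Finset.sum_range, Finset.sum_mul, Finset.sum_mul]
  refine Finset.sum_le_sum fun j _ => ?_
  have h1 := hb j (by omega) _ (hx.translate s) t
  simp only [zero_add] at h1
  refine h1.trans (mul_le_mul_of_nonneg_right (mul_le_mul_of_nonneg_left ?_ (hM _ _))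
    (Real.cosh_pos _).le)
  exact Finset.sum_le_sum_of_subset_of_nonneg
    (Finset.range_subset_range.mpr (by omega)) fun _ _ _ => norm_nonneg _

/-- The growth rate `l / 6` enters three times, once for `t²` and twice for the square of the state,
which leaves `exp (-l |t| / 2)`, integrable. -/
theorem exists_wint_tail (W : WaveGroup H) (K : ℕ → ℕ → H →L[ℝ] H) (n : ℕ) {l : ℝ} (hl : 0 < l) :
    ∃ Q, 0 ≤ Q ∧ ∀ x, W.Chain K n x →
      wint l (fun s => s ^ 2 * ‖x n s‖ ^ 2) ≤ Q * (∑ j ∈ Finset.range (n + 1), ‖x j 0‖) ^ 2 := by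
  obtain ⟨M, hM, hb⟩ := exists_chain_growth_sum W K n (ε := l / 6) (by positivity)
  have hint := integrable_exp_neg_abs (c := l / 2) (by positivity)
  refine ⟨M ^ 2 * (72 / l ^ 2) * ∫ t : ℝ, Real.exp (-(l / 2) * |t|), by
    have : 0 ≤ ∫ t : ℝ, Real.exp (-(l / 2) * |t|) := integral_nonneg fun _ => (Real.exp_pos _).le
    positivity, fun x hx => ?_⟩
  set E := ∑ j ∈ Finset.range (n + 1), ‖x j 0‖
  have hE : 0 ≤ E := Finset.sum_nonneg fun _ _ => norm_nonneg _
  have e : M ^ 2 * (72 / l ^ 2) * (∫ t : ℝ, Real.exp (-(l / 2) * |t|)) * E ^ 2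
      = ∫ t : ℝ, (M ^ 2 * (72 / l ^ 2) * E ^ 2) * Real.exp (-(l / 2) * |t|) := by
    rw [integral_const_mul]; ring
  rw [wint, e]
  refine integral_mono ((tame_pow_two.mul (hx.tame le_rfl).sq).integrable hl)
    (hint.const_mul _) fun t => ?_
  have h1 : ‖x n t‖ ≤ M * E * Real.exp (l / 6 * |t|) := by
    have := hb x hx 0 t
    rw [add_zero] at this
    exact (Finset.single_le_sum (f := fun j => ‖x j t‖) (fun _ _ => norm_nonneg _)
      (Finset.self_mem_range_succ n)).trans (this.trans
        (mul_le_mul_of_nonneg_left (cosh_le_exp_abs _ _ (by positivity)) (by positivity)))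
  have h2 : t ^ 2 ≤ 72 / l ^ 2 * Real.exp (l / 6 * |t|) := by
    have := Real.quadratic_le_exp_of_nonneg (x := l / 6 * |t|) (by positivity)
    have h3 : (l / 6 * |t|) ^ 2 / 2 = l ^ 2 / 72 * t ^ 2 := by rw [mul_pow, sq_abs]; ring
    have h4 : l ^ 2 / 72 * t ^ 2 ≤ Real.exp (l / 6 * |t|) := by
      have : 0 ≤ l / 6 * |t| := by positivity
      linarith
    calc t ^ 2 = 72 / l ^ 2 * (l ^ 2 / 72 * t ^ 2) := by field_simp
      _ ≤ _ := by gcongr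
  have h5 := pow_le_pow_left₀ (norm_nonneg _) h1 2
  calc wt l t * (t ^ 2 * ‖x n t‖ ^ 2)
      ≤ Real.exp (-l * |t|) * (72 / l ^ 2 * Real.exp (l / 6 * |t|)
        * (M * E * Real.exp (l / 6 * |t|)) ^ 2) := by
        gcongr
        exact wt_le hl.le t
    _ = M ^ 2 * (72 / l ^ 2) * E ^ 2 * (Real.exp (-l * |t|) * Real.exp (l / 6 * |t|)
        * Real.exp (l / 6 * |t|) * Real.exp (l / 6 * |t|)) := by ring
    _ = _ := by
      rw [← Real.exp_add, ← Real.exp_add, ← Real.exp_add]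
      ring_nf

/-- The growth estimate is read backwards, from time `t` to `0`: the initial size is at most `cosh
t` times the size at `t`. Dividing by `cosh² t` and integrating against the weight gives the bound.
-/
theorem exists_initial_le_wen (W : WaveGroup H) (K : ℕ → ℕ → H →L[ℝ] H) (n : ℕ) {l : ℝ}
    (hl : 0 < l) : ∃ M, 0 ≤ M ∧ ∀ x, W.Chain K n x →
      (∑ j ∈ Finset.range (n + 1), ‖x j 0‖) ^ 2 ≤ M * ∑ i ∈ Finset.range (n + 1), wen l (x i) := by
  obtain ⟨M, hM, hb⟩ := exists_chain_growth_sum W K n (ε := 1) one_pos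
  have hc1 : ∀ t, 1 ≤ Real.cosh t := Real.one_le_cosh
  have hφ : Tame fun t => 1 / Real.cosh t ^ 2 := by
    refine tame_of_bounded (B := 1) ?_ fun t => ?_
    · exact continuous_const.div (by fun_prop) fun t => by have := Real.cosh_pos t; positivity
    · have := hc1 t
      rw [abs_of_nonneg (by positivity), div_le_one (by positivity)]
      nlinarith
  have hpos : 0 < wint l fun t => 1 / Real.cosh t ^ 2 := by
    refine integral_pos_of_integrable_nonneg_nonzero (x := 0) ((continuous_wt l).mul hφ.1)
      (hφ.integrable hl) (fun t => ?_) ?_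
    · have := wt_pos l t
      change 0 ≤ wt l t * (1 / Real.cosh t ^ 2)
      positivity
    · have := wt_pos l 0
      simpa using this.ne'
  set φ₀ := wint l fun t => 1 / Real.cosh t ^ 2
  refine ⟨M ^ 2 * (n + 1) / φ₀, by positivity, fun x hx => ?_⟩
  set E := ∑ j ∈ Finset.range (n + 1), ‖x j 0‖
  have hE : 0 ≤ E := Finset.sum_nonneg fun _ _ => norm_nonneg _
  have hts : ∀ m ≤ n + 1, Tame (fun t => ∑ i ∈ Finset.range m, ‖x i t‖ ^ 2) ∧
      wint l (fun t => ∑ i ∈ Finset.range m, ‖x i t‖ ^ 2)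
        = ∑ i ∈ Finset.range m, wen l (x i) := by
    intro m
    induction m with
    | zero => exact fun _ => ⟨by simpa using tame_of_bounded (B := 0) continuous_const (by simp),
        by simp [wint]⟩
    | succ m ih =>
      intro hm
      obtain ⟨h1, h2⟩ := ih (by omega)
      have h3 := (hx.tame (i := m) (by omega)).sq
      simp only [Finset.sum_range_succ]
      exact ⟨h1.add h3, by rw [wint_add hl h1 h3, h2, wen]⟩
  obtain ⟨ht, hw⟩ := hts (n + 1) le_rfl
  have hpt : ∀ t, E ^ 2 * (1 / Real.cosh t ^ 2)
      ≤ M ^ 2 * (n + 1) * ∑ i ∈ Finset.range (n + 1), ‖x i t‖ ^ 2 := by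
    intro t
    have h1 := hb x hx t (-t)
    rw [neg_add_cancel, one_mul, Real.cosh_neg] at h1
    have h2 := pow_le_pow_left₀ hE h1 2
    have h3 := sq_sum_le_card_mul_sum_sq (s := Finset.range (n + 1)) (f := fun i => ‖x i t‖)
    rw [Finset.card_range] at h3
    push_cast at h3
    have hc := Real.cosh_pos t
    rw [mul_one_div, div_le_iff₀ (by positivity)]
    calc E ^ 2 ≤ M ^ 2 * (∑ i ∈ Finset.range (n + 1), ‖x i t‖) ^ 2 * Real.cosh t ^ 2 := by
          refine h2.trans_eq (by ring)
      _ ≤ M ^ 2 * ((n + 1) * ∑ i ∈ Finset.range (n + 1), ‖x i t‖ ^ 2) * Real.cosh t ^ 2 := by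
          gcongr
      _ = _ := by ring
  have key := wint_mono hl (hφ.const_mul (E ^ 2)) (ht.const_mul _) hpt
  rw [wint_const_mul, wint_const_mul, hw] at key
  rw [div_mul_eq_mul_div, le_div_iff₀ hpos]
  exact key

/-- Observability of the whole chain through its last component. -/
theorem exists_chain_obs (hn : 1 ≤ n) (hL : LowerBound W K n) {c τ : ℝ} (hc : 0 ≤ c) (hτ : 0 < τ) :
    ∃ R d : ℝ, 0 < R ∧ 0 ≤ d ∧ ∀ x O, W.Chain K n x → 0 ≤ O →
      (∀ s, |s| ≤ R → ‖x n s‖ ^ 2 ≤ c * (O + ∫ r in (0 : ℝ)..τ, ‖x (n - 1) (s + r)‖ ^ 2)) →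
      ∀ j ≤ n, ‖x j (-R)‖ ^ 2 ≤ d * O := by
  obtain ⟨C, l₀, hC, hl₀, low⟩ := hL
  obtain ⟨k, rfl⟩ : ∃ k, n = k + 1 := ⟨n - 1, by omega⟩
  simp only [Nat.add_sub_cancel]
  set q := Real.exp 1 * τ * c
  have hq : 0 ≤ q := by positivity
  -- The weight is now fixed: `l ≤ l₀` for the lower bound, `l τ ≤ 1` for the sliding averages, and
  -- the last term makes `q C l² ≤ 1/2`, so that the component `n - 1` is absorbed.
  set l := min (min l₀ 1) (min (1 / τ) (1 / (2 * (q * C + 1)))) with hldef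
  have hl : 0 < l := by positivity
  have hl0 : l ≤ l₀ := (min_le_left _ _).trans (min_le_left _ _)
  have hl1 : l ≤ 1 := (min_le_left _ _).trans (min_le_right _ _)
  have hlτ : l * τ ≤ 1 :=
    (le_div_iff₀ hτ).mp ((min_le_right _ _).trans (min_le_left _ _))
  have hlq : l * (2 * (q * C + 1)) ≤ 1 :=
    (le_div_iff₀ (by positivity)).mp ((min_le_right _ _).trans (min_le_right _ _))
  have habs : q * (C * l ^ 2) ≤ 1 / 2 := by
    have h1 : l * (q * C) ≤ 1 / 2 := by linarith
    have h2 : l * (l * (q * C)) ≤ 1 * (l * (q * C)) :=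
      mul_le_mul_of_nonneg_right hl1 (by positivity)
    have h3 : q * (C * l ^ 2) = l * (l * (q * C)) := by ring
    linarith
  obtain ⟨Q, hQ, tail⟩ := exists_wint_tail W K (k + 1) hl
  obtain ⟨M, hM, init⟩ := exists_initial_le_wen W K (k + 1) hl
  obtain ⟨M', hM', growth⟩ := exists_chain_growth_sum W K (k + 1) (ε := 1) one_pos
  set Z := wint l fun _ => 1
  have hZ : 0 ≤ Z := wint_nonneg fun _ => zero_le_one
  set M₂ := M * (C + 1)
  have hM₂ : 0 ≤ M₂ := by positivity
  -- Then `R² ≥ 4 Q M₂`, and the tail below costs at most a quarter of the weighted energy of the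
  -- last component.
  set R := 1 + 4 * (Q * M₂)
  have hR1 : 1 ≤ R := by have : 0 ≤ 4 * (Q * M₂) := by positivity
                         linarith
  have hR0 : 0 < R := by linarith
  have hRR : 4 * (Q * M₂) ≤ R ^ 2 := by nlinarith
  refine ⟨R, (M' * Real.cosh R) ^ 2 * (M₂ * (4 * (c * Z))), hR0, by positivity,
    fun x O hx hO hobs j hj => ?_⟩
  have tX := (hx.tame (i := k + 1) le_rfl).sq
  have tY := (hx.tame (i := k) (by omega)).sq
  have tO : Tame fun _ => c * O * 1 := (tame_of_bounded (B := 1) continuous_const (by simp)).const_mul _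
  have tT := (tame_pow_two.mul tX).const_mul (1 / R ^ 2)
  -- The window estimate is available for `|s| ≤ R` only. Subtracting `s²/R²` times the squared norm
  -- makes `F` nonpositive beyond `R`, so that the inequality for sliding averages holds on the
  -- whole line.
  set F : ℝ → ℝ := fun s => ‖x (k + 1) s‖ ^ 2 + (-1) * (c * O * 1
    + 1 / R ^ 2 * (s ^ 2 * ‖x (k + 1) s‖ ^ 2)) with hF
  have hFt : Tame F := tX.add ((tO.add tT).const_mul (-1))
  have key := integral_window_le hl hτ hlτ (h := fun t => c * ‖x k t‖ ^ 2) (tY.const_mul c)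
    (fun t => by positivity) hFt fun s => by
      rw [intervalIntegral.integral_const_mul]
      have hi : 0 ≤ ∫ r in (0 : ℝ)..τ, ‖x k (s + r)‖ ^ 2 :=
        intervalIntegral.integral_nonneg hτ.le fun _ _ => by positivity
      simp only [hF]
      rcases le_or_gt |s| R with hs | hs
      · have := hobs s hs
        have h0 : 0 ≤ 1 / R ^ 2 * (s ^ 2 * ‖x (k + 1) s‖ ^ 2) := by positivity
        linarith
      · have h1 : R ^ 2 ≤ s ^ 2 := by
          rw [← sq_abs s]; exact pow_le_pow_left₀ hR0.le hs.le 2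
        have h2 : ‖x (k + 1) s‖ ^ 2 ≤ 1 / R ^ 2 * (s ^ 2 * ‖x (k + 1) s‖ ^ 2) := by
          rw [one_div, inv_mul_eq_div, le_div_iff₀ (by positivity), mul_comm]
          exact mul_le_mul_of_nonneg_right h1 (by positivity)
        have h3 : 0 ≤ c * O := by positivity
        have h4 := mul_nonneg hc hi
        linarith
  have e1 : wint l F = wen l (x (k + 1)) - (c * O * Z
      + 1 / R ^ 2 * wint l fun s => s ^ 2 * ‖x (k + 1) s‖ ^ 2) := by
    rw [hF, wint_add hl tX ((tO.add tT).const_mul (-1)), wint_const_mul, wint_add hl tO tT,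
      wint_const_mul, wint_const_mul, wen]
    ring
  rw [e1, wint_const_mul] at key
  set E := ∑ j ∈ Finset.range (k + 1 + 1), ‖x j 0‖
  set Y := wen l (x (k + 1))
  have hY : 0 ≤ Y := wen_nonneg _ _
  have low' := low l hl hl0 x hx
  have h1 : wen l (x k) ≤ C * l ^ 2 * Y :=
    (Finset.single_le_sum (f := fun i => wen l (x i)) (fun i _ => wen_nonneg _ _)
      (Finset.self_mem_range_succ k)).trans low'
  have h2 : E ^ 2 ≤ M₂ * Y := by
    refine (init x hx).trans ?_
    rw [Finset.sum_range_succ, mul_assoc]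
    refine mul_le_mul_of_nonneg_left ?_ hM
    have : C * l ^ 2 * Y ≤ C * Y :=
      mul_le_mul_of_nonneg_right (mul_le_of_le_one_right hC (pow_le_one₀ hl.le hl1)) hY
    linarith
  have h3 : q * wen l (x k) ≤ 1 / 2 * Y := by
    have h5 := mul_le_mul_of_nonneg_left h1 hq
    have h6 := mul_le_mul_of_nonneg_right habs hY
    linarith
  have h4 : 1 / R ^ 2 * wint l (fun s => s ^ 2 * ‖x (k + 1) s‖ ^ 2) ≤ 1 / 4 * Y := by
    rw [one_div, inv_mul_eq_div, div_le_iff₀ (by positivity)]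
    have h5 := (tail x hx).trans (mul_le_mul_of_nonneg_left h2 hQ)
    have h6 := mul_le_mul_of_nonneg_right hRR hY
    linarith
  have h5 : Y ≤ 4 * (c * Z) * O := by
    change _ ≤ Real.exp 1 * τ * (c * wen l (x k)) at key
    have h6 : Real.exp 1 * τ * (c * wen l (x k)) = q * wen l (x k) := by ring
    linarith
  -- The estimate at the centre of the interval is transported to its left end, which will be the
  -- initial time.
  have h6 := growth x hx 0 (-R)
  rw [add_zero, one_mul, Real.cosh_neg] at h6
  have h7 : ‖x j (-R)‖ ≤ M' * E * Real.cosh R :=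
    (Finset.single_le_sum (f := fun j => ‖x j (-R)‖) (fun _ _ => norm_nonneg _)
      (Finset.mem_range.mpr (by omega : j < k + 1 + 1))).trans h6
  calc ‖x j (-R)‖ ^ 2 ≤ (M' * E * Real.cosh R) ^ 2 := pow_le_pow_left₀ (norm_nonneg _) h7 2
    _ = (M' * Real.cosh R) ^ 2 * E ^ 2 := by ring
    _ ≤ (M' * Real.cosh R) ^ 2 * (M₂ * (4 * (c * Z) * O)) := by
      gcongr
      exact h2.trans (mul_le_mul_of_nonneg_left h5 hM₂)
    _ = _ := by ring

/-- The solution of the Cauchy problem with a continuous source. -/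
theorem exists_mildOn (x₀ : Ph H) {g : ℝ → Ph H} (hg : Continuous g) :
    ∃ x, W.MildOn Set.univ x g ∧ x 0 = x₀ := by
  have hc := W.phase.continuous_neg_apply hg
  refine ⟨fun t => W.phase.U t (x₀ + ∫ r in (0 : ℝ)..t, W.phase.U (-r) (g r)),
    mildOn_of_hasDerivAt hg fun t => ?_, by simp [W.phase.zero]⟩
  simp only [W.phase.neg_apply]
  exact (intervalIntegral.integral_hasDerivAt_right (hc.intervalIntegrable 0 t)
    hc.aestronglyMeasurable.stronglyMeasurableAtFilter hc.continuousAt).const_add x₀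

theorem MildOn.eqOn {T : ℝ} {x y g k : ℝ → Ph H} (hx : W.MildOn (Set.Icc 0 T) x g)
    (hy : W.MildOn (Set.Icc 0 T) y k) (hg : Set.EqOn g k (Set.Icc 0 T)) (h0 : x 0 = y 0) :
    Set.EqOn x y (Set.Icc 0 T) := by
  intro t ht
  have hd : W.MildOn (Set.Icc 0 T) (fun t => x t - y t) fun _ => 0 := by
    refine ⟨hx.cont.sub hy.cont, continuousOn_const, fun t ht => ?_⟩
    have := (hx.deriv t ht).sub (hy.deriv t ht)
    rw [hg ht, add_sub_add_right_eq_sub, ← map_sub] at this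
    simp only [map_sub, map_zero, add_zero] at this ⊢
    exact this
  have := (hd.mono (Set.Icc_subset_Icc_right ht.2)).norm_le ht.1
  simp only [h0, sub_self, norm_zero, intervalIntegral.integral_zero, add_zero] at this
  exact sub_eq_zero.mp (norm_le_zero_iff.mp this)

/-- Chains on a compact interval extend to chains on the line. -/
theorem exists_chain_extension {T : ℝ} {x : ℕ → ℝ → Ph H}
    (h : ∀ i, 1 ≤ i → i ≤ n → W.MildOn (Set.Icc 0 T) (x i)
      fun t => ph 0 (-K (n - i) i (if i = 1 then 0 else (x (i - 1) t).fst))) :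
    ∃ y, W.Chain K n y ∧ ∀ i, 1 ≤ i → i ≤ n → Set.EqOn (x i) (y i) (Set.Icc 0 T) := by
  suffices hm : ∀ m ≤ n, ∃ y : ℕ → ℝ → Ph H, (∀ t, y 0 t = 0) ∧ ∀ i, 1 ≤ i → i ≤ m →
      W.MildOn Set.univ (y i) (fun t => ph 0 (-K (n - i) i (y (i - 1) t).fst)) ∧
      Set.EqOn (x i) (y i) (Set.Icc 0 T) by
    obtain ⟨y, h0, hy⟩ := hm n le_rfl
    exact ⟨y, ⟨h0, fun i hi him => (hy i hi him).1⟩, fun i hi him => (hy i hi him).2⟩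
  intro m
  induction m with
  | zero => exact fun _ => ⟨fun _ _ => 0, fun _ => rfl, fun i hi hi0 => by omega⟩
  | succ m ih =>
    intro hm
    obtain ⟨y, h0, hy⟩ := ih (by omega)
    have hyc : Continuous (y m) := by
      rcases Nat.eq_zero_or_pos m with rfl | hm0
      · rw [funext h0]; exact continuous_const
      · exact continuousOn_univ.mp (hy m hm0 le_rfl).1.cont
    obtain ⟨z, hz, hz0⟩ := exists_mildOn (W := W) (x (m + 1) 0)
      (g := fun t => ph 0 (-K (n - (m + 1)) (m + 1) (y m t).fst))
      (continuous_const.ph ((K _ _).continuous.comp hyc.phFst).neg)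
    refine ⟨Function.update y (m + 1) z, fun t => by rw [Function.update_of_ne (by omega)]; exact h0 t,
      fun i hi him => ?_⟩
    rw [Function.update_of_ne (by omega : i - 1 ≠ m + 1)]
    rcases eq_or_ne i (m + 1) with rfl | hne
    · rw [Function.update_self, Nat.add_sub_cancel]
      refine ⟨hz, (h (m + 1) hi hm).eqOn (hz.mono (Set.subset_univ _)) (fun t ht => ?_) hz0.symm⟩
      rcases Nat.eq_zero_or_pos m with rfl | hm0
      · simp [h0]
      · beta_reduce
        rw [if_neg (by omega), Nat.add_sub_cancel, (hy m hm0 le_rfl).2 ht]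
    · rw [Function.update_of_ne hne]
      exact hy i hi (by omega)

end WaveGroup

end Cascade

/-! ### The cascade in normalised variables. -/

namespace Cascade

open MeasureTheory

theorem integral_shift_le {T s τ : ℝ} (hs : 0 ≤ s) (hτ : 0 ≤ τ) (hsτ : s + τ ≤ T) {q : ℝ → ℝ}
    (hq : ContinuousOn q (Set.Icc 0 T)) (h0 : ∀ t, 0 ≤ q t) :
    ∫ t in (0 : ℝ)..τ, q (t + s) ≤ ∫ t in (0 : ℝ)..T, q t := by
  rw [intervalIntegral.integral_comp_add_right, zero_add]
  exact intervalIntegral.integral_mono_interval hs (by linarith) (by linarith)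
    (Filter.Eventually.of_forall h0) (hq.intervalIntegrable_of_Icc (by linarith))

namespace WaveGroup

variable {H : Type*} [NormedAddCommGroup H] [InnerProductSpace ℝ H] [CompleteSpace H]
  {W : WaveGroup H} {A : H →ₗ.[ℝ] H}

theorem denseRange_S_pow (W : WaveGroup H) (k : ℕ) : DenseRange (W.S ^ k) := by
  induction k with
  | zero => exact Function.surjective_id.denseRange
  | succ k ih =>
    rw [pow_succ]
    exact ih.comp W.denseRange_S (W.S ^ k).continuous

theorem pow_two_apply (W : WaveGroup H) (k : ℕ) (x : H) :
    (W.S ^ k) ((W.S ^ 2) x) = (W.S ^ (k + 1)) (W.S x) := by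
  rw [← mul_apply_eq_comp, ← mul_apply_eq_comp, ← pow_add, ← pow_succ]

/-- `K k i` stands for `S^k C_{i,i-1} S^{-k}`, bounded for exactly the range of `k` in (A2). The
value `0` at `i = 1` records that the first equation has no source. -/
theorem IsRoot.exists_coupling_family (hW : W.IsRoot A) (hA : HypA1 A) {n : ℕ}
    {C : ℕ → ℕ → H →L[ℝ] H} {P : ℕ → H →L[ℝ] H} (hA2 : HypA2 A n C P) :
    ∃ K : ℕ → ℕ → H →L[ℝ] H,
      (∀ i, 2 ≤ i → i ≤ n → ∀ k ≤ n - i + 1, ∀ x,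
        (W.S ^ k) (C i (i - 1) x) = K k i ((W.S ^ k) x)) ∧ ∀ k, K k 1 = 0 := by
  have h : ∀ k i : ℕ, ∃ L : H →L[ℝ] H, (2 ≤ i → i ≤ n → k ≤ n - i + 1 → ∀ x,
      (W.S ^ k) (C i (i - 1) x) = L ((W.S ^ k) x)) ∧ (i = 1 → L = 0) := by
    intro k i
    by_cases hi : 2 ≤ i ∧ i ≤ n ∧ k ≤ n - i + 1
    · obtain ⟨L, hL⟩ := hW.exists_boundedOn hA
        ((hA2 i (Finset.mem_Icc.mpr ⟨hi.1, hi.2.1⟩)).1 k hi.2.2)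
      exact ⟨L, fun _ _ _ => hL, fun h1 => by omega⟩
    · exact ⟨0, fun h1 h2 h3 => absurd ⟨h1, h2, h3⟩ hi, fun _ => rfl⟩
  choose K hK using h
  exact ⟨K, fun i hi hin k hk => (hK k i).1 hi hin hk, fun k => (hK k 1).2 rfl⟩

/-- Both sides are continuous and agree on the range of `S^k`, which is dense. -/
theorem coupling_family_comm {K : H →L[ℝ] H} {K' L : H →L[ℝ] H} {k : ℕ}
    (h : ∀ x, (W.S ^ k) (L x) = K ((W.S ^ k) x))
    (h' : ∀ x, (W.S ^ (k + 1)) (L x) = K' ((W.S ^ (k + 1)) x)) (x : H) :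
    W.S (K x) = K' (W.S x) := by
  refine congrFun ((W.denseRange_S_pow k).equalizer (W.S.continuous.comp K.continuous)
    (K'.continuous.comp W.S.continuous) (funext fun y => ?_)) x
  simp only [Function.comp_apply]
  rw [← h, ← mul_apply_eq_comp, ← pow_succ', h', pow_succ', mul_apply_eq_comp]

theorem energy_level (hW : W.IsRoot A) (hA : HypA1 A) {n i : ℕ} (hi : i ≤ n) (w : HSp A 2)
    (w' : HSp A 1) : Cascade.energy A (1 + (i : ℤ) - (n : ℤ)) (HSp.val w) (HSp.val w')
      = ‖ph ((W.S ^ (n - i)) (W.S ((hW.equiv hA 2).symm w)))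
          ((W.S ^ (n - i)) (W.S ((hW.equiv hA 1).symm w')))‖ ^ 2 / 2 := by
  have := hW.energy hA (n - i) ((hW.equiv hA 2).symm w) ((hW.equiv hA 1).symm w')
  rw [hW.pow_val_symm, hW.pow_val_symm] at this
  rw [norm_ph_sq, ← mul_apply_eq_comp, ← mul_apply_eq_comp, ← pow_succ, ← this]
  congr 1
  omega

variable {n p : ℕ} {C : ℕ → ℕ → H →L[ℝ] H} {P : ℕ → H →L[ℝ] H}
  {u : ℕ → ℝ → HSp A 2} {u' : ℕ → ℝ → HSp A 1}

/-- The state of the `i`-th component of the cascade in normalised variables. -/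
def IsRoot.nrm (hW : W.IsRoot A) (hA : HypA1 A) (n : ℕ) (u : ℕ → ℝ → HSp A 2)
    (u' : ℕ → ℝ → HSp A 1) (i : ℕ) (t : ℝ) : Ph H :=
  ph ((W.S ^ (n - i)) (W.S ((hW.equiv hA 2).symm (u i t))))
    ((W.S ^ (n - i)) (W.S ((hW.equiv hA 1).symm (u' i t))))

theorem IsRoot.nrm_mildOn (hW : W.IsRoot A) (hA : HypA1 A) {T : ℝ} (h : IsCascadeSol A n p C T u u')
    {i : ℕ} (hi : i ∈ Finset.Icc 1 (n + p)) : W.MildOn (Set.Icc 0 T) (hW.nrm hA n u u' i)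
      fun t => ph 0 ((W.S ^ (n - i)) (-coupling n C (fun k => HSp.val (u k t)) i)) :=
  (hW.strongOn hA (h i hi)).mildOn (n - i)

/-- The extra power of `S` in the normalisation of the component `i - 1` is the second `S` in `w =
S² α`: this turns the coupling into a bounded operator between normalised states. -/
theorem IsRoot.nrm_fst_pred (hW : W.IsRoot A) (hA : HypA1 A) {i : ℕ} (hi : i ≤ n) (hi0 : 1 ≤ i)
    (t : ℝ) : (hW.nrm hA n u u' (i - 1) t).fst = (W.S ^ (n - i)) (HSp.val (u (i - 1) t)) := by
  change (W.S ^ (n - (i - 1))) _ = _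
  rw [← hW.pow_val_symm hA, W.pow_two_apply, show n - (i - 1) = n - i + 1 by omega]

/-- The equations beyond `n` contain `u_j` for `j ≥ n - 1` only; for these indices the normalised
state controls `u_j` in `H` itself, with equality to its first entry when `j = n - 1`. -/
theorem IsRoot.norm_val_le (hW : W.IsRoot A) (hA : HypA1 A) {j : ℕ} (hj : n - 1 ≤ j) (hn : 1 ≤ n)
    (t : ℝ) : ‖HSp.val (u j t)‖ ≤ (1 + ‖W.S‖) * ‖hW.nrm hA n u u' j t‖ := by
  rcases hj.eq_or_lt with rfl | hj
  · have h := hW.nrm_fst_pred hA (u := u) (u' := u') le_rfl hn t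
    rw [Nat.sub_self, pow_zero, one_apply_eq_self] at h
    rw [← h]
    refine (Ph.norm_fst_le _).trans (le_mul_of_one_le_left (norm_nonneg _) ?_)
    have := norm_nonneg W.S
    linarith
  · have e : HSp.val (u j t) = W.S (hW.nrm hA n u u' j t).fst := by
      change _ = W.S ((W.S ^ (n - j)) _)
      rw [show n - j = 0 by omega, pow_zero, one_apply_eq_self, ← hW.pow_val_symm hA, W.S_sq]
    rw [e]
    refine (W.S.le_opNorm _).trans ?_
    have h1 := (hW.nrm hA n u u' j t).norm_fst_le
    have h2 := norm_nonneg W.S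
    have h3 := norm_nonneg (hW.nrm hA n u u' j t)
    nlinarith [mul_le_mul_of_nonneg_left h1 h2]

variable {G : ℕ → Type*} [∀ k, NormedAddCommGroup (G k)] [∀ k, InnerProductSpace ℝ (G k)]

theorem continuousOn_observation (hW : W.IsRoot A) (hA : HypA1 A) {T : ℝ}
    (h : IsCascadeSol A n p C T u u') {i : ℕ} (hi : i ∈ Finset.Icc 1 (n + p)) {F : Type*}
    [NormedAddCommGroup F] [InnerProductSpace ℝ F] (Bs : HSp A 2 × H →L[ℝ] F) :
    ContinuousOn (fun t => Bs (u i t, HSp.val (u' i t))) (Set.Icc 0 T) := by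
  have h1 := hW.strongOn hA (h i hi)
  simp only [← hW.obs_of_val hA Bs]
  exact (hW.obs hA Bs).continuous.comp_continuousOn (h1.cont.ph h1.cont')

/-- The observability estimate on a time window, for one component of the cascade. -/
theorem IsRoot.window_le (hW : W.IsRoot A) (hA : HypA1 A) {F : Type*} [NormedAddCommGroup F]
    [InnerProductSpace ℝ F] {Bs : HSp A 2 × H →L[ℝ] F} {τ c : ℝ} (hτ : 0 < τ) (hc : 0 ≤ c)
    (hob : ∀ f α β, W.StrongOn τ f α β → ‖ph (W.S (α 0)) (W.S (β 0))‖ ^ 2 ≤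
        c * ((∫ t in (0 : ℝ)..τ, ‖hW.obs hA Bs (ph (α t) (β t))‖ ^ 2)
          + ∫ t in (0 : ℝ)..τ, ‖f t‖ ^ 2))
    {T s : ℝ} (hs : 0 ≤ s) (hsτ : s + τ ≤ T) (h : IsCascadeSol A n p C T u u') {i : ℕ}
    (hi : i ∈ Finset.Icc 1 (n + p)) (hni : n ≤ i) : ‖hW.nrm hA n u u' i s‖ ^ 2 ≤
      c * ((∫ t in (0 : ℝ)..T, ‖Bs (u i t, HSp.val (u' i t))‖ ^ 2)
        + ∫ t in (0 : ℝ)..τ, ‖coupling n C (fun k => HSp.val (u k (t + s))) i‖ ^ 2) := by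
  have h1 := hob _ _ _ ((hW.strongOn hA (h i hi)).shift hs hsτ)
  simp only [zero_add, hW.obs_of_val, norm_neg] at h1
  have e : hW.nrm hA n u u' i s = ph (W.S ((hW.equiv hA 2).symm (u i s)))
      (W.S ((hW.equiv hA 1).symm (u' i s))) := by
    rw [IsRoot.nrm, show n - i = 0 by omega]; rfl
  rw [e]
  refine h1.trans (mul_le_mul_of_nonneg_left (add_le_add_left ?_ _) hc)
  exact integral_shift_le (q := fun t => ‖Bs (u i t, HSp.val (u' i t))‖ ^ 2) hs hτ.le hsτ
    ((continuousOn_observation hW hA h hi Bs).norm.pow 2) fun t => by positivity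

end WaveGroup

end Cascade

/-! ### Existence of an observability time. -/

namespace Cascade

open MeasureTheory

namespace WaveGroup

variable {H : Type*} [NormedAddCommGroup H] [InnerProductSpace ℝ H] [CompleteSpace H]
  {W : WaveGroup H} {A : H →ₗ.[ℝ] H} {n p : ℕ} {C : ℕ → ℕ → H →L[ℝ] H} {P : ℕ → H →L[ℝ] H}

theorem coupling_of_le {n i : ℕ} (C : ℕ → ℕ → H →L[ℝ] H) (u : ℕ → H) (h2 : 2 ≤ i) (hi : i ≤ n) :
    coupling n C u i = C i (i - 1) (u (i - 1)) := by
  rw [coupling, if_neg (by omega), if_pos hi]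

theorem coupling_of_lt {n i : ℕ} (C : ℕ → ℕ → H →L[ℝ] H) (u : ℕ → H) (hn : 1 ≤ n) (hi : n < i) :
    coupling n C u i = ∑ k ∈ Finset.Icc (n - 1) (i - 1), C i k (u k) := by
  rw [coupling, if_neg (by omega), if_neg (by omega)]

/-- Observability of the first `n` components through the `n`-th one, at every time. -/
theorem IsRoot.exists_cascade_obs (hW : W.IsRoot A) (hA : HypA1 A) (hn : 2 ≤ n)
    (hA2 : HypA2 A n C P) (hA3 : HypA3 A n P) {F : Type*} [NormedAddCommGroup F]
    [InnerProductSpace ℝ F] {Bs : HSp A 2 × H →L[ℝ] F} (h4 : HypA4 A Bs) (h5 : HypA5 A Bs) :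
    ∃ T₀ > 0, ∀ T > T₀, ∃ d, 0 ≤ d ∧ ∀ u u', IsCascadeSol A n p C T u u' →
      ∀ i, 1 ≤ i → i ≤ n → ∀ t ∈ Set.Icc 0 T, ‖hW.nrm hA n u u' i t‖ ^ 2
        ≤ d * ∫ t in (0 : ℝ)..T, ‖Bs (u n t, HSp.val (u' n t))‖ ^ 2 := by
  obtain ⟨K, hK, hK1⟩ := hW.exists_coupling_family hA hA2
  have hK0 : ∀ i, 2 ≤ i → i ≤ n → K 0 i = C i (i - 1) := by
    intro i h2 hi
    ext x
    simpa using (hK i h2 hi 0 (by omega) x).symm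
  have hL : LowerBound W K n := by
    refine lowerBound (fun i hi hin k hki x => ?_) (fun m h2 hm => ?_) le_rfl
    · rcases hi.eq_or_lt with rfl | hi
      · rw [hK1, hK1]; simp
      · exact coupling_family_comm (hK i hi hin k (by omega)) (hK i hi hin (k + 1) (by omega)) x
    · obtain ⟨_, _, α, hα, hP⟩ := hA2 m (Finset.mem_Icc.mpr ⟨h2, hm⟩)
      obtain ⟨T₀, _, hT⟩ := hA3 m (Finset.mem_Icc.mpr ⟨h2, hm⟩)
      rw [hK0 m h2 hm]
      exact couplingObs hW hA hα hP hT
  obtain ⟨τ, c, hτ, hc, hob⟩ := hW.exists_window_obs hA h4 h5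
  obtain ⟨R, d, hR, hd, hch⟩ := exists_chain_obs (c := c * (1 + ‖K 0 n‖ ^ 2)) (τ := τ) (by omega)
    hL (by positivity) hτ
  obtain ⟨M, hM, hgr⟩ := exists_chain_growth_sum W K n (ε := 1) one_pos
  -- The chain is translated by `R`, so that the windows `[s + R, s + R + τ]` with `|s| ≤ R` all lie
  -- in `[0, T]`.
  refine ⟨2 * R + τ, by positivity, fun T hT => ⟨(M * (n + 1) * Real.cosh T) ^ 2 * d, by positivity,
    fun u u' h => ?_⟩⟩
  set x := hW.nrm hA n u u'
  set O := ∫ t in (0 : ℝ)..T, ‖Bs (u n t, HSp.val (u' n t))‖ ^ 2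
  have hO : 0 ≤ O := intervalIntegral.integral_nonneg (by linarith) fun _ _ => by positivity
  -- The entry of index `0` of a cascade solution is arbitrary, hence the separate source at `i =
  -- 1`; the extension to the line sets this entry to zero.
  have hmild : ∀ i, 1 ≤ i → i ≤ n → W.MildOn (Set.Icc 0 T) (x i)
      fun t => ph 0 (-K (n - i) i (if i = 1 then 0 else (x (i - 1) t).fst)) := by
    intro i h1 hi
    have := hW.nrm_mildOn hA h (Finset.mem_Icc.mpr ⟨h1, by omega⟩ : i ∈ _)
    convert! this using 3 with t
    rcases h1.eq_or_lt with rfl | h2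
    · simp [coupling]
    · rw [if_neg (by omega), hW.nrm_fst_pred hA hi h1, coupling_of_le C _ h2 hi, map_neg,
        hK i h2 hi _ (by omega)]
  obtain ⟨y, hy, hxy⟩ := exists_chain_extension hmild
  have hwin : ∀ s, |s| ≤ R → ‖y n (s + R)‖ ^ 2
      ≤ c * (1 + ‖K 0 n‖ ^ 2) * (O + ∫ r in (0 : ℝ)..τ, ‖y (n - 1) (s + r + R)‖ ^ 2) := by
    intro s hs
    obtain ⟨hs1, hs2⟩ := abs_le.mp hs
    have h1 := hW.window_le hA hτ hc hob (s := s + R) (by linarith) (by linarith) h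
      (i := n) (Finset.mem_Icc.mpr ⟨by omega, by omega⟩) le_rfl
    rw [← hxy n (by omega) le_rfl ⟨by linarith, by linarith⟩]
    have hyc := hy.continuous (i := n - 1) (by omega)
    have h2 : ∫ t in (0 : ℝ)..τ, ‖coupling n C (fun k => HSp.val (u k (t + (s + R)))) n‖ ^ 2
        ≤ ∫ r in (0 : ℝ)..τ, ‖K 0 n‖ ^ 2 * ‖y (n - 1) (s + r + R)‖ ^ 2 := by
      have e : ∀ t ∈ Set.Icc 0 τ, coupling n C (fun k => HSp.val (u k (t + (s + R)))) n
          = K 0 n (y (n - 1) (s + t + R)).fst := by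
        intro t ht
        have e1 : t + (s + R) = s + t + R := by ring
        rw [coupling_of_le C _ hn le_rfl, hK0 n hn le_rfl, e1,
          ← hxy (n - 1) (by omega) (by omega) ⟨by linarith [ht.1], by linarith [ht.2]⟩,
          hW.nrm_fst_pred hA le_rfl (by omega)]
        simp
      have e2 : ∫ t in (0 : ℝ)..τ, ‖coupling n C (fun k => HSp.val (u k (t + (s + R)))) n‖ ^ 2
          = ∫ t in (0 : ℝ)..τ, ‖K 0 n (y (n - 1) (s + t + R)).fst‖ ^ 2 := by
        refine intervalIntegral.integral_congr fun t ht => ?_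
        rw [Set.uIcc_of_le hτ.le] at ht
        simp only [e t ht]
      have hyc' : Continuous fun t => y (n - 1) (s + t + R) :=
        hyc.comp ((continuous_const.add continuous_id).add continuous_const)
      rw [e2]
      refine intervalIntegral.integral_mono_on hτ.le
        (((K 0 n).continuous.comp hyc'.phFst).norm.pow 2 |>.intervalIntegrable _ _)
        ((continuous_const.mul (hyc'.norm.pow 2)).intervalIntegrable _ _) fun t _ => ?_
      rw [← mul_pow]
      exact pow_le_pow_left₀ (norm_nonneg _) (((K 0 n).le_opNorm _).trans
        (mul_le_mul_of_nonneg_left (Ph.norm_fst_le _) (norm_nonneg _))) 2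
    rw [intervalIntegral.integral_const_mul] at h2
    refine h1.trans ?_
    rw [mul_assoc]
    refine mul_le_mul_of_nonneg_left ?_ hc
    have h3 : 0 ≤ ∫ r in (0 : ℝ)..τ, ‖y (n - 1) (s + r + R)‖ ^ 2 :=
      intervalIntegral.integral_nonneg hτ.le fun _ _ => by positivity
    nlinarith [mul_nonneg (sq_nonneg ‖K 0 n‖) hO]
  -- Time `-R` of the translated chain is time `0` of the original one.
  have hinit := hch _ O (hy.translate R) hO hwin
  simp only [neg_add_cancel] at hinit
  intro i hi1 hin t ht
  rw [hxy i hi1 hin ht]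
  have h1 := hgr y hy 0 t
  rw [add_zero, one_mul] at h1
  have h2 : ∑ j ∈ Finset.range (n + 1), ‖y j 0‖ ≤ (n + 1) * √(d * O) := by
    refine (Finset.sum_le_card_nsmul _ _ (√(d * O)) fun j hj => ?_).trans_eq (by simp)
    exact Real.le_sqrt_of_sq_le (hinit j (by have := Finset.mem_range.mp hj; omega))
  have h3 : ‖y i t‖ ≤ M * ((n + 1) * √(d * O)) * Real.cosh T := by
    refine ((Finset.single_le_sum (f := fun j => ‖y j t‖) (fun _ _ => norm_nonneg _)
      (Finset.mem_range.mpr (by omega : i < n + 1))).trans h1).trans ?_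
    gcongr
    rw [Real.cosh_le_cosh, abs_of_nonneg ht.1, abs_of_nonneg (ht.1.trans ht.2)]
    exact ht.2
  calc ‖y i t‖ ^ 2 ≤ (M * ((n + 1) * √(d * O)) * Real.cosh T) ^ 2 :=
        pow_le_pow_left₀ (norm_nonneg _) h3 2
    _ = (M * (n + 1) * Real.cosh T) ^ 2 * (√(d * O)) ^ 2 := by ring
    _ = _ := by rw [Real.sq_sqrt (by positivity)]; ring

variable {G : ℕ → Type*} [∀ k, NormedAddCommGroup (G k)] [∀ k, InnerProductSpace ℝ (G k)]

theorem norm_coupling_sq_le (hW : W.IsRoot A) (hA : HypA1 A) (hn : 1 ≤ n) {i : ℕ} (hi : n < i)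
    {u : ℕ → ℝ → HSp A 2} {u' : ℕ → ℝ → HSp A 1} {t B : ℝ}
    (hB : ∀ j, n - 1 ≤ j → j < i → ‖hW.nrm hA n u u' j t‖ ^ 2 ≤ B) :
    ‖coupling n C (fun k => HSp.val (u k t)) i‖ ^ 2
      ≤ ((∑ k ∈ Finset.Icc (n - 1) (i - 1), ‖C i k‖) * (1 + ‖W.S‖)) ^ 2 * B := by
  have hB0 : 0 ≤ B := (sq_nonneg _).trans (hB (n - 1) le_rfl (by omega))
  have h1 : ‖coupling n C (fun k => HSp.val (u k t)) i‖
      ≤ (∑ k ∈ Finset.Icc (n - 1) (i - 1), ‖C i k‖) * (1 + ‖W.S‖) * √B := by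
    rw [coupling_of_lt C _ hn hi, mul_assoc, Finset.sum_mul]
    refine (norm_sum_le _ _).trans (Finset.sum_le_sum fun k hk => ?_)
    obtain ⟨hk1, hk2⟩ := Finset.mem_Icc.mp hk
    refine ((C i k).le_opNorm _).trans (mul_le_mul_of_nonneg_left ?_ (norm_nonneg _))
    refine (hW.norm_val_le hA (u' := u') hk1 hn t).trans ?_
    gcongr
    exact Real.le_sqrt_of_sq_le (hB k hk1 (by omega))
  refine (pow_le_pow_left₀ (norm_nonneg _) h1 2).trans_eq ?_
  rw [mul_pow, Real.sq_sqrt hB0]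

/-- Existence of an observability time. -/
theorem IsRoot.exists_obsTime (hW : W.IsRoot A) (hA : HypA1 A) (hn : 2 ≤ n)
    (hA2 : HypA2 A n C P) (hA3 : HypA3 A n P) {Bs : ∀ k, HSp A 2 × H →L[ℝ] G k}
    (hB : ∀ k ∈ Finset.Icc n (n + p), HypA4 A (Bs k) ∧ HypA5 A (Bs k)) :
    ∃ Tstar > 0, IsObsTime A n p C Bs Tstar := by
  have hnp : n ∈ Finset.Icc n (n + p) := Finset.mem_Icc.mpr ⟨le_rfl, by omega⟩
  obtain ⟨T₀, hT₀, hlow⟩ := hW.exists_cascade_obs (p := p) hA hn hA2 hA3 (hB n hnp).1 (hB n hnp).2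
  have hex : ∀ k, ∃ τ c : ℝ, 0 < τ ∧ 0 ≤ c ∧ (k ∈ Finset.Icc n (n + p) →
      ∀ f α β, W.StrongOn τ f α β → ‖ph (W.S (α 0)) (W.S (β 0))‖ ^ 2 ≤
        c * ((∫ t in (0 : ℝ)..τ, ‖hW.obs hA (Bs k) (ph (α t) (β t))‖ ^ 2)
          + ∫ t in (0 : ℝ)..τ, ‖f t‖ ^ 2)) := by
    intro k
    by_cases hk : k ∈ Finset.Icc n (n + p)
    · obtain ⟨τ, c, h1, h2, h3⟩ := hW.exists_window_obs hA (hB k hk).1 (hB k hk).2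
      exact ⟨τ, c, h1, h2, fun _ => h3⟩
    · exact ⟨1, 0, one_pos, le_rfl, fun h => absurd h hk⟩
  choose τ c hτ hc hob using hex
  have hsum : 0 ≤ ∑ k ∈ Finset.Icc n (n + p), τ k := Finset.sum_nonneg fun k _ => (hτ k).le
  -- All windows for the later equations start at time `0`, so `T` has to exceed each `τ k` only;
  -- the sum is a common bound.
  refine ⟨T₀ + ∑ k ∈ Finset.Icc n (n + p), τ k, by positivity, fun T hT => ?_⟩
  have hTτ : ∀ k ∈ Finset.Icc n (n + p), τ k ≤ T := fun k hk => by
    have := Finset.single_le_sum (f := τ) (fun k _ => (hτ k).le) hk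
    linarith
  have hT0 : 0 < T := by linarith
  obtain ⟨d, hd, hlow⟩ := hlow T (by linarith)
  let O : (ℕ → ℝ → HSp A 2) → (ℕ → ℝ → HSp A 1) → ℕ → ℝ := fun u u' l =>
    ∫ t in (0 : ℝ)..T, ‖Bs (n + l) (u (n + l) t, HSp.val (u' (n + l) t))‖ ^ 2
  have hO : ∀ u u' l, 0 ≤ O u u' l := fun u u' l =>
    intervalIntegral.integral_nonneg hT0.le fun _ _ => by positivity
  -- The induction carries the bound at every time of `[0, T]`, since the source of the next
  -- equation is integrated over time.
  have key : ∀ k ≤ p, ∃ ρ, 0 ≤ ρ ∧ ∀ u u', IsCascadeSol A n p C T u u' → ∀ j, n - 1 ≤ j →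
      j ≤ n + k → ∀ t ∈ Set.Icc 0 T, ‖hW.nrm hA n u u' j t‖ ^ 2
        ≤ ρ * ∑ l ∈ Finset.range (k + 1), O u u' l := by
    intro k
    induction k with
    | zero =>
      intro _
      refine ⟨d, hd, fun u u' h j hj hjn t ht => ?_⟩
      rw [zero_add, Finset.sum_range_one]
      exact hlow u u' h j (by omega) (by omega) t ht
    | succ k ih =>
      intro hk
      obtain ⟨ρ, hρ, ih⟩ := ih (by omega)
      set i := n + (k + 1)
      have hi : i ∈ Finset.Icc n (n + p) := Finset.mem_Icc.mpr ⟨by omega, by omega⟩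
      set F := ((∑ k ∈ Finset.Icc (n - 1) (i - 1), ‖C i k‖) * (1 + ‖W.S‖)) ^ 2 * ρ
      have hF : 0 ≤ F := by positivity
      refine ⟨ρ + (2 * (c i * (1 + τ i * F)) + 2 * (T * (T * F))), by
        have := hc i; have := hτ i; positivity, fun u u' h j hj hji t ht => ?_⟩
      set Q := ∑ l ∈ Finset.range (k + 1), O u u' l with hQ
      have hQ0 : 0 ≤ Q := Finset.sum_nonneg fun l _ => hO u u' l
      have hO1 := hO u u' (k + 1)
      rw [Finset.sum_range_succ, ← hQ]
      have hrest : 0 ≤ 2 * (c i * (1 + τ i * F)) + 2 * (T * (T * F)) := by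
        have := hc i; have := hτ i; positivity
      rcases hji.lt_or_eq with hji | rfl
      · have h1 := ih u u' h j hj (by omega) t ht
        nlinarith [mul_nonneg hrest (add_nonneg hQ0 hO1), mul_nonneg hρ hO1]
      · have hfs : ∀ s ∈ Set.Icc 0 T, ‖coupling n C (fun k => HSp.val (u k s)) i‖ ^ 2
            ≤ F * Q := by
          intro s hs
          refine (norm_coupling_sq_le hW hA (by omega) (by omega : n < i)
            fun j hj hji => ih u u' h j hj (by omega) s hs).trans_eq ?_
          ring
        have himem : i ∈ Finset.Icc 1 (n + p) := Finset.mem_Icc.mpr ⟨by omega, by omega⟩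
        have hsc := ((h i himem).source.neg).norm.pow 2
        simp only [Pi.neg_apply, neg_neg] at hsc
        have hint : ∀ τ, 0 ≤ τ → τ ≤ T →
            ∫ s in (0 : ℝ)..τ, ‖coupling n C (fun k => HSp.val (u k s)) i‖ ^ 2 ≤ τ * (F * Q) := by
          intro τ h0 hτ
          have := intervalIntegral.integral_mono_on (μ := volume) h0
            ((hsc.mono (Set.Icc_subset_Icc_right hτ)).intervalIntegrable_of_Icc h0)
            (intervalIntegrable_const (c := F * Q)) fun s hs => hfs s ⟨hs.1, hs.2.trans hτ⟩
          rwa [intervalIntegral.integral_const, sub_zero, smul_eq_mul] at this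
        have h0 := hW.window_le hA (hτ i) (hc i) (hob i hi) (s := 0) le_rfl
          (by rw [zero_add]; exact hTτ i hi) h himem (by omega)
        simp only [add_zero] at h0
        have h1 : ‖hW.nrm hA n u u' i 0‖ ^ 2 ≤ c i * (O u u' (k + 1) + τ i * (F * Q)) :=
          h0.trans (mul_le_mul_of_nonneg_left
            (add_le_add_right (hint (τ i) (hτ i).le (hTτ i hi)) _) (hc i))
        -- The window gives the new component at time `0`; Duhamel propagates it to all `t`, as its
        -- source is already controlled.
        have h2 := (hW.nrm_mildOn hA h himem).norm_sub_sq_le ht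
        have e : n - i = 0 := by omega
        simp only [e, pow_zero, one_apply_eq_self, norm_ph_zero, norm_neg] at h2
        have h3 := h2.trans (mul_le_mul_of_nonneg_left (hint T hT0.le le_rfl) hT0.le)
        have h4 := norm_le_insert' (hW.nrm hA n u u' i t) (W.phase.U t (hW.nrm hA n u u' i 0))
        rw [W.phase.norm_map] at h4
        set a := ‖hW.nrm hA n u u' i t‖
        set b := ‖hW.nrm hA n u u' i 0‖
        set e := ‖hW.nrm hA n u u' i t - W.phase.U t (hW.nrm hA n u u' i 0)‖
        have h5 : a ^ 2 ≤ 2 * b ^ 2 + 2 * e ^ 2 := by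
          have := pow_le_pow_left₀ (norm_nonneg _) h4 2
          nlinarith [sq_nonneg (b - e)]
        have g1 : c i * (O u u' (k + 1) + τ i * (F * Q))
            ≤ c i * (1 + τ i * F) * (Q + O u u' (k + 1)) := by
          rw [mul_assoc (c i)]
          refine mul_le_mul_of_nonneg_left ?_ (hc i)
          have : 0 ≤ τ i * F := mul_nonneg (hτ i).le hF
          nlinarith [mul_nonneg this hO1]
        have g2 : T * (T * (F * Q)) ≤ T * (T * F) * (Q + O u u' (k + 1)) := by
          have : 0 ≤ T * (T * F) := by positivity
          nlinarith [mul_nonneg this hO1]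
        have g3 := mul_nonneg hρ (add_nonneg hQ0 hO1)
        nlinarith
  have hex : ∀ k, ∃ ρ, 0 ≤ ρ ∧ (k ≤ p → ∀ u u', IsCascadeSol A n p C T u u' →
      ‖hW.nrm hA n u u' (n + k) 0‖ ^ 2 ≤ ρ * ∑ l ∈ Finset.range (k + 1), O u u' l) := by
    intro k
    by_cases hk : k ≤ p
    · obtain ⟨ρ, hρ, h⟩ := key k hk
      exact ⟨ρ, hρ, fun _ u u' hu => h u u' hu _ (by omega) le_rfl 0 ⟨le_rfl, hT0.le⟩⟩
    · exact ⟨0, le_rfl, fun h => absurd h hk⟩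
  choose ρ hρ hup using hex
  refine ⟨fun _ => d + 1, fun k => ρ k + 1, fun _ => by positivity, fun k => by
    have := hρ k; positivity, fun u u' h => ⟨fun i hi => ?_, fun k hk => ?_⟩⟩
  · obtain ⟨h1, h2⟩ := Finset.mem_Icc.mp hi
    rw [energy_level hW hA h2]
    have h3 := hlow u u' h i h1 h2 0 ⟨le_rfl, hT0.le⟩
    have h4 := hO u u' 0
    change _ ≤ (d + 1) * O u u' 0
    change ‖hW.nrm hA n u u' i 0‖ ^ 2 ≤ d * O u u' 0 at h3
    change ‖hW.nrm hA n u u' i 0‖ ^ 2 / 2 ≤ _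
    nlinarith [mul_nonneg hd h4]
  · obtain ⟨h1, h2⟩ := Finset.mem_Icc.mp hk
    have e := hW.energy_one hA ((hW.equiv hA 2).symm (u (n + k) 0))
      ((hW.equiv hA 1).symm (u' (n + k) 0))
    rw [LinearIsometryEquiv.apply_symm_apply, LinearIsometryEquiv.apply_symm_apply] at e
    have h3 := hup k h2 u u' h
    have e2 : hW.nrm hA n u u' (n + k) 0 = ph (W.S ((hW.equiv hA 2).symm (u (n + k) 0)))
        (W.S ((hW.equiv hA 1).symm (u' (n + k) 0))) := by
      rw [IsRoot.nrm, show n - (n + k) = 0 by omega]; rfl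
    rw [e, ← e2]
    have h4 : 0 ≤ ∑ l ∈ Finset.range (k + 1), O u u' l := Finset.sum_nonneg fun l _ => hO u u' l
    change _ ≤ (ρ k + 1) * ∑ l ∈ Finset.range (k + 1), O u u' l
    nlinarith [mul_nonneg (hρ k) h4]

end WaveGroup

end Cascade

/-! ### The Hilbert uniqueness method. -/

namespace Cascade

open MeasureTheory

section Riesz

variable {Z V X : Type*} [AddCommGroup Z] [Module ℝ Z] [NormedAddCommGroup V]
  [InnerProductSpace ℝ V] [CompleteSpace V] [NormedAddCommGroup X] [InnerProductSpace ℝ X]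
  [CompleteSpace X]

/-- The bound lets `ℓ` factor through the range of `Ψ`; Hahn–Banach extends the resulting bounded
functional and Riesz represents it. -/
theorem exists_inner_eq (Ψ : Z →ₗ[ℝ] V) (ℓ : Z →ₗ[ℝ] ℝ) {c : ℝ} (h : ∀ z, |ℓ z| ≤ c * ‖Ψ z‖) :
    ∃ v : V, ∀ z, inner ℝ v (Ψ z) = ℓ z := by
  have hker : LinearMap.ker Ψ ≤ LinearMap.ker ℓ := by
    intro z hz
    have := h z
    rw [LinearMap.mem_ker.mp hz, norm_zero, mul_zero] at this
    exact LinearMap.mem_ker.mpr (abs_nonpos_iff.mp this)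
  let f : LinearMap.range Ψ →ₗ[ℝ] ℝ :=
    ((LinearMap.ker Ψ).liftQ ℓ hker).comp Ψ.quotKerEquivRange.symm.toLinearMap
  have hf : ∀ z, f ⟨Ψ z, z, rfl⟩ = ℓ z := by
    intro z
    have : Ψ.quotKerEquivRange.symm ⟨Ψ z, z, rfl⟩ = (LinearMap.ker Ψ).mkQ z := by
      rw [LinearEquiv.symm_apply_eq]; rfl
    change (LinearMap.ker Ψ).liftQ ℓ hker (Ψ.quotKerEquivRange.symm ⟨Ψ z, z, rfl⟩) = _
    rw [this]; rfl
  let F : StrongDual ℝ (LinearMap.range Ψ) := f.mkContinuous c (by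
    rintro ⟨_, z, rfl⟩
    rw [hf]; exact h z)
  obtain ⟨g, hg, -⟩ := exists_extension_norm_eq _ F
  refine ⟨(InnerProductSpace.toDual ℝ V).symm g, fun z => ?_⟩
  rw [InnerProductSpace.toDual_symm_apply]
  exact (hg ⟨Ψ z, z, rfl⟩).trans (hf z)

theorem norm_le_of_denseRange {D : Z → X} (hD : DenseRange D) {x : X} {c : ℝ} (hc : 0 ≤ c)
    (h : ∀ z, inner ℝ x (D z) ≤ c * ‖D z‖) : ‖x‖ ≤ c := by
  have key : inner ℝ x x ≤ c * ‖x‖ := hD.induction_on (p := fun y => inner ℝ x y ≤ c * ‖y‖) x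
    (isClosed_le (by fun_prop) (by fun_prop)) h
  rw [real_inner_self_eq_norm_sq, pow_two] at key
  rcases (norm_nonneg x).eq_or_lt with h0 | h0
  · rwa [← h0]
  · exact le_of_mul_le_mul_right key h0

theorem le_sqrt_mul {a b c : ℝ} (ha : 0 ≤ a) (hb : 0 ≤ b) (hc : 0 ≤ c) (h : a ^ 2 ≤ c * b ^ 2) :
    a ≤ √c * b := by
  rw [← sq_le_sq₀ ha (by positivity), mul_pow, Real.sq_sqrt hc]
  exact h

omit [CompleteSpace V] in
theorem inner_toLp_indicator {f g : ℝ → V} {s t : Set ℝ} (hst : MeasurableSet (s ∩ t))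
    (hf : MemLp (s.indicator f) 2) (hg : MemLp (t.indicator g) 2) :
    inner ℝ (hf.toLp _) (hg.toLp _) = ∫ a in s ∩ t, inner ℝ (f a) (g a) := by
  rw [L2.inner_def, ← integral_indicator hst]
  refine integral_congr_ae ?_
  filter_upwards [hf.coeFn_toLp, hg.coeFn_toLp] with a h1 h2
  rw [h1, h2]
  by_cases hs : a ∈ s <;> by_cases ht : a ∈ t <;> simp [hs, ht]

theorem setIntegral_Ioc_inter {τ σ : ℝ} (h0 : 0 ≤ min τ σ) (f : ℝ → ℝ) :
    ∫ a in Set.Ioc 0 τ ∩ Set.Ioc 0 σ, f a = ∫ a in (0 : ℝ)..min τ σ, f a := by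
  rw [intervalIntegral.integral_of_le h0, Set.Ioc_inter_Ioc, max_self]

theorem UnitaryGroup.continuousOn_evol_apply (U : UnitaryGroup X) (K : X →L[ℝ] X) {T : ℝ}
    {x : ℝ → X} (hx : ContinuousOn x (Set.Icc 0 T)) :
    ContinuousOn (fun t => U.evol K t (x t)) (Set.Icc 0 T) := by
  obtain ⟨M, hM, hb⟩ := U.exists_evol_bound K T
  intro σ hσ
  have h1 := (tendsto_iff_norm_sub_tendsto_zero.mp (hx σ hσ)).const_mul M
  have h2 := tendsto_iff_norm_sub_tendsto_zero.mp
    ((U.continuous_evol K (x σ)).continuousAt (x := σ) |>.continuousWithinAt (s := Set.Icc 0 T))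
  refine tendsto_iff_norm_sub_tendsto_zero.mpr (squeeze_zero' (.of_forall fun _ => norm_nonneg _)
    ?_ (by simpa using h1.add h2))
  filter_upwards [self_mem_nhdsWithin] with τ hτ
  have e : U.evol K τ (x τ) - U.evol K σ (x σ)
      = U.evol K τ (x τ - x σ) + (U.evol K τ (x σ) - U.evol K σ (x σ)) := by
    rw [map_sub]; abel
  rw [e]
  exact (norm_add_le _ _).trans (add_le_add_left
    (hb τ (by rw [abs_of_nonneg hτ.1]; exact hτ.2) _) _)

/-- The Hilbert uniqueness method: an observability inequality for the group `evol K` on the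
smooth data `D z` gives exact controllability for the adjoint group. -/
theorem UnitaryGroup.exists_control (U : UnitaryGroup X) (K : X →L[ℝ] X) {D : Z →ₗ[ℝ] X}
    (hD : DenseRange D) {b : ℝ → Z →ₗ[ℝ] V} (hb : ∀ z, Continuous fun t => b t z) {T c C : ℝ}
    (hT : 0 ≤ T) (hc : 0 ≤ c) (hC : 0 ≤ C)
    (hobs : ∀ z, ‖D z‖ ^ 2 ≤ c * ∫ t in (0 : ℝ)..T, ‖b t z‖ ^ 2)
    (hadm : ∀ z, ∫ t in (0 : ℝ)..T, ‖b t z‖ ^ 2 ≤ C * ‖D z‖ ^ 2) (Y₀ : X) :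
    ∃ v : ℝ → V, MemLp v 2 ∧
      (∃ Y : ℝ → X, ContinuousOn Y (Set.Icc 0 T) ∧ Y 0 = Y₀ ∧ ∀ τ ∈ Set.Icc 0 T, ∀ z,
        inner ℝ (Y τ) (U.evol K τ (D z))
          = inner ℝ Y₀ (D z) + ∫ t in (0 : ℝ)..τ, inner ℝ (v t) (b t z)) ∧
      ∀ z, inner ℝ Y₀ (D z) + ∫ t in (0 : ℝ)..T, inner ℝ (v t) (b t z) = 0 := by
  have hmem : ∀ z, MemLp ((Set.Ioc 0 T).indicator fun t => b t z) 2 := fun z => by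
    rw [memLp_indicator_iff_restrict measurableSet_Ioc,
      memLp_two_iff_integrable_sq_norm (hb z).aestronglyMeasurable]
    exact ((hb z).norm.pow 2).integrableOn_Ioc
  -- The observation, cut off outside `(0, T]`, as an element of `L²` of the whole line.
  let Ψ : Z →ₗ[ℝ] Lp V 2 (volume : Measure ℝ) :=
    { toFun := fun z => (hmem z).toLp _
      map_add' := fun z w => by
        rw [← MemLp.toLp_add]
        refine MemLp.toLp_congr _ _ (.of_forall fun t => ?_)
        by_cases ht : t ∈ Set.Ioc 0 T <;> simp [ht]
      map_smul' := fun r z => by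
        rw [RingHom.id_apply, ← MemLp.toLp_const_smul]
        refine MemLp.toLp_congr _ _ (.of_forall fun t => ?_)
        by_cases ht : t ∈ Set.Ioc 0 T <;> simp [ht] }
  have hΨ : ∀ z, ‖Ψ z‖ ^ 2 = ∫ t in (0 : ℝ)..T, ‖b t z‖ ^ 2 := by
    intro z
    rw [← real_inner_self_eq_norm_sq]
    refine (inner_toLp_indicator (measurableSet_Ioc.inter measurableSet_Ioc) (hmem z)
      (hmem z)).trans ?_
    rw [setIntegral_Ioc_inter (by rwa [min_self]), min_self]
    simp only [real_inner_self_eq_norm_sq]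
  have hDΨ : ∀ z, ‖D z‖ ≤ √c * ‖Ψ z‖ := fun z =>
    le_sqrt_mul (norm_nonneg _) (norm_nonneg _) hc (by rw [hΨ]; exact hobs z)
  have hΨD : ∀ z, ‖Ψ z‖ ≤ √C * ‖D z‖ := fun z =>
    le_sqrt_mul (norm_nonneg _) (norm_nonneg _) hC (by rw [hΨ]; exact hadm z)
  -- The control represents `-⟨Y₀, D ·⟩` as a functional of the observation; observability is what
  -- bounds this functional.
  obtain ⟨v, hv⟩ := exists_inner_eq Ψ (-((innerSL ℝ Y₀ : X →ₗ[ℝ] ℝ).comp D)) (c := ‖Y₀‖ * √c)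
    fun z => by
      rw [LinearMap.neg_apply, abs_neg, mul_assoc]
      exact (abs_real_inner_le_norm Y₀ (D z)).trans
        (mul_le_mul_of_nonneg_left (hDΨ z) (norm_nonneg _))
  -- By admissibility every `w` in `L²` induces a bounded functional of the data. Its representative
  -- `q w` is the accumulated effect of the control, transported back to time `0`.
  have hp : ∀ w : Lp V 2 (volume : Measure ℝ), ∃ q : X, ∀ z, inner ℝ q (D z) = inner ℝ w (Ψ z) := by
    intro w
    exact exists_inner_eq D ((innerSL ℝ w : _ →ₗ[ℝ] ℝ).comp Ψ) (c := ‖w‖ * √C) fun z => by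
      rw [mul_assoc]
      exact (abs_real_inner_le_norm w (Ψ z)).trans
        (mul_le_mul_of_nonneg_left (hΨD z) (norm_nonneg _))
  choose q hq using hp
  have hq0 : ∀ w w', ‖q w - q w'‖ ≤ √C * ‖w - w'‖ := fun w w' =>
    norm_le_of_denseRange hD (by positivity) fun z => by
      rw [inner_sub_left, hq, hq, ← inner_sub_left, mul_right_comm, mul_comm _ ‖w - w'‖]
      exact (real_inner_le_norm _ _).trans (mul_le_mul_of_nonneg_left (hΨD z) (norm_nonneg _))
  have hcut : ∀ τ, MemLp ((Set.Ioc 0 τ).indicator v) 2 := fun τ =>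
    (Lp.memLp v).indicator measurableSet_Ioc
  set cut : ℝ → Lp V 2 (volume : Measure ℝ) := fun τ => (hcut τ).toLp _
  have hcutΨ : ∀ τ ∈ Set.Icc 0 T, ∀ z,
      inner ℝ (cut τ) (Ψ z) = ∫ t in (0 : ℝ)..τ, inner ℝ (v t) (b t z) := by
    intro τ hτ z
    refine (inner_toLp_indicator (measurableSet_Ioc.inter measurableSet_Ioc) (hcut τ)
      (hmem z)).trans ?_
    rw [setIntegral_Ioc_inter (by rw [min_eq_left hτ.2]; exact hτ.1), min_eq_left hτ.2]
  have hvint : Integrable fun t => ‖v t‖ ^ 2 :=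
    (memLp_two_iff_integrable_sq_norm (Lp.aestronglyMeasurable v)).mp (Lp.memLp v)
  set F : ℝ → ℝ := fun τ => ∫ t in (0 : ℝ)..τ, ‖v t‖ ^ 2
  have hF : Continuous F := intervalIntegral.continuous_primitive
    (fun _ _ => hvint.intervalIntegrable) 0
  have hcc : ∀ τ σ, 0 ≤ τ → 0 ≤ σ → inner ℝ (cut τ) (cut σ) = F (min τ σ) := by
    intro τ σ hτ hσ
    refine (inner_toLp_indicator (measurableSet_Ioc.inter measurableSet_Ioc) (hcut τ)
      (hcut σ)).trans ?_
    rw [setIntegral_Ioc_inter (le_min hτ hσ)]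
    simp only [real_inner_self_eq_norm_sq, F]
  -- The distance between two truncations of `v` is expressed by the primitive of `‖v‖²`, which
  -- makes the state continuous in time.
  have hcs : ∀ τ σ, 0 ≤ τ → 0 ≤ σ → ‖cut τ - cut σ‖ = √(F τ - 2 * F (min τ σ) + F σ) := by
    intro τ σ hτ hσ
    rw [← Real.sqrt_sq (norm_nonneg (cut τ - cut σ)), norm_sub_sq_real,
      ← real_inner_self_eq_norm_sq, ← real_inner_self_eq_norm_sq, hcc τ σ hτ hσ, hcc τ τ hτ hτ,
      hcc σ σ hσ hσ, min_self, min_self]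
  have hqc : ContinuousOn (fun τ => q (cut τ)) (Set.Icc 0 T) := by
    intro σ hσ
    have h1 : Continuous fun τ => √C * √(F τ - 2 * F (min τ σ) + F σ) := by fun_prop
    have h2 := (h1.continuousAt (x := σ)).continuousWithinAt (s := Set.Icc 0 T)
    refine tendsto_iff_norm_sub_tendsto_zero.mpr
      (squeeze_zero' (.of_forall fun _ => norm_nonneg _) ?_ (h2.tendsto.trans_eq ?_))
    · filter_upwards [self_mem_nhdsWithin] with τ hτ
      rw [← hcs τ σ hτ.1 hσ.1]
      exact hq0 _ _
    · rw [min_self, show F σ - 2 * F σ + F σ = 0 by ring]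
      simp
  have hq00 : q (cut 0) = 0 := by
    refine norm_le_zero_iff.mp (norm_le_of_denseRange hD le_rfl fun z => ?_)
    rw [hq, hcutΨ 0 ⟨le_rfl, hT⟩, intervalIntegral.integral_same, zero_mul]
  -- The state at `τ` is the dual evolution of `Y₀` plus the effect of the control up to `τ`; the
  -- transposition identity is then the conserved pairing.
  refine ⟨v, Lp.memLp v, ⟨fun τ => U.evol (-ContinuousLinearMap.adjoint K) τ (Y₀ + q (cut τ)),
    U.continuousOn_evol_apply _ (continuousOn_const.add hqc), ?_, fun τ hτ z => ?_⟩, fun z => ?_⟩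
  · beta_reduce
    rw [hq00, add_zero, U.evol_zero]
  · rw [U.inner_evol_adjoint, inner_add_left, hq, hcutΨ τ hτ]
  · have hu : MemLp (Set.univ.indicator v) 2 := by
      rw [Set.indicator_univ]; exact Lp.memLp v
    have e : hu.toLp _ = v :=
      (MemLp.toLp_congr _ (Lp.memLp v) (by rw [Set.indicator_univ])).trans (Lp.toLp_coeFn v _)
    have h1 := inner_toLp_indicator (MeasurableSet.univ.inter measurableSet_Ioc) hu (hmem z)
    rw [e, Set.univ_inter, ← intervalIntegral.integral_of_le hT] at h1
    rw [← h1]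
    have h2 := hv z
    rw [LinearMap.neg_apply] at h2
    change inner ℝ v (Ψ z) = -inner ℝ Y₀ (D z) at h2
    change _ + inner ℝ v (Ψ z) = 0
    rw [h2, add_neg_cancel]

end Riesz

/-! ### Smooth data and strong solutions of the perturbed equation. -/

namespace WaveGroup

variable {H : Type*} [NormedAddCommGroup H] [InnerProductSpace ℝ H] (W : WaveGroup H)

/-- The inverse `(a, b) ↦ (-S b, S a)` of the generator of the wave group. -/
def J : Ph H →L[ℝ] Ph H := -(rot H).comp W.Sph

theorem J_apply (x : Ph H) : W.J x = -rot H (W.Sph x) := rfl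

theorem J_fst (x : Ph H) : (W.J x).fst = -W.S x.snd := by
  rw [J_apply, WithLp.neg_fst, rot_fst, Sph_snd]

theorem J_snd (x : Ph H) : (W.J x).snd = W.S x.fst := by
  rw [J_apply, WithLp.neg_snd, rot_snd, Sph_fst, neg_neg]

theorem rot_J (x : Ph H) : rot H (W.J x) = W.Sph x := by
  rw [J_apply, map_neg, rot_rot, neg_neg]

variable [CompleteSpace H]

/-- The operator `J⁻¹ (evol K t) J`. -/
def smooth (K : Ph H →L[ℝ] Ph H) (t : ℝ) : Ph H →L[ℝ] Ph H :=
  (W.phase.evol K t).comp (.id ℝ (Ph H) + K.comp W.J) - K.comp ((W.phase.evol K t).comp W.J)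

theorem smooth_apply (K : Ph H →L[ℝ] Ph H) (t : ℝ) (η : Ph H) :
    W.smooth K t η = W.phase.evol K t (η + K (W.J η)) - K (W.phase.evol K t (W.J η)) := rfl

/-- `J` inverts the free generator, so `η + K (J η)` is the full generator applied to `J η`. Let `y`
be its evolution and `z` the primitive of `y` issued from `J η`. Then `J y - z - J K z` has zero
derivative and starts at zero; rotating this identity shows that `z` solves the equation, so it is
the evolution of `J η`. -/
theorem evol_J_aux (K : Ph H →L[ℝ] Ph H) (η : Ph H) :
    (∀ t, W.phase.evol K t (W.J η) = W.J (W.smooth K t η)) ∧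
    ∀ t, HasDerivAt (fun t => W.phase.evol K t (W.J η)) (W.phase.evol K t (η + K (W.J η))) t := by
  set m := η + K (W.J η) with hm
  set y : ℝ → Ph H := fun t => W.phase.evol K t m with hy
  have hyc : Continuous y := W.phase.continuous_evol K m
  set z : ℝ → Ph H := fun t => W.J η + ∫ r in (0 : ℝ)..t, y r
  have hz : ∀ t, HasDerivAt z (y t) t := fun t =>
    (intervalIntegral.integral_hasDerivAt_right (hyc.intervalIntegrable 0 t)
      hyc.aestronglyMeasurable.stronglyMeasurableAtFilter hyc.continuousAt).const_add _
  have hz0 : z 0 = W.J η := by simp [z]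
  have hJy : ∀ t, HasDerivAt (fun t => W.J (y t)) (y t + W.J (K (y t))) t := by
    intro t
    have h1 := ((evol_mildOn (W := W) K m).deriv t trivial).hasDerivAt Filter.univ_mem
    have h2 := ((rot H).hasFDerivAt.comp_hasDerivAt t h1).neg
    convert! h2 using 1
    rw [map_add, rot_rot, neg_add, neg_neg]
    rfl
  have hconst : ∀ t, W.J (y t) - z t - W.J (K (z t)) = 0 := by
    intro t
    have hd : ∀ t, HasDerivAt (fun t => W.J (y t) - z t - W.J (K (z t))) 0 t := by
      intro t
      have h3 := (W.J.comp K).hasFDerivAt.comp_hasDerivAt t (hz t)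
      have h4 := ((hJy t).sub (hz t)).sub h3
      convert! h4 using 1
      rw [ContinuousLinearMap.comp_apply]; abel
    have := is_const_of_deriv_eq_zero (fun t => (hd t).differentiableAt) (fun t => (hd t).deriv) t 0
    rw [this, hz0]
    simp only [hy, W.phase.evol_zero, hm, map_add]
    abel
  have hzm : W.MildOn Set.univ z fun t => K (z t) := by
    have hzc : Continuous z := continuous_iff_continuousAt.mpr fun t => (hz t).continuousAt
    refine ⟨hzc.continuousOn, (K.continuous.comp hzc).continuousOn, fun t _ => ?_⟩
    have h1 := (W.Sph.hasFDerivAt.comp_hasDerivAt t (hz t)).hasDerivWithinAt (s := Set.univ)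
    convert! h1 using 1
    have h2 := congrArg (rot H) (hconst t)
    rw [map_sub, map_sub, rot_J, rot_J, map_zero, sub_sub, sub_eq_zero] at h2
    exact h2.symm
  have hze : ∀ t, z t = W.phase.evol K t (W.J η) := fun t => by
    rw [W.phase.eq_evol K (fun t => hzm.hasDerivAt t) t, hz0]
  refine ⟨fun t => ?_, fun t => ?_⟩
  · rw [smooth_apply, ← hze, map_sub]
    have := hconst t
    rw [sub_sub, sub_eq_zero] at this
    rw [eq_sub_iff_add_eq]
    exact this.symm
  · exact (hz t).congr_of_eventuallyEq (.of_forall fun t => (hze t).symm)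

theorem evol_J (K : Ph H →L[ℝ] Ph H) (t : ℝ) (η : Ph H) :
    W.phase.evol K t (W.J η) = W.J (W.smooth K t η) := (W.evol_J_aux K η).1 t

theorem hasDerivAt_evol_J (K : Ph H →L[ℝ] Ph H) (t : ℝ) (η : Ph H) :
    HasDerivAt (fun t => W.phase.evol K t (W.J η)) (W.phase.evol K t (η + K (W.J η))) t :=
  (W.evol_J_aux K η).2 t

theorem continuous_smooth (K : Ph H →L[ℝ] Ph H) (η : Ph H) :
    Continuous fun t => W.smooth K t η := by
  simp only [smooth_apply]
  exact (W.phase.continuous_evol K _).sub (K.continuous.comp (W.phase.continuous_evol K _))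

theorem denseRange_J : DenseRange W.J := by
  have h : DenseRange (-rot H : Ph H →L[ℝ] Ph H) := by
    refine Function.Surjective.denseRange fun x => ⟨rot H x, ?_⟩
    rw [neg_apply, rot_rot, neg_neg]
  exact h.comp W.denseRange_Sph (-rot H).continuous

theorem J_injective : Function.Injective W.J := by
  intro x y h
  refine W.Sph_injective ?_
  rw [← rot_J, ← rot_J, h]

/-- Strong solutions of `w'' + A w + L w = 0`. -/
theorem strongOn_smooth (L : H →L[ℝ] H) (η : Ph H) (T : ℝ) :
    W.StrongOn T (fun t => -L (W.S (W.S (-(W.smooth (pert (L.comp W.S)) t η).snd))))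
      (fun t => -(W.smooth (pert (L.comp W.S)) t η).snd)
      fun t => (W.smooth (pert (L.comp W.S)) t η).fst := by
  set K := pert (L.comp W.S)
  have hc := W.continuous_smooth K η
  have hα : Continuous fun t => -(W.smooth K t η).snd := hc.phSnd.neg
  have hd := fun t => (W.hasDerivAt_evol_J K t η).hasDerivWithinAt (s := Set.Icc 0 T)
  have hs : ∀ t, W.phase.evol K t (η + K (W.J η)) = W.smooth K t η + K (W.J (W.smooth K t η)) := by
    intro t
    rw [← evol_J, smooth_apply, sub_add_cancel]
  simp only [hs, evol_J] at hd
  refine ⟨(L.continuous.comp (W.S.continuous.comp (W.S.continuous.comp hα))).neg.continuousOn,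
    hα.continuousOn, hc.phFst.continuousOn, fun t _ => ?_, fun t _ => ?_⟩
  · have := W.S.hasFDerivAt.comp_hasDerivWithinAt t (hd t).phFst
    simpa only [Function.comp_def, J_fst, map_neg, WithLp.add_fst, K, pert_fst, add_zero] using this
  · have := (hd t).phSnd
    simp only [J_snd, WithLp.add_snd, K, pert_snd, J_fst, ContinuousLinearMap.comp_apply] at this
    convert! this using 1
    rw [sub_neg_eq_add, add_comm, map_neg]

/-- All strong solutions of `w'' + A w + L w = 0` arise from `smooth`. -/
theorem StrongOn.eq_smooth {T : ℝ} (L : H →L[ℝ] H) {α β : ℝ → H}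
    (h : W.StrongOn T (fun t => -L (W.S (W.S (α t)))) α β) {t : ℝ} (ht : t ∈ Set.Icc 0 T) :
    ph (β t) (-α t) = W.smooth (pert (L.comp W.S)) t (ph (β 0) (-α 0)) := by
  have hJ : ∀ t, W.J (ph (β t) (-α t)) = ph (W.S (α t)) (W.S (β t)) := fun t =>
    Ph.ext (by rw [J_fst]; simp) (W.J_snd _)
  refine W.J_injective ?_
  rw [← evol_J, hJ, hJ]
  have hm := h.mildOn 0
  simp only [pow_zero, one_apply_eq_self] at hm
  refine MildOn.eq_evol (K := pert (L.comp W.S)) (x := fun t => ph (W.S (α t)) (W.S (β t))) ?_ ht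
  convert! hm using 2 with t
  exact Ph.ext (pert_fst _ _) (pert_snd _ _)

end WaveGroup

end Cascade

/-! ### The cascade as one system, its weights and trajectories. -/

namespace Cascade

open MeasureTheory

section Coupling

variable {H : Type*} [NormedAddCommGroup H] [InnerProductSpace ℝ H]

/-- The index set of the components of the cascade. -/
abbrev Idx (n p : ℕ) := Finset.Icc 1 (n + p)

/-- The coefficients of the coupling term. -/
def coef (n : ℕ) (C : ℕ → ℕ → H →L[ℝ] H) (i j : ℕ) : H →L[ℝ] H :=
  if i ≤ 1 then 0
  else if i ≤ n then (if j = i - 1 then C i j else 0)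
  else if n - 1 ≤ j ∧ j ≤ i - 1 then C i j else 0

theorem coupling_eq_sum {n p : ℕ} [CompleteSpace H] (hn : 2 ≤ n) (C : ℕ → ℕ → H →L[ℝ] H)
    (u : ℕ → H) (i : Idx n p) : coupling n C u i = ∑ j : Idx n p, coef n C i j (u j) := by
  obtain ⟨i, hi⟩ := i
  obtain ⟨h1, h2⟩ := Finset.mem_Icc.mp hi
  rw [Finset.sum_coe_sort (Finset.Icc 1 (n + p)) fun j => coef n C i j (u j)]
  simp only [coupling, coef]
  split_ifs with ha hb
  · simp
  · rw [Finset.sum_eq_single (i - 1)]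
    · simp
    · intro j _ hj; simp [hj]
    · intro h; exact absurd (Finset.mem_Icc.mpr ⟨by omega, by omega⟩) h
  · refine Eq.trans ?_ (Finset.sum_subset (s₁ := Finset.Icc (n - 1) (i - 1))
      (f := fun j => (if n - 1 ≤ j ∧ j ≤ i - 1 then C i j else 0) (u j)) ?_ ?_)
    · refine Finset.sum_congr rfl fun j hj => ?_
      rw [if_pos (Finset.mem_Icc.mp hj)]
    · intro j hj
      obtain ⟨h3, h4⟩ := Finset.mem_Icc.mp hj
      exact Finset.mem_Icc.mpr ⟨by omega, by omega⟩
    · intro j _ hj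
      rw [if_neg fun h => hj (Finset.mem_Icc.mpr h), zero_apply]

/-- The coupling operator of the whole system. -/
def couplingOp (n p : ℕ) (C : ℕ → ℕ → H →L[ℝ] H) : Pw (Idx n p) H →L[ℝ] Pw (Idx n p) H :=
  pwMat fun i j => coef n C i j

theorem couplingOp_apply {n p : ℕ} [CompleteSpace H] (hn : 2 ≤ n) (C : ℕ → ℕ → H →L[ℝ] H)
    {u : ℕ → H} {x : Pw (Idx n p) H} (hx : ∀ j, x j = u j) (i : Idx n p) :
    couplingOp n p C x i = coupling n C u i := by
  rw [coupling_eq_sum hn, couplingOp, pwMat_apply]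
  simp only [hx]

/-- The system `q + C S S q = r` is solvable, since the coupling is strictly triangular. -/
theorem exists_add_coupling {n p : ℕ} [CompleteSpace H] (hn : 2 ≤ n) (C : ℕ → ℕ → H →L[ℝ] H)
    (L : H →L[ℝ] H) (r : Pw (Idx n p) H) :
    ∃ q : Pw (Idx n p) H, q + couplingOp n p C (pwDiag (fun _ => L) q) = r := by
  -- Forward substitution: the coupling of equation `m` involves earlier entries only, so the `m`-th
  -- entry can be set without disturbing the equations already solved.
  have h : ∀ m, ∃ q : ℕ → H, ∀ i : Idx n p, (i : ℕ) < m →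
      q i + coupling n C (fun k => L (q k)) i = r i := by
    intro m
    induction m with
    | zero => exact ⟨0, fun i hi => absurd hi (Nat.not_lt_zero _)⟩
    | succ m ih =>
      obtain ⟨q, hq⟩ := ih
      have hcongr : ∀ (x : H) (i : ℕ), 1 ≤ i → i ≤ m →
          coupling n C (fun k => L (Function.update q m x k)) i
            = coupling n C (fun k => L (q k)) i := by
        intro x i h1 hi
        simp only [coupling]
        split_ifs with ha hb
        · rfl
        · rw [Function.update_of_ne (by omega)]
        · refine Finset.sum_congr rfl fun k hk => ?_
          have := (Finset.mem_Icc.mp hk).2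
          rw [Function.update_of_ne (by omega)]
      by_cases hm : m ∈ Finset.Icc 1 (n + p)
      · refine ⟨Function.update q m (r ⟨m, hm⟩ - coupling n C (fun k => L (q k)) m),
          fun i hi => ?_⟩
        rw [hcongr _ _ (Finset.mem_Icc.mp i.2).1 (by omega)]
        rcases eq_or_ne (i : ℕ) m with rfl | hne
        · rw [Function.update_self, sub_add_cancel]
        · rw [Function.update_of_ne hne]
          exact hq i (by omega)
      · refine ⟨q, fun i hi => hq i ?_⟩
        have : (i : ℕ) ≠ m := fun h => hm (h ▸ i.2)
        omega
  obtain ⟨q, hq⟩ := h (n + p + 1)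
  refine ⟨WithLp.toLp 2 fun i => q i, PiLp.ext fun i => ?_⟩
  rw [← hq i (by have := (Finset.mem_Icc.mp i.2).2; omega)]
  exact congrArg (q i + ·) (couplingOp_apply hn C (u := fun k => L (q k)) (fun _ => rfl) i)

end Coupling

namespace WaveGroup

variable {H : Type*} [NormedAddCommGroup H] [InnerProductSpace ℝ H] (W : WaveGroup H)

theorem pow_c_comm (k : ℕ) (t : ℝ) (x : H) : (W.S ^ k) (W.c t x) = W.c t ((W.S ^ k) x) := by
  induction k generalizing x with
  | zero => simp
  | succ k ih => rw [pow_succ, mul_apply_eq_comp, mul_apply_eq_comp, ← W.c_comm, ih]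

theorem pow_s_comm (k : ℕ) (t : ℝ) (x : H) : (W.S ^ k) (W.s t x) = W.s t ((W.S ^ k) x) := by
  induction k generalizing x with
  | zero => simp
  | succ k ih => rw [pow_succ, mul_apply_eq_comp, mul_apply_eq_comp, ← W.s_comm, ih]

/-- The diagonal operator with entries `S^(n-i+e)`. -/
def weight (n p e : ℕ) : Pw (Idx n p) H →L[ℝ] Pw (Idx n p) H :=
  pwDiag fun i => W.S ^ (n - (i : ℕ) + e)

theorem weight_apply (n p e : ℕ) (x : Pw (Idx n p) H) (i : Idx n p) :
    W.weight n p e x i = (W.S ^ (n - (i : ℕ) + e)) (x i) := rfl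

/-- The diagonal operator with entries `S^(n-i+e)` on the phase space. -/
def weightPh (n p e : ℕ) : Ph (Pw (Idx n p) H) →L[ℝ] Ph (Pw (Idx n p) H) :=
  phMat (W.weight n p e) 0 0 (W.weight n p e)

theorem weightPh_fst (n p e : ℕ) (x : Ph (Pw (Idx n p) H)) :
    (W.weightPh n p e x).fst = W.weight n p e x.fst := by simp [weightPh]

theorem weightPh_snd (n p e : ℕ) (x : Ph (Pw (Idx n p) H)) :
    (W.weightPh n p e x).snd = W.weight n p e x.snd := by simp [weightPh]

theorem weightPh_U (n p e : ℕ) (t : ℝ) (x : Ph (Pw (Idx n p) H)) :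
    W.weightPh n p e ((W.pi _).phase.U t x) = (W.pi _).phase.U t (W.weightPh n p e x) := by
  have hc : ∀ y : Pw (Idx n p) H, W.weight n p e ((W.pi _).c t y) = (W.pi _).c t (W.weight n p e y) :=
    fun y => PiLp.ext fun i => W.pow_c_comm _ t (y i)
  have hs : ∀ y : Pw (Idx n p) H, W.weight n p e ((W.pi _).s t y) = (W.pi _).s t (W.weight n p e y) :=
    fun y => PiLp.ext fun i => W.pow_s_comm _ t (y i)
  refine Ph.ext ?_ ?_
  · simp only [weightPh_fst, weightPh_snd, U_fst, map_add, hc, hs]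
  · simp only [weightPh_fst, weightPh_snd, U_snd, map_add, map_neg, hc, hs]

theorem weightPh_Sph (n p e : ℕ) (x : Ph (Pw (Idx n p) H)) :
    W.weightPh n p e ((W.pi _).Sph x) = (W.pi _).Sph (W.weightPh n p e x) := by
  have h : ∀ y : Pw (Idx n p) H, W.weight n p e ((W.pi _).S y) = (W.pi _).S (W.weight n p e y) :=
    fun y => PiLp.ext fun i => (W.S_pow_comm _ (y i)).symm
  refine Ph.ext ?_ ?_
  · simp only [weightPh_fst, Sph_fst, h]
  · simp only [weightPh_snd, Sph_snd, h]

theorem weightPh_rot (n p e : ℕ) (x : Ph (Pw (Idx n p) H)) :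
    W.weightPh n p e (rot _ x) = rot _ (W.weightPh n p e x) := by
  refine Ph.ext ?_ ?_
  · simp only [weightPh_fst, weightPh_snd, rot_fst]
  · simp only [weightPh_fst, weightPh_snd, rot_snd, map_neg]

theorem weightPh_one (n p : ℕ) (x : Ph (Pw (Idx n p) H)) :
    W.weightPh n p 1 x = (W.pi _).Sph (W.weightPh n p 0 x) := by
  have h : ∀ y : Pw (Idx n p) H, W.weight n p 1 y = (W.pi _).S (W.weight n p 0 y) :=
    fun y => PiLp.ext fun i => by
      rw [weight_apply, pi_S_apply, weight_apply, pow_succ', mul_apply_eq_comp, add_zero]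
  refine Ph.ext ?_ ?_
  · simp only [weightPh_fst, Sph_fst, h]
  · simp only [weightPh_snd, Sph_snd, h]

variable [CompleteSpace H]

theorem denseRange_weightPh (n p e : ℕ) : DenseRange (W.weightPh n p e) := by
  refine denseRange_of_symm (fun x y => ?_) fun x hx => ?_
  · simp only [Ph.inner_def, weightPh_fst, weightPh_snd, PiLp.inner_apply, weight_apply, W.pow_symm]
  · refine Ph.ext (PiLp.ext fun i => W.pow_inj (n - (i : ℕ) + e) ?_)
      (PiLp.ext fun i => W.pow_inj (n - (i : ℕ) + e) ?_)
    · rw [← weight_apply, ← weightPh_fst, hx]; rfl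
    · rw [← weight_apply, ← weightPh_snd, hx]; rfl

variable {W} {A : H →ₗ.[ℝ] H} {n p : ℕ} {C : ℕ → ℕ → H →L[ℝ] H} {P : ℕ → H →L[ℝ] H}

/-- The weighted coupling is bounded. -/
theorem IsRoot.exists_intertwine (hW : W.IsRoot A) (hA : HypA1 A) (hn : 2 ≤ n)
    (hA2 : HypA2 A n C P) (hC : HypC A n p C) {e : ℕ} (he : e ≤ 1) :
    ∃ κ : Pw (Idx n p) H →L[ℝ] Pw (Idx n p) H, ∀ x,
      W.weight n p e (couplingOp n p C ((W.pi _).S x)) = κ (W.weight n p e x) := by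
  -- Entry by entry. When the weight exponent of `j` exceeds that of `i` by one, as for `j = i - 1`
  -- with `i ≤ n` and for `j = n - 1` with `i > n`, it absorbs the factor `S`; for `n ≤ j < i` this
  -- factor remains as a bounded operator. The exponents `n - i + e` with `e ≤ 1` stay within (A2)
  -- and (C).
  have h : ∀ i j : Idx n p, ∃ k : H →L[ℝ] H, ∀ x : H,
      (W.S ^ (n - (i : ℕ) + e)) (coef n C i j (W.S x)) = k ((W.S ^ (n - (j : ℕ) + e)) x) := by
    rintro ⟨i, hi⟩ ⟨j, hj⟩
    obtain ⟨hi1, hi2⟩ := Finset.mem_Icc.mp hi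
    simp only [coef]
    split_ifs with ha hb hc hc
    · exact ⟨0, fun x => by simp⟩
    · subst hc
      obtain ⟨k, hk⟩ := hW.exists_boundedOn hA
        ((hA2 i (Finset.mem_Icc.mpr ⟨by omega, hb⟩)).1 (n - i + e) (by omega))
      refine ⟨k, fun x => ?_⟩
      rw [hk, show n - (i - 1) + e = n - i + e + 1 by omega, pow_succ, mul_apply_eq_comp]
    · exact ⟨0, fun x => by simp⟩
    · obtain ⟨k, hk⟩ := hW.exists_boundedOn hA (hC i (Finset.mem_Icc.mpr ⟨by omega, hi2⟩) j
        (Finset.mem_Icc.mpr hc) e he).2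
      rw [show n - i + e = e by omega]
      rcases hc.1.eq_or_lt with hj | hj
      · refine ⟨k, fun x => ?_⟩
        rw [hk, show n - j + e = e + 1 by omega, pow_succ, mul_apply_eq_comp]
      · refine ⟨k.comp W.S, fun x => ?_⟩
        rw [hk, show n - j + e = e by omega, ContinuousLinearMap.comp_apply, S_pow_comm]
    · exact ⟨0, fun x => by simp⟩
  choose k hk using h
  refine ⟨pwMat k, fun x => PiLp.ext fun i => ?_⟩
  rw [weight_apply, couplingOp, pwMat_apply, pwMat_apply, map_sum]
  exact Finset.sum_congr rfl fun j _ => hk i j (x j)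

/-- The operator mapping the parameter `η` to the state `(β, -α)` at time `t` of the strong
solution `(S² α, S β)` of the cascade system. -/
def traj (W : WaveGroup H) (n p : ℕ) (C : ℕ → ℕ → H →L[ℝ] H) (t : ℝ) :
    Ph (Pw (Idx n p) H) →L[ℝ] Ph (Pw (Idx n p) H) :=
  (W.pi _).smooth (pert ((couplingOp n p C).comp (W.pi _).S)) t

/-- The components of a function with values in `H^Idx` as elements of `H_k`. -/
def IsRoot.comps (hW : W.IsRoot A) (hA : HypA1 A) (k : ℕ) (α : ℝ → Pw (Idx n p) H) (i : ℕ) (t : ℝ) :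
    HSp A k := if h : i ∈ Finset.Icc 1 (n + p) then hW.equiv hA k (α t ⟨i, h⟩) else 0

theorem IsRoot.comps_apply (hW : W.IsRoot A) (hA : HypA1 A) (k : ℕ) (α : ℝ → Pw (Idx n p) H)
    (i : Idx n p) (t : ℝ) : hW.comps hA k α i t = hW.equiv hA k (α t i) := by
  rw [IsRoot.comps, dif_pos i.2]

theorem IsRoot.isCascadeSol_comps (hW : W.IsRoot A) (hA : HypA1 A) (hn : 2 ≤ n) {T : ℝ}
    {α β : ℝ → Pw (Idx n p) H} (h : (W.pi (Idx n p)).StrongOn T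
      (fun t => -couplingOp n p C ((W.pi _).S ((W.pi _).S (α t)))) α β) :
    IsCascadeSol A n p C T (hW.comps hA 2 α) (hW.comps hA 1 β) := by
  intro i hi
  have hc : ∀ t, coupling n C (fun k => HSp.val (hW.comps hA 2 α k t)) i
      = couplingOp n p C ((W.pi _).S ((W.pi _).S (α t))) ⟨i, hi⟩ := fun t =>
    (couplingOp_apply hn C (fun j => by rw [hW.comps_apply, hW.val_equiv, S_sq]; rfl) ⟨i, hi⟩).symm
  have e : ∀ (k : ℕ) (γ : ℝ → Pw (Idx n p) H), hW.comps hA k γ i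
      = fun t => hW.equiv hA k (γ t ⟨i, hi⟩) := fun k γ => funext fun t =>
    hW.comps_apply hA k γ ⟨i, hi⟩ t
  rw [e, e, hW.isStrongSol_iff]
  simp only [hc]
  have hpr := fun x : Pw (Idx n p) H => (PiLp.proj (𝕜 := ℝ) 2 (fun _ : Idx n p => H) ⟨i, hi⟩).hasFDerivAt (x := x)
  have hcp := (PiLp.proj (𝕜 := ℝ) 2 (fun _ : Idx n p => H) ⟨i, hi⟩).continuous
  exact ⟨hcp.comp_continuousOn h.source, hcp.comp_continuousOn h.cont,
    hcp.comp_continuousOn h.cont', fun t ht => (hpr _).comp_hasDerivWithinAt t (h.deriv t ht),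
    fun t ht => (hpr _).comp_hasDerivWithinAt t (h.eqn t ht)⟩

theorem IsRoot.isCascadeSol_traj (hW : W.IsRoot A) (hA : HypA1 A) (hn : 2 ≤ n)
    (C : ℕ → ℕ → H →L[ℝ] H) (T : ℝ) (η : Ph (Pw (Idx n p) H)) :
    IsCascadeSol A n p C T (hW.comps hA 2 fun t => -(W.traj n p C t η).snd)
      (hW.comps hA 1 fun t => (W.traj n p C t η).fst) :=
  hW.isCascadeSol_comps hA hn ((W.pi _).strongOn_smooth _ η T)

theorem IsRoot.exists_traj_eq (hW : W.IsRoot A) (hA : HypA1 A) (hn : 2 ≤ n) {T : ℝ}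
    {u : ℕ → ℝ → HSp A 2} {u' : ℕ → ℝ → HSp A 1} (h : IsCascadeSol A n p C T u u') :
    ∃ η, ∀ t ∈ Set.Icc 0 T, ∀ i : Idx n p,
      hW.equiv hA 2 (-(W.traj n p C t η).snd i) = u i t ∧
      hW.equiv hA 1 ((W.traj n p C t η).fst i) = u' i t := by
  set α : ℝ → Pw (Idx n p) H := fun t => WithLp.toLp 2 fun i => (hW.equiv hA 2).symm (u i t)
  set β : ℝ → Pw (Idx n p) H := fun t => WithLp.toLp 2 fun i => (hW.equiv hA 1).symm (u' i t)
  have hs : (W.pi (Idx n p)).StrongOn T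
      (fun t => -couplingOp n p C ((W.pi _).S ((W.pi _).S (α t)))) α β := by
    have hi := fun i : Idx n p => hW.strongOn hA (h i i.2)
    have hc : ∀ (i : Idx n p) t, couplingOp n p C ((W.pi _).S ((W.pi _).S (α t))) i
        = coupling n C (fun k => HSp.val (u k t)) i := fun i t =>
      couplingOp_apply hn C (fun j => by
        rw [← hW.pow_val_symm hA, S_sq]; rfl) i
    have hc' : ∀ t, -couplingOp n p C ((W.pi _).S ((W.pi _).S (α t)))
        = WithLp.toLp 2 fun i : Idx n p => -coupling n C (fun k => HSp.val (u k t)) i := fun t =>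
      PiLp.ext fun i => congrArg (- ·) (hc i t)
    simp only [hc']
    exact ⟨Pw.continuousOn fun i => (hi i).source, Pw.continuousOn fun i => (hi i).cont,
      Pw.continuousOn fun i => (hi i).cont',
      fun t ht => Pw.hasDerivWithinAt fun i => (hi i).deriv t ht,
      fun t ht => Pw.hasDerivWithinAt fun i => (hi i).eqn t ht⟩
  refine ⟨ph (β 0) (-α 0), fun t ht i => ?_⟩
  have e := hs.eq_smooth (W.pi _) _ ht
  have e1 : (W.traj n p C t (ph (β 0) (-α 0))).snd i = -(hW.equiv hA 2).symm (u i t) := by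
    rw [traj, ← e]; rfl
  have e2 : (W.traj n p C t (ph (β 0) (-α 0))).fst i = (hW.equiv hA 1).symm (u' i t) := by
    rw [traj, ← e]; rfl
  rw [e1, e2, neg_neg, LinearIsometryEquiv.apply_symm_apply, LinearIsometryEquiv.apply_symm_apply]
  exact ⟨rfl, rfl⟩

end WaveGroup

end Cascade

/-! ### Controllability from observability of weighted states. -/

namespace Cascade

open MeasureTheory

theorem intervalIntegrable_inner {F : Type*} [NormedAddCommGroup F] [InnerProductSpace ℝ F]
    {f g : ℝ → F} (hf : MemLp f 2) (hg : Continuous g) {τ : ℝ} (hτ : 0 ≤ τ) :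
    IntervalIntegrable (fun t => inner ℝ (f t) (g t)) volume 0 τ := by
  have h1 : MemLp ((Set.Ioc 0 τ).indicator g) 2 := by
    rw [memLp_indicator_iff_restrict measurableSet_Ioc,
      memLp_two_iff_integrable_sq_norm hg.aestronglyMeasurable]
    exact (hg.norm.pow 2).integrableOn_Ioc
  rw [intervalIntegrable_iff_integrableOn_Ioc_of_le hτ, ← integrable_indicator_iff measurableSet_Ioc]
  refine (L2.integrable_inner (𝕜 := ℝ) (hf.toLp f) (h1.toLp _)).congr ?_
  filter_upwards [hf.coeFn_toLp, h1.coeFn_toLp] with t h2 h3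
  rw [h2, h3]
  by_cases ht : t ∈ Set.Ioc 0 τ <;> simp [ht]

theorem Ph.norm_sq_eq_sum {ι H : Type*} [Fintype ι] [NormedAddCommGroup H] [InnerProductSpace ℝ H]
    (y : Ph (Pw ι H)) : ‖y‖ ^ 2 = ∑ i, ‖ph (y.fst i) (y.snd i)‖ ^ 2 := by
  rw [Ph.norm_sq, PiLp.norm_sq_eq_of_L2, PiLp.norm_sq_eq_of_L2, ← Finset.sum_add_distrib]
  exact Finset.sum_congr rfl fun i _ => (WaveGroup.norm_ph_sq _ _).symm

namespace WaveGroup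

variable {H : Type*} [NormedAddCommGroup H] [InnerProductSpace ℝ H] [CompleteSpace H]
  {W : WaveGroup H} {A : H →ₗ.[ℝ] H} {n p : ℕ} {C : ℕ → ℕ → H →L[ℝ] H} {P : ℕ → H →L[ℝ] H}

/-- The operator mapping the parameter `η` to `α_k(t)`, for the strong solution
`(S² α, S β)` of the cascade system. -/
def posn (W : WaveGroup H) (n p : ℕ) (C : ℕ → ℕ → H →L[ℝ] H) (t : ℝ) (k : ℕ) :
    Ph (Pw (Idx n p) H) →L[ℝ] H :=
  if h : k ∈ Idx n p then
    -((PiLp.proj (𝕜 := ℝ) 2 (fun _ : Idx n p => H) ⟨k, h⟩).comp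
      ((WithLp.sndL 2 ℝ _ _).comp (W.traj n p C t)))
  else 0

theorem posn_coe (t : ℝ) (k : Idx n p) (η : Ph (Pw (Idx n p) H)) :
    W.posn n p C t k η = -(W.traj n p C t η).snd k := by
  rw [posn, dif_pos k.2]; rfl

theorem continuous_posn (k : ℕ) (η : Ph (Pw (Idx n p) H)) :
    Continuous fun t => W.posn n p C t k η := by
  by_cases hk : k ∈ Idx n p
  · have h1 := ((W.pi (Idx n p)).continuous_smooth (pert ((couplingOp n p C).comp (W.pi _).S)) η).phSnd
    have h2 := ((PiLp.proj (𝕜 := ℝ) 2 (fun _ : Idx n p => H) ⟨k, hk⟩).continuous.comp h1).neg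
    exact h2.congr fun t => (posn_coe t ⟨k, hk⟩ η).symm
  · simp only [posn, dif_neg hk]
    exact continuous_const

theorem IsRoot.comps_posn (hW : W.IsRoot A) (hA : HypA1 A) (η : Ph (Pw (Idx n p) H)) (k : ℕ)
    (t : ℝ) : hW.comps hA 2 (fun t => -(W.traj n p C t η).snd) k t
      = hW.equiv hA 2 (W.posn n p C t k η) := by
  by_cases hk : k ∈ Idx n p
  · rw [posn_coe t ⟨k, hk⟩]
    exact hW.comps_apply hA 2 _ ⟨k, hk⟩ t
  · rw [IsRoot.comps, dif_neg hk, posn, dif_neg hk]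
    simp

theorem traj_zero (η : Ph (Pw (Idx n p) H)) : W.traj n p C 0 η = η := by
  rw [traj, smooth_apply, UnitaryGroup.evol_zero, UnitaryGroup.evol_zero, add_sub_cancel_right]

/-- The weighted states of strong solutions evolve by a group. -/
theorem weightPh_traj {e : ℕ} {κ : Pw (Idx n p) H →L[ℝ] Pw (Idx n p) H}
    (hκ : ∀ x, W.weight n p e (couplingOp n p C ((W.pi _).S x)) = κ (W.weight n p e x)) (t : ℝ)
    (η : Ph (Pw (Idx n p) H)) : W.weightPh n p e ((W.pi _).J (W.traj n p C t η))
      = (W.pi _).phase.evol (pert κ) t (W.weightPh n p e ((W.pi _).J η)) := by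
  rw [traj, ← evol_J]
  refine (W.pi _).phase.map_evol _ (W.weightPh_U n p e) (fun x => Ph.ext ?_ ?_) t _
  · rw [weightPh_fst, pert_fst, pert_fst, map_zero]
  · rw [weightPh_snd, pert_snd, pert_snd, map_neg, weightPh_fst, ContinuousLinearMap.comp_apply, hκ]

theorem denseRange_weightPh_J (W : WaveGroup H) (n p e : ℕ) :
    DenseRange ((W.weightPh n p e).comp (W.pi _).J) :=
  (W.denseRange_weightPh n p e).comp (W.pi _).denseRange_J (W.weightPh n p e).continuous

variable {G : ℕ → Type*} [∀ k, NormedAddCommGroup (G k)] [∀ k, InnerProductSpace ℝ (G k)]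

theorem continuous_observation_posn (ob : ∀ k, H →L[ℝ] G k) (k : ℕ) (η : Ph (Pw (Idx n p) H)) :
    Continuous fun t => ob k (W.posn n p C t k η) :=
  (ob k).continuous.comp (continuous_posn k η)

/-- The joint observation of the components `n, …, n + p`. -/
def jointObs (W : WaveGroup H) (n p : ℕ) (C : ℕ → ℕ → H →L[ℝ] H) (ob : ∀ k, H →L[ℝ] G k) (t : ℝ) :
    Ph (Pw (Idx n p) H) →ₗ[ℝ] PiLp 2 fun k : Finset.Icc n (n + p) => G k where
  toFun η := WithLp.toLp 2 fun k => ob k (W.posn n p C t k η)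
  map_add' η ξ := PiLp.ext fun k => by
    change ob k (W.posn n p C t k (η + ξ)) = ob k _ + ob k _
    rw [map_add, map_add]
  map_smul' r η := PiLp.ext fun k => by
    change ob k (W.posn n p C t k (r • η)) = r • ob k _
    rw [map_smul, map_smul]

theorem continuous_jointObs (ob : ∀ k, H →L[ℝ] G k) (η : Ph (Pw (Idx n p) H)) :
    Continuous fun t => W.jointObs n p C ob t η :=
  (PiLp.continuousLinearEquiv 2 ℝ fun k : Finset.Icc n (n + p) => G k).symm.continuous.comp
    (continuous_pi fun k => continuous_observation_posn ob k η)

theorem integral_norm_jointObs (ob : ∀ k, H →L[ℝ] G k) (η : Ph (Pw (Idx n p) H)) (T : ℝ) :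
    ∫ t in (0 : ℝ)..T, ‖W.jointObs n p C ob t η‖ ^ 2
      = ∑ k ∈ Finset.Icc n (n + p), ∫ t in (0 : ℝ)..T, ‖ob k (W.posn n p C t k η)‖ ^ 2 := by
  have hi : ∀ k ∈ Finset.Icc n (n + p), IntervalIntegrable
      (fun t => ‖ob k (W.posn n p C t k η)‖ ^ 2) volume 0 T := fun k _ =>
    ((continuous_observation_posn ob k η).norm.pow 2).intervalIntegrable _ _
  rw [← intervalIntegral.integral_finsetSum hi]
  refine intervalIntegral.integral_congr fun t _ => ?_
  rw [PiLp.norm_sq_eq_of_L2]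
  exact Finset.sum_coe_sort (Finset.Icc n (n + p)) fun k => ‖ob k (W.posn n p C t k η)‖ ^ 2

/-- The components of a control of the joint observation. -/
def splitControl {n p : ℕ} (v : ℝ → PiLp 2 fun k : Finset.Icc n (n + p) => G k) (k : ℕ) (t : ℝ) :
    G k := if h : k ∈ Finset.Icc n (n + p) then v t ⟨k, h⟩ else 0

theorem memLp_splitControl {v : ℝ → PiLp 2 fun k : Finset.Icc n (n + p) => G k} (hv : MemLp v 2)
    (k : ℕ) : MemLp (splitControl v k) 2 := by
  by_cases hk : k ∈ Finset.Icc n (n + p)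
  · refine ((PiLp.proj (𝕜 := ℝ) 2 (fun k : Finset.Icc n (n + p) => G k) ⟨k, hk⟩).comp_memLp' hv).ae_eq
      (.of_forall fun t => ?_)
    rw [splitControl, dif_pos hk]; rfl
  · have : splitControl v k = fun _ => 0 := funext fun t => by rw [splitControl, dif_neg hk]
    rw [this]; exact MemLp.zero

theorem integral_inner_jointObs (ob : ∀ k, H →L[ℝ] G k)
    {v : ℝ → PiLp 2 fun k : Finset.Icc n (n + p) => G k} (hv : MemLp v 2)
    (η : Ph (Pw (Idx n p) H)) {τ : ℝ} (hτ : 0 ≤ τ) :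
    ∫ t in (0 : ℝ)..τ, inner ℝ (v t) (W.jointObs n p C ob t η)
      = ∑ k ∈ Finset.Icc n (n + p),
        ∫ t in (0 : ℝ)..τ, inner ℝ (splitControl v k t) (ob k (W.posn n p C t k η)) := by
  have hi : ∀ k ∈ Finset.Icc n (n + p), IntervalIntegrable
      (fun t => (inner ℝ (splitControl v k t) (ob k (W.posn n p C t k η)) : ℝ)) volume 0 τ :=
    fun k _ => intervalIntegrable_inner (memLp_splitControl hv k)
      (continuous_observation_posn ob k η) hτ
  rw [← intervalIntegral.integral_finsetSum hi]
  refine intervalIntegral.integral_congr fun t _ => ?_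
  rw [PiLp.inner_apply, ← Finset.sum_coe_sort (Finset.Icc n (n + p))
    fun k => (inner ℝ (splitControl v k t) (ob k (W.posn n p C t k η)) : ℝ)]
  refine Finset.sum_congr rfl fun k _ => ?_
  rw [splitControl, dif_pos k.2]
  rfl

variable [∀ k, CompleteSpace (G k)]

/-- Exact controllability of the adjoint of the cascade system, given the observability and
admissibility estimates at the level of the weighted states. -/
theorem IsRoot.exists_system_control (hW : W.IsRoot A) (hA : HypA1 A) (hn : 2 ≤ n)
    (hA2 : HypA2 A n C P) (hC : HypC A n p C) {e : ℕ} (he : e ≤ 1) (ob : ∀ k, H →L[ℝ] G k)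
    {T c : ℝ} (hT : 0 ≤ T) (hc : 0 ≤ c)
    (hobs : ∀ η, ‖W.weightPh n p e ((W.pi _).J η)‖ ^ 2
      ≤ c * ∑ k ∈ Finset.Icc n (n + p), ∫ t in (0 : ℝ)..T, ‖ob k (W.posn n p C t k η)‖ ^ 2)
    (hadm : ∀ k ∈ Finset.Icc n (n + p), ∃ D, 0 ≤ D ∧ ∀ η,
      ∫ t in (0 : ℝ)..T, ‖ob k (W.posn n p C t k η)‖ ^ 2
        ≤ D * ‖W.weightPh n p e ((W.pi _).J η)‖ ^ 2)
    (Y₀ : Ph (Pw (Idx n p) H)) :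
    ∃ v : ∀ k, ℝ → G k, (∀ k, MemLp (v k) 2) ∧
      (∃ Y : ℝ → Ph (Pw (Idx n p) H), ContinuousOn Y (Set.Icc 0 T) ∧ Y 0 = Y₀ ∧
        ∀ τ ∈ Set.Icc 0 T, ∀ η,
          inner ℝ (Y τ) (W.weightPh n p e ((W.pi _).J (W.traj n p C τ η)))
            = inner ℝ Y₀ (W.weightPh n p e ((W.pi _).J η))
              + ∑ k ∈ Finset.Icc n (n + p),
                ∫ t in (0 : ℝ)..τ, inner ℝ (v k t) (ob k (W.posn n p C t k η))) ∧
      ∀ q, (∀ η, inner ℝ q (W.weightPh n p e ((W.pi _).J (W.traj n p C T η)))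
          = inner ℝ Y₀ (W.weightPh n p e ((W.pi _).J η))
            + ∑ k ∈ Finset.Icc n (n + p),
              ∫ t in (0 : ℝ)..T, inner ℝ (v k t) (ob k (W.posn n p C t k η))) → q = 0 := by
  obtain ⟨κ, hκ⟩ := hW.exists_intertwine hA hn hA2 hC he
  choose! D hD hadm using hadm
  obtain ⟨v, hv, ⟨Y, hYc, hY0, hY⟩, hfin⟩ := (W.pi (Idx n p)).phase.exists_control (pert κ)
    (D := (((W.weightPh n p e).comp (W.pi _).J : Ph (Pw (Idx n p) H) →L[ℝ] Ph (Pw (Idx n p) H)) :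
      Ph (Pw (Idx n p) H) →ₗ[ℝ] Ph (Pw (Idx n p) H))) (W.denseRange_weightPh_J n p e)
    (b := W.jointObs n p C ob)
    (continuous_jointObs ob) hT hc (C := ∑ k ∈ Finset.Icc n (n + p), D k) (Finset.sum_nonneg hD)
    (fun η => by rw [integral_norm_jointObs]; exact hobs η)
    (fun η => by
      rw [integral_norm_jointObs, Finset.sum_mul]
      exact Finset.sum_le_sum fun k hk => hadm k hk η) Y₀
  refine ⟨splitControl v, memLp_splitControl hv, ⟨Y, hYc, hY0, fun τ hτ η => ?_⟩, fun q hq => ?_⟩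
  · rw [weightPh_traj hκ, ← integral_inner_jointObs ob hv η hτ.1]
    exact hY τ hτ η
  · have h0 : ∀ η, inner ℝ q ((W.pi _).phase.evol (pert κ) T
        (W.weightPh n p e ((W.pi _).J η))) = 0 := fun η => by
      rw [← weightPh_traj hκ, hq, ← integral_inner_jointObs ob hv η hT]
      exact hfin η
    -- The evolution is invertible, so smooth data remain dense at time `T`, and a vector orthogonal
    -- to all of them vanishes. This gives zero final state for every transposition solution, not
    -- only for the one constructed.
    have hsurj : Function.Surjective ((W.pi (Idx n p)).phase.evol (pert κ) T) := fun x =>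
      ⟨_, (W.pi (Idx n p)).phase.evol_evol_neg (pert κ) T x⟩
    have hd := hsurj.denseRange.comp (W.denseRange_weightPh_J n p e)
      ((W.pi (Idx n p)).phase.evol (pert κ) T).continuous
    exact norm_le_zero_iff.mp (norm_le_of_denseRange hd le_rfl fun η => by
      rw [zero_mul, Function.comp_apply, ContinuousLinearMap.comp_apply, h0])

theorem IsRoot.nrm_traj (hW : W.IsRoot A) (hA : HypA1 A) (η : Ph (Pw (Idx n p) H)) (i : Idx n p)
    (t : ℝ) : hW.nrm hA n (hW.comps hA 2 fun t => -(W.traj n p C t η).snd)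
      (hW.comps hA 1 fun t => (W.traj n p C t η).fst) i t
      = ph ((W.weightPh n p 0 ((W.pi _).J (W.traj n p C t η))).fst i)
        ((W.weightPh n p 0 ((W.pi _).J (W.traj n p C t η))).snd i) := by
  rw [IsRoot.nrm, hW.comps_apply, hW.comps_apply, LinearIsometryEquiv.symm_apply_apply,
    LinearIsometryEquiv.symm_apply_apply, weightPh_fst, weightPh_snd, J_fst, J_snd]
  simp only [weight_apply, add_zero, pi_S_apply, PiLp.neg_apply, map_neg]

theorem IsRoot.norm_nrm_traj_le (hW : W.IsRoot A) (hA : HypA1 A) (η : Ph (Pw (Idx n p) H))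
    {i : ℕ} (hi : i ∈ Idx n p) (t : ℝ) :
    ‖hW.nrm hA n (hW.comps hA 2 fun t => -(W.traj n p C t η).snd)
      (hW.comps hA 1 fun t => (W.traj n p C t η).fst) i t‖ ^ 2
      ≤ ‖W.weightPh n p 0 ((W.pi _).J (W.traj n p C t η))‖ ^ 2 := by
  have e := hW.nrm_traj hA (C := C) η ⟨i, hi⟩ t
  simp only at e
  rw [e, Ph.norm_sq_eq_sum]
  exact Finset.single_le_sum (f := fun i : Idx n p => ‖ph
    ((W.weightPh n p 0 ((W.pi _).J (W.traj n p C t η))).fst i)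
    ((W.weightPh n p 0 ((W.pi _).J (W.traj n p C t η))).snd i)‖ ^ 2)
    (fun i _ => by positivity) (Finset.mem_univ (⟨i, hi⟩ : Idx n p))

/-- An observability time provides an observability inequality for the weighted states. -/
theorem IsRoot.obs_le (hW : W.IsRoot A) (hA : HypA1 A) (hn : 2 ≤ n)
    {Bs : ∀ k, HSp A 2 × H →L[ℝ] G k} {Tstar T : ℝ} (hT0 : 0 ≤ T)
    (hobs : IsObsTime A n p C Bs Tstar) (hT : Tstar < T) :
    ∃ c, 0 ≤ c ∧ ∀ η, ‖W.weightPh n p 0 ((W.pi _).J η)‖ ^ 2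
      ≤ c * ∑ k ∈ Finset.Icc n (n + p), ∫ t in (0 : ℝ)..T,
        ‖Bs k (hW.comps hA 2 (fun t => -(W.traj n p C t η).snd) k t,
          HSp.val (hW.comps hA 1 (fun t => (W.traj n p C t η).fst) k t))‖ ^ 2 := by
  obtain ⟨d, ρ, hd, hρ, h⟩ := hobs T hT
  -- The factor `2` undoes the one half in the energy. `d i` serves `i ≤ n` and `ρ (i - n)` serves
  -- `i > n`; the superfluous term is nonnegative.
  refine ⟨∑ i : Idx n p, 2 * (d i + ρ (i - n)), Finset.sum_nonneg fun i _ => by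
    have := hd i; have := hρ (i - n); positivity, fun η => ?_⟩
  obtain ⟨h1, h2⟩ := h _ _ (hW.isCascadeSol_traj hA hn C T η)
  set u := hW.comps hA 2 (fun t => -(W.traj n p C t η).snd)
  set u' := hW.comps hA 1 (fun t => (W.traj n p C t η).fst)
  set O : ℕ → ℝ := fun k => ∫ t in (0 : ℝ)..T, ‖Bs k (u k t, HSp.val (u' k t))‖ ^ 2
  have hO : ∀ k, 0 ≤ O k := fun k =>
    intervalIntegral.integral_nonneg hT0 fun _ _ => by positivity
  have hS : 0 ≤ ∑ k ∈ Finset.Icc n (n + p), O k := Finset.sum_nonneg fun k _ => hO k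
  have e0 : ‖W.weightPh n p 0 ((W.pi _).J η)‖ ^ 2 = ∑ i : Idx n p, ‖hW.nrm hA n u u' i 0‖ ^ 2 := by
    rw [Ph.norm_sq_eq_sum]
    refine Finset.sum_congr rfl fun i _ => ?_
    rw [hW.nrm_traj, traj_zero]
  rw [e0, Finset.sum_mul]
  refine Finset.sum_le_sum fun i _ => ?_
  obtain ⟨hi1, hi2⟩ := Finset.mem_Icc.mp i.2
  have hdi := hd i
  have hρi := hρ (i - n)
  change _ ≤ 2 * (d i + ρ (i - n)) * ∑ k ∈ Finset.Icc n (n + p), O k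
  rcases le_or_gt (i : ℕ) n with hin | hin
  · have h3 := h1 i (Finset.mem_Icc.mpr ⟨hi1, hin⟩)
    rw [energy_level hW hA hin] at h3
    change ‖hW.nrm hA n u u' i 0‖ ^ 2 / 2 ≤ d i * O n at h3
    have h4 : O n ≤ ∑ k ∈ Finset.Icc n (n + p), O k :=
      Finset.single_le_sum (fun k _ => hO k) (Finset.mem_Icc.mpr ⟨le_rfl, by omega⟩)
    have h5 := mul_le_mul_of_nonneg_left h4 hdi.le
    nlinarith [mul_nonneg hρi.le hS]
  · have h3 := h2 (i - n) (Finset.mem_Icc.mpr ⟨by omega, by omega⟩)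
    rw [show n + ((i : ℕ) - n) = i by omega] at h3
    have e := hW.energy_one hA ((hW.equiv hA 2).symm (u i 0)) ((hW.equiv hA 1).symm (u' i 0))
    rw [LinearIsometryEquiv.apply_symm_apply, LinearIsometryEquiv.apply_symm_apply] at e
    have e2 : hW.nrm hA n u u' i 0 = ph (W.S ((hW.equiv hA 2).symm (u i 0)))
        (W.S ((hW.equiv hA 1).symm (u' i 0))) := by
      rw [IsRoot.nrm, show n - (i : ℕ) = 0 by omega]; rfl
    rw [e, ← e2] at h3
    change _ ≤ ρ (i - n) * ∑ l ∈ Finset.range (i - n + 1), O (n + l) at h3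
    have h4 : ∑ l ∈ Finset.range (i - n + 1), O (n + l) ≤ ∑ k ∈ Finset.Icc n (n + p), O k := by
      rw [← Finset.sum_image (s := Finset.range (i - n + 1)) (g := fun l => n + l)
        (f := O) fun a _ b _ h => Nat.add_left_cancel h]
      refine Finset.sum_le_sum_of_subset_of_nonneg (fun k hk => ?_) fun k _ _ => hO k
      obtain ⟨l, hl, rfl⟩ := Finset.mem_image.mp hk
      have := Finset.mem_range.mp hl
      exact Finset.mem_Icc.mpr ⟨by omega, by omega⟩
    have h5 := mul_le_mul_of_nonneg_left h4 hρi.le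
    nlinarith [mul_nonneg hdi.le hS]

end WaveGroup

end Cascade

/-! ### Admissibility and the two kinds of control. -/

namespace Cascade

open MeasureTheory

theorem integral_le_const_mul {T c : ℝ} (hT : 0 ≤ T) {f : ℝ → ℝ} (h0 : ∀ t, 0 ≤ f t)
    (h : ∀ t ∈ Set.Icc 0 T, f t ≤ c) : ∫ t in (0 : ℝ)..T, f t ≤ c * T := by
  have := intervalIntegral.norm_integral_le_of_norm_le_const (a := 0) (b := T) (f := f) (C := c)
    fun t ht => by
      rw [Set.uIoc_of_le hT] at ht
      rw [Real.norm_eq_abs, abs_of_nonneg (h0 t)]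
      exact h t ⟨ht.1.le, ht.2⟩
  rw [sub_zero, abs_of_nonneg hT] at this
  exact (le_abs_self _).trans this

namespace WaveGroup

variable {H : Type*} [NormedAddCommGroup H] [InnerProductSpace ℝ H] [CompleteSpace H]
  {W : WaveGroup H} {A : H →ₗ.[ℝ] H} {n p : ℕ} {C : ℕ → ℕ → H →L[ℝ] H} {P : ℕ → H →L[ℝ] H}

theorem IsRoot.exists_coupling_bound (hW : W.IsRoot A) (hA : HypA1 A) (hn : 2 ≤ n)
    (C : ℕ → ℕ → H →L[ℝ] H) {k : ℕ} (hk : k ∈ Finset.Icc n (n + p)) :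
    ∃ F, 0 ≤ F ∧ ∀ (u : ℕ → ℝ → HSp A 2) (u' : ℕ → ℝ → HSp A 1) (t B : ℝ),
      (∀ j ∈ Idx n p, ‖hW.nrm hA n u u' j t‖ ^ 2 ≤ B) →
        ‖coupling n C (fun k => HSp.val (u k t)) k‖ ^ 2 ≤ F * B := by
  obtain ⟨h1, h2⟩ := Finset.mem_Icc.mp hk
  rcases h1.eq_or_lt with rfl | h1
  · refine ⟨(‖C n (n - 1)‖ * (1 + ‖W.S‖)) ^ 2, by positivity, fun u u' t B hB => ?_⟩
    rw [coupling_of_le C _ hn le_rfl]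
    have h3 := hB (n - 1) (Finset.mem_Icc.mpr ⟨by omega, by omega⟩)
    have h4 := hW.norm_val_le hA (u := u) (u' := u') (j := n - 1) le_rfl (by omega) t
    calc ‖C n (n - 1) (HSp.val (u (n - 1) t))‖ ^ 2
        ≤ (‖C n (n - 1)‖ * ((1 + ‖W.S‖) * ‖hW.nrm hA n u u' (n - 1) t‖)) ^ 2 := by
          gcongr
          exact (ContinuousLinearMap.le_opNorm _ _).trans (by gcongr)
      _ = (‖C n (n - 1)‖ * (1 + ‖W.S‖)) ^ 2 * ‖hW.nrm hA n u u' (n - 1) t‖ ^ 2 := by ring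
      _ ≤ _ := by gcongr
  · refine ⟨((∑ j ∈ Finset.Icc (n - 1) (k - 1), ‖C k j‖) * (1 + ‖W.S‖)) ^ 2, by positivity,
      fun u u' t B hB => ?_⟩
    exact norm_coupling_sq_le hW hA (by omega) h1 fun j hj hjk =>
      hB j (Finset.mem_Icc.mpr ⟨by omega, by omega⟩)

/-- Weighted states stay bounded by their initial values. -/
theorem IsRoot.exists_state_bound (hW : W.IsRoot A) (hA : HypA1 A) (hn : 2 ≤ n)
    (hA2 : HypA2 A n C P) (hC : HypC A n p C) {e : ℕ} (he : e ≤ 1) (T : ℝ) :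
    ∃ M, 0 < M ∧ ∀ t ∈ Set.Icc 0 T, ∀ η : Ph (Pw (Idx n p) H),
      ‖W.weightPh n p e ((W.pi _).J (W.traj n p C t η))‖
        ≤ M * ‖W.weightPh n p e ((W.pi _).J η)‖ := by
  obtain ⟨κ, hκ⟩ := hW.exists_intertwine hA hn hA2 hC he
  obtain ⟨M, hM, h⟩ := (W.pi (Idx n p)).phase.exists_evol_bound (pert κ) T
  refine ⟨M, hM, fun t ht η => ?_⟩
  rw [weightPh_traj hκ]
  exact h t (by rw [abs_of_nonneg ht.1]; exact ht.2) _

section Admissibility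

variable {G : Type*} [NormedAddCommGroup G] [InnerProductSpace ℝ G]

/-- Admissibility of an observation for the cascade system, from its admissibility for one
equation. -/
theorem IsRoot.exists_admissible (hW : W.IsRoot A) (hA : HypA1 A) (hn : 2 ≤ n)
    (hA2 : HypA2 A n C P) (hC : HypC A n p C) {k : ℕ} (hk : k ∈ Finset.Icc n (n + p))
    {Bs : HSp A 2 × H →L[ℝ] G} (h4 : HypA4 A Bs) {T : ℝ} (hT : 0 < T) :
    ∃ D, 0 ≤ D ∧ ∀ η : Ph (Pw (Idx n p) H), ∫ t in (0 : ℝ)..T,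
      ‖Bs (hW.comps hA 2 (fun t => -(W.traj n p C t η).snd) k t,
        HSp.val (hW.comps hA 1 (fun t => (W.traj n p C t η).fst) k t))‖ ^ 2
        ≤ D * ‖W.weightPh n p 0 ((W.pi _).J η)‖ ^ 2 := by
  obtain ⟨D, hD, h⟩ := h4 T hT
  obtain ⟨M, hM, hMb⟩ := hW.exists_state_bound hA hn hA2 hC (e := 0) zero_le_one T
  obtain ⟨F, hF, hFb⟩ := hW.exists_coupling_bound (p := p) hA hn C hk
  obtain ⟨h1, h2⟩ := Finset.mem_Icc.mp hk
  have hk' : k ∈ Idx n p := Finset.mem_Icc.mpr ⟨by omega, h2⟩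
  refine ⟨D * ((1 + T / 2 + F * T) * M ^ 2), by positivity, fun η => ?_⟩
  set u := hW.comps hA 2 (fun t => -(W.traj n p C t η).snd)
  set u' := hW.comps hA 1 (fun t => (W.traj n p C t η).fst)
  set B : ℝ := M ^ 2 * ‖W.weightPh n p 0 ((W.pi _).J η)‖ ^ 2 with hBdef
  have hB : ∀ t ∈ Set.Icc 0 T, ∀ j ∈ Idx n p, ‖hW.nrm hA n u u' j t‖ ^ 2 ≤ B := by
    intro t ht j hj
    refine (hW.norm_nrm_traj_le hA η hj t).trans ?_
    rw [hBdef, ← mul_pow]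
    exact pow_le_pow_left₀ (norm_nonneg _) (hMb t ht η) 2
  have hen : ∀ t, Cascade.energy A 1 (HSp.val (u k t)) (HSp.val (u' k t))
      = ‖hW.nrm hA n u u' k t‖ ^ 2 / 2 := by
    intro t
    have e := hW.energy_one hA ((hW.equiv hA 2).symm (u k t)) ((hW.equiv hA 1).symm (u' k t))
    rw [LinearIsometryEquiv.apply_symm_apply, LinearIsometryEquiv.apply_symm_apply] at e
    rw [e, IsRoot.nrm, show n - k = 0 by omega]; rfl
  have hB0 : 0 ≤ B := by positivity
  have hsol := hW.isCascadeSol_traj hA hn C T η k hk'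
  refine (h _ _ _ hsol).trans ?_
  rw [mul_assoc]
  refine mul_le_mul_of_nonneg_left ?_ hD.le
  have e0 := hB 0 ⟨le_rfl, hT.le⟩ k hk'
  have eT := hB T ⟨hT.le, le_rfl⟩ k hk'
  have e1 : ∫ t in (0 : ℝ)..T, Cascade.energy A 1 (HSp.val (u k t)) (HSp.val (u' k t)) ≤ B / 2 * T :=
    integral_le_const_mul hT.le (fun t => by rw [hen]; positivity) fun t ht => by
      rw [hen]; linarith [hB t ht k hk']
  have e2 : ∫ t in (0 : ℝ)..T, ‖-coupling n C (fun k => HSp.val (u k t)) k‖ ^ 2 ≤ F * B * T :=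
    integral_le_const_mul hT.le (fun t => by positivity) fun t ht => by
      rw [norm_neg]; exact hFb u u' t B (hB t ht)
  rw [hen, hen]
  have e3 : (1 + T / 2 + F * T) * M ^ 2 * ‖W.weightPh n p 0 ((W.pi _).J η)‖ ^ 2
      = B + B / 2 * T + F * B * T := by rw [hBdef]; ring
  rw [e3]
  linarith

end Admissibility

theorem weightPh_one_fst_coe (x : Ph (Pw (Idx n p) H)) {k : Idx n p} (hk : n ≤ k) :
    (W.weightPh n p 1 ((W.pi _).J x)).fst k = -W.S (W.S (x.snd k)) := by
  rw [weightPh_fst, weight_apply, J_fst, show n - (k : ℕ) + 1 = 1 by omega, pow_one,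
    PiLp.neg_apply, pi_S_apply, map_neg]

/-- Time integration of strong solutions. -/
theorem exists_primitive (hn : 2 ≤ n) (C : ℕ → ℕ → H →L[ℝ] H) (η : Ph (Pw (Idx n p) H)) :
    ∃ ζ, ζ + pert ((couplingOp n p C).comp (W.pi _).S) ((W.pi _).J ζ) = (W.pi _).J η := by
  obtain ⟨q, hq⟩ := exists_add_coupling hn C (W.S.comp W.S) ((W.pi (Idx n p)).J η).snd
  refine ⟨ph ((W.pi (Idx n p)).J η).fst q, Ph.ext ?_ ?_⟩
  · rw [WithLp.add_fst, pert_fst, add_zero]; rfl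
  · have e : ((W.pi (Idx n p)).J (ph ((W.pi (Idx n p)).J η).fst q)).fst = -(W.pi (Idx n p)).S q :=
      J_fst _ _
    rw [WithLp.add_snd, pert_snd, e, ← hq, map_neg, neg_neg]
    rfl

/-- The full generator sends `J ζ` to `J η`, and the perturbation has no first entry. So the
velocity of the solution attached to `ζ` is the position of the one attached to `η`: the former is a
time primitive of the latter. -/
theorem traj_primitive {η ζ : Ph (Pw (Idx n p) H)}
    (h : ζ + pert ((couplingOp n p C).comp (W.pi _).S) ((W.pi _).J ζ) = (W.pi _).J η) (t : ℝ)
    (k : Idx n p) : (W.traj n p C t ζ).fst k = W.S (W.posn n p C t k η) := by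
  have e : (W.traj n p C t ζ).fst = ((W.pi _).J (W.traj n p C t η)).fst := by
    rw [traj, smooth_apply, h, evol_J, WithLp.sub_fst, pert_fst, sub_zero]
  rw [e, J_fst, posn_coe, map_neg, PiLp.neg_apply, pi_S_apply]

/-- Differentiation in time costs one power of `S`: `rot (J ζ) = Sph ζ` turns the weight `1` on `ζ`
into the weight `0` on `J ζ`, and the coupling term is bounded after intertwining. -/
theorem exists_norm_primitive_le {κ : Pw (Idx n p) H →L[ℝ] Pw (Idx n p) H}
    (hκ : ∀ x, W.weight n p 1 (couplingOp n p C ((W.pi _).S x)) = κ (W.weight n p 1 x)) :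
    ∃ c, 0 ≤ c ∧ ∀ η ζ : Ph (Pw (Idx n p) H),
      ζ + pert ((couplingOp n p C).comp (W.pi _).S) ((W.pi _).J ζ) = (W.pi _).J η →
        ‖W.weightPh n p 1 ((W.pi _).J η)‖ ≤ c * ‖W.weightPh n p 0 ((W.pi _).J ζ)‖ := by
  refine ⟨1 + ‖pert κ‖ * ‖(W.pi (Idx n p)).Sph‖, by positivity, fun η ζ h => ?_⟩
  set y := W.weightPh n p 0 ((W.pi _).J ζ) with hy
  have e1 : W.weightPh n p 1 ζ = rot _ y := by
    rw [hy, ← weightPh_rot, rot_J, weightPh_Sph, weightPh_one]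
  have e2 : W.weightPh n p 1 (pert ((couplingOp n p C).comp (W.pi _).S) ((W.pi _).J ζ))
      = pert κ ((W.pi _).Sph y) := by
    rw [hy, ← weightPh_one]
    refine Ph.ext ?_ ?_
    · rw [weightPh_fst, pert_fst, pert_fst, map_zero]
    · rw [weightPh_snd, pert_snd, pert_snd, map_neg, weightPh_fst, ContinuousLinearMap.comp_apply,
        hκ]
  rw [← h, map_add, e1, e2, add_mul, one_mul]
  refine (norm_add_le _ _).trans (add_le_add (norm_rot y).le ?_)
  rw [mul_assoc]
  exact ((pert κ).le_opNorm _).trans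
    (mul_le_mul_of_nonneg_left ((W.pi (Idx n p)).Sph.le_opNorm y) (norm_nonneg _))

variable {G : ℕ → Type*} [∀ k, NormedAddCommGroup (G k)] [∀ k, InnerProductSpace ℝ (G k)]
  [∀ k, CompleteSpace (G k)]

/-- Observation and transposition both involve `B* w`, so the observability inequality is used as it
stands, at weight `e = 0`; admissibility comes from (A4). -/
theorem IsRoot.exists_control_unbounded (hW : W.IsRoot A) (hA : HypA1 A) (hn : 2 ≤ n)
    (hA2 : HypA2 A n C P) (hC : HypC A n p C) {B : ∀ k, G k →L[ℝ] StrongDual ℝ (HSp A 2)}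
    (h4 : ∀ k ∈ Finset.Icc n (n + p), HypA4 A (obsUnbounded (B k))) {Tstar T : ℝ} (hT0 : 0 < T)
    (hobs : IsObsTime A n p C (fun k => obsUnbounded (B k)) Tstar) (hT : Tstar < T)
    (Y₀ : Ph (Pw (Idx n p) H)) :
    ∃ v : ∀ k, ℝ → G k, (∀ k, MemLp (v k) 2) ∧
      (∃ Y : ℝ → Ph (Pw (Idx n p) H), ContinuousOn Y (Set.Icc 0 T) ∧ Y 0 = Y₀ ∧
        ∀ τ ∈ Set.Icc 0 T, ∀ η,
          inner ℝ (Y τ) (W.weightPh n p 0 ((W.pi _).J (W.traj n p C τ η)))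
            = inner ℝ Y₀ (W.weightPh n p 0 ((W.pi _).J η))
              + ∑ k ∈ Finset.Icc n (n + p), ∫ t in (0 : ℝ)..τ, inner ℝ (v k t)
                (adjointUnbounded (B k) (hW.equiv hA 2 (W.posn n p C t k η)))) ∧
      ∀ q, (∀ η, inner ℝ q (W.weightPh n p 0 ((W.pi _).J (W.traj n p C T η)))
          = inner ℝ Y₀ (W.weightPh n p 0 ((W.pi _).J η))
            + ∑ k ∈ Finset.Icc n (n + p), ∫ t in (0 : ℝ)..T, inner ℝ (v k t)
              (adjointUnbounded (B k) (hW.equiv hA 2 (W.posn n p C t k η)))) → q = 0 := by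
  obtain ⟨c, hc, h⟩ := hW.obs_le hA hn hT0.le hobs hT
  refine hW.exists_system_control hA hn hA2 hC (e := 0) zero_le_one
    (fun k => (adjointUnbounded (B k)).comp
      ((hW.equiv hA 2).toContinuousLinearEquiv : H →L[ℝ] HSp A 2)) hT0.le hc
    (fun η => (h η).trans_eq ?_) (fun k hk => ?_) Y₀
  · simp only [hW.comps_posn hA]
    rfl
  · obtain ⟨D, hD, hb⟩ := hW.exists_admissible hA hn hA2 hC hk (h4 k hk) hT0
    refine ⟨D, hD, fun η => ?_⟩
    have := hb η
    simp only [hW.comps_posn hA] at this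
    exact this

/-- Transposition pairs the control with `B* w`, observability is about `B* w'`. Working with time
primitives reconciles them and raises the weight to `e = 1`, whence the smoother state space. -/
theorem IsRoot.exists_control_bounded (hW : W.IsRoot A) (hA : HypA1 A) (hn : 2 ≤ n)
    (hA2 : HypA2 A n C P) (hC : HypC A n p C) {B : ∀ k, G k →L[ℝ] H} {Tstar T : ℝ} (hT0 : 0 < T)
    (hobs : IsObsTime A n p C (fun k => obsBounded A (B k)) Tstar) (hT : Tstar < T)
    (Y₀ : Ph (Pw (Idx n p) H)) :
    ∃ v : ∀ k, ℝ → G k, (∀ k, MemLp (v k) 2) ∧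
      (∃ Y : ℝ → Ph (Pw (Idx n p) H), ContinuousOn Y (Set.Icc 0 T) ∧ Y 0 = Y₀ ∧
        ∀ τ ∈ Set.Icc 0 T, ∀ η,
          inner ℝ (Y τ) (W.weightPh n p 1 ((W.pi _).J (W.traj n p C τ η)))
            = inner ℝ Y₀ (W.weightPh n p 1 ((W.pi _).J η))
              + ∑ k ∈ Finset.Icc n (n + p), ∫ t in (0 : ℝ)..τ, inner ℝ (v k t)
                (ContinuousLinearMap.adjoint (B k) (W.S (W.S (W.posn n p C t k η))))) ∧
      ∀ q, (∀ η, inner ℝ q (W.weightPh n p 1 ((W.pi _).J (W.traj n p C T η)))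
          = inner ℝ Y₀ (W.weightPh n p 1 ((W.pi _).J η))
            + ∑ k ∈ Finset.Icc n (n + p), ∫ t in (0 : ℝ)..T, inner ℝ (v k t)
              (ContinuousLinearMap.adjoint (B k) (W.S (W.S (W.posn n p C t k η))))) → q = 0 := by
  obtain ⟨c, hc, h⟩ := hW.obs_le hA hn hT0.le hobs hT
  obtain ⟨κ, hκ⟩ := hW.exists_intertwine hA hn hA2 hC (e := 1) le_rfl
  obtain ⟨b, hb, hbp⟩ := exists_norm_primitive_le hκ
  obtain ⟨M, hM, hMb⟩ := hW.exists_state_bound hA hn hA2 hC (e := 1) le_rfl T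
  refine hW.exists_system_control hA hn hA2 hC (e := 1) le_rfl
    (fun k => (ContinuousLinearMap.adjoint (B k)).comp (W.S.comp W.S)) hT0.le
    (c := b ^ 2 * c) (by positivity) (fun η => ?_) (fun k hk => ?_) Y₀
  · obtain ⟨ζ, hζ⟩ := exists_primitive (W := W) hn C η
    have h1 : ∀ k ∈ Finset.Icc n (n + p), ∀ t, obsBounded A (B k)
        (hW.comps hA 2 (fun t => -(W.traj n p C t ζ).snd) k t,
          HSp.val (hW.comps hA 1 (fun t => (W.traj n p C t ζ).fst) k t))
        = ContinuousLinearMap.adjoint (B k) (W.S (W.S (W.posn n p C t k η))) := by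
      intro k hk t
      obtain ⟨h1, h2⟩ := Finset.mem_Icc.mp hk
      have e := hW.comps_apply hA 1 (fun t => (W.traj n p C t ζ).fst)
        ⟨k, Finset.mem_Icc.mpr ⟨by omega, h2⟩⟩ t
      rw [traj_primitive hζ] at e
      change ContinuousLinearMap.adjoint (B k) (HSp.val _) = _
      rw [e, hW.val_equiv, pow_one]
    calc ‖W.weightPh n p 1 ((W.pi _).J η)‖ ^ 2
        ≤ (b * ‖W.weightPh n p 0 ((W.pi _).J ζ)‖) ^ 2 :=
          pow_le_pow_left₀ (norm_nonneg _) (hbp η ζ hζ) 2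
      _ = b ^ 2 * ‖W.weightPh n p 0 ((W.pi _).J ζ)‖ ^ 2 := mul_pow _ _ _
      _ ≤ b ^ 2 * (c * _) := mul_le_mul_of_nonneg_left (h ζ) (sq_nonneg b)
      _ = _ := by
        rw [mul_assoc]
        congr 2
        refine Finset.sum_congr rfl fun k hk => ?_
        simp only [h1 k hk]
        rfl
  -- Admissibility is direct here: for `k ≥ n` the weight exponent is `1`, so `w_k = S² α_k` is an
  -- entry of the weighted state and `B*` is bounded.
  · obtain ⟨h1, h2⟩ := Finset.mem_Icc.mp hk
    have hk' : k ∈ Idx n p := Finset.mem_Icc.mpr ⟨by omega, h2⟩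
    refine ⟨‖ContinuousLinearMap.adjoint (B k)‖ ^ 2 * M ^ 2 * T, by positivity, fun η => ?_⟩
    refine (integral_le_const_mul (c := ‖ContinuousLinearMap.adjoint (B k)‖ ^ 2 * M ^ 2
      * ‖W.weightPh n p 1 ((W.pi _).J η)‖ ^ 2) hT0.le (fun t => by positivity)
      fun t ht => ?_).trans_eq (by ring)
    have e1 : ‖W.S (W.S (W.posn n p C t k η))‖ ≤ M * ‖W.weightPh n p 1 ((W.pi _).J η)‖ := by
      have e := weightPh_one_fst_coe (W := W) (W.traj n p C t η) (k := ⟨k, hk'⟩) h1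
      rw [posn_coe t ⟨k, hk'⟩, map_neg, map_neg, ← e]
      exact ((PiLp.norm_apply_le _ _).trans (Ph.norm_fst_le _)).trans (hMb t ht η)
    calc ‖ContinuousLinearMap.adjoint (B k) (W.S (W.S (W.posn n p C t k η)))‖ ^ 2
        ≤ (‖ContinuousLinearMap.adjoint (B k)‖ * (M * ‖W.weightPh n p 1 ((W.pi _).J η)‖)) ^ 2 := by
          gcongr
          exact (ContinuousLinearMap.le_opNorm _ _).trans (by gcongr)
      _ = _ := by ring

end WaveGroup

end Cascade

/-! ### Identification of the state spaces and of the duality products. -/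

namespace Cascade

open MeasureTheory

namespace WaveGroup

variable {H : Type*} [NormedAddCommGroup H] [InnerProductSpace ℝ H] [CompleteSpace H]
  {W : WaveGroup H} {A : H →ₗ.[ℝ] H} {n p : ℕ} {C : ℕ → ℕ → H →L[ℝ] H} {P : ℕ → H →L[ℝ] H}

theorem pow_S (W : WaveGroup H) (k : ℕ) (x : H) : (W.S ^ k) (W.S x) = (W.S ^ (k + 1)) x := by
  rw [pow_succ, mul_apply_eq_comp]

theorem inner_pow_pow (W : WaveGroup H) (k l : ℕ) (x y : H) :
    inner ℝ ((W.S ^ k) x) ((W.S ^ l) y) = inner ℝ x ((W.S ^ (k + l)) y) := by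
  rw [W.pow_symm, pow_add, mul_apply_eq_comp]

theorem continuous_fst_apply (i : Idx n p) :
    Continuous fun x : Ph (Pw (Idx n p) H) => x.fst i :=
  (PiLp.proj (𝕜 := ℝ) 2 (fun _ : Idx n p => H) i).continuous.comp (WithLp.fstL 2 ℝ _ _).continuous

theorem continuous_snd_apply (i : Idx n p) :
    Continuous fun x : Ph (Pw (Idx n p) H) => x.snd i :=
  (PiLp.proj (𝕜 := ℝ) 2 (fun _ : Idx n p => H) i).continuous.comp (WithLp.sndL 2 ℝ _ _).continuous

/-- The state `y_i = -S^(n-i+1) x_{2,i}`, `y_i' = S^(n-i) x_{1,i}`. -/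
def IsRoot.stateBounded (hW : W.IsRoot A) (hA : HypA1 A) (x : Ph (Pw (Idx n p) H)) :
    StateBounded A n p :=
  (fun i => hW.equiv hA _ (-x.snd i), fun i => hW.equiv hA _ (x.fst i))

theorem IsRoot.continuous_stateBounded (hW : W.IsRoot A) (hA : HypA1 A) :
    Continuous (hW.stateBounded hA (n := n) (p := p)) :=
  (continuous_pi fun i => (hW.equiv hA _).continuous.comp (continuous_snd_apply i).neg).prodMk
    (continuous_pi fun i => (hW.equiv hA _).continuous.comp (continuous_fst_apply i))

theorem IsRoot.stateBounded_zero (hW : W.IsRoot A) (hA : HypA1 A) :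
    hW.stateBounded hA (0 : Ph (Pw (Idx n p) H)) = 0 := by
  refine Prod.ext (funext fun i => ?_) (funext fun i => ?_)
  · change hW.equiv hA _ (-0) = 0
    rw [neg_zero, map_zero]
  · exact map_zero (hW.equiv hA _)

theorem IsRoot.exists_stateBounded (hW : W.IsRoot A) (hA : HypA1 A) (Y : StateBounded A n p) :
    ∃ x, hW.stateBounded hA x = Y := by
  refine ⟨ph (WithLp.toLp 2 fun i => (hW.equiv hA _).symm (Y.2 i))
    (WithLp.toLp 2 fun i => -(hW.equiv hA _).symm (Y.1 i)),
    Prod.ext (funext fun i => ?_) (funext fun i => ?_)⟩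
  · change hW.equiv hA _ (- -(hW.equiv hA _).symm (Y.1 i)) = Y.1 i
    rw [neg_neg, LinearIsometryEquiv.apply_symm_apply]
  · exact (hW.equiv hA _).apply_symm_apply (Y.2 i)

theorem IsRoot.pairingBounded_eq (hW : W.IsRoot A) (hA : HypA1 A) (x η : Ph (Pw (Idx n p) H))
    {w : ℕ → HSp A 2} {w' : ℕ → HSp A 1} (hw : ∀ i : Idx n p, hW.equiv hA 2 (-η.snd i) = w i)
    (hw' : ∀ i : Idx n p, hW.equiv hA 1 (η.fst i) = w' i) :
    pairingBounded (hW.stateBounded hA x) w w'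
      = inner ℝ x (W.weightPh n p 1 ((W.pi _).J η)) := by
  rw [Ph.inner_def, PiLp.inner_apply, PiLp.inner_apply, pairingBounded, sub_eq_add_neg,
    ← Finset.sum_neg_distrib]
  congr 1
  · refine Finset.sum_congr rfl fun i _ => ?_
    rw [← hw, hW.val_equiv, weightPh_fst, weight_apply, J_fst, PiLp.neg_apply, pi_S_apply]
    change inner ℝ ((W.S ^ (n - (i : ℕ))) (x.fst i)) _ = _
    rw [inner_pow_pow, ← map_neg, pow_S]
  · refine Finset.sum_congr rfl fun i _ => ?_
    rw [← hw', hW.val_equiv, weightPh_snd, weight_apply, J_snd, pi_S_apply]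
    change -inner ℝ ((W.S ^ (n - (i : ℕ) + 1)) (-x.snd i)) _ = _
    rw [inner_pow_pow, pow_S, inner_neg_left, neg_neg]

theorem IsRoot.toOne_equiv (hW : W.IsRoot A) (hA : HypA1 A) (a : H) :
    HSp.toOne hA (hW.equiv hA 2 a) = hW.equiv hA 1 (W.S a) := by
  refine Subtype.ext ?_
  change (W.S ^ 2) a = (W.S ^ 1) (W.S a)
  rw [pow_S]

/-- The functional `S b ↦ ⟨a, b⟩` of `H_1`. -/
def IsRoot.functional (hW : W.IsRoot A) (hA : HypA1 A) (a : H) : StrongDual ℝ (HSp A 1) :=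
  (innerSL ℝ a).comp ((hW.equiv hA 1).symm.toContinuousLinearEquiv : HSp A 1 →L[ℝ] H)

theorem IsRoot.functional_equiv (hW : W.IsRoot A) (hA : HypA1 A) (a b : H) :
    hW.functional hA a (hW.equiv hA 1 b) = inner ℝ a b := by
  change inner ℝ a ((hW.equiv hA 1).symm (hW.equiv hA 1 b)) = _
  rw [LinearIsometryEquiv.symm_apply_apply]

theorem IsRoot.continuous_functional (hW : W.IsRoot A) (hA : HypA1 A) :
    Continuous (hW.functional hA) :=
  (innerSL ℝ (E := H)).continuous.clm_comp continuous_const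

theorem IsRoot.exists_functional (hW : W.IsRoot A) (hA : HypA1 A) (f : StrongDual ℝ (HSp A 1)) :
    ∃ a, hW.functional hA a = f := by
  refine ⟨(InnerProductSpace.toDual ℝ H).symm
    (f.comp ((hW.equiv hA 1).toContinuousLinearEquiv : H →L[ℝ] HSp A 1)),
    ContinuousLinearMap.ext fun u => ?_⟩
  obtain ⟨b, rfl⟩ := (hW.equiv hA 1).surjective u
  rw [hW.functional_equiv, InnerProductSpace.toDual_symm_apply]
  rfl

/-- An index of the first `n - 1` components, as an index of the cascade. -/
def idxLow {n p : ℕ} (i : Finset.Icc 1 (n - 1)) : Idx n p :=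
  ⟨i, Finset.mem_Icc.mpr
    ⟨(Finset.mem_Icc.mp i.2).1, by have := (Finset.mem_Icc.mp i.2).2; omega⟩⟩

/-- An index of the last `p + 1` components, as an index of the cascade. -/
def idxHigh {n p : ℕ} (hn : 2 ≤ n) (i : Finset.Icc n (n + p)) : Idx n p :=
  ⟨i, Finset.mem_Icc.mpr
    ⟨by have := (Finset.mem_Icc.mp i.2).1; omega, (Finset.mem_Icc.mp i.2).2⟩⟩

theorem sum_idx {n p : ℕ} (hn : 2 ≤ n) (f : Idx n p → ℝ) :
    ∑ i, f i = ∑ i, f (idxLow i) + ∑ i, f (idxHigh hn i) := by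
  set g : ℕ → ℝ := fun i => if h : i ∈ Idx n p then f ⟨i, h⟩ else 0
  have hg : ∀ i : Idx n p, f i = g i := fun i => by
    simp only [g]; rw [dif_pos i.2]
  simp only [hg]
  refine (Finset.sum_coe_sort (Idx n p) g).trans (Eq.trans ?_ (congrArg₂ (· + ·)
    (Finset.sum_coe_sort (Finset.Icc 1 (n - 1)) g)
    (Finset.sum_coe_sort (Finset.Icc n (n + p)) g)).symm)
  rw [← Finset.sum_union (Finset.disjoint_left.mpr fun i h1 h2 => by
    have := (Finset.mem_Icc.mp h1).2; have := (Finset.mem_Icc.mp h2).1; omega)]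
  congr 1
  ext i
  simp only [Finset.mem_union, Finset.mem_Icc]
  omega

/-- The state `y_i = -S^(n-i) x_{2,i}` for all `i`, `y_i' = S^(n-1-i) x_{1,i}` for `i ≤ n - 1`,
and `y_i'` the functional `S b ↦ ⟨x_{1,i}, b⟩` for `i ≥ n`. -/
def IsRoot.stateUnbounded (hW : W.IsRoot A) (hA : HypA1 A) (hn : 2 ≤ n)
    (x : Ph (Pw (Idx n p) H)) : StateUnbounded A n p :=
  (fun i => hW.equiv hA _ (-x.snd i),
    fun i => hW.equiv hA _ (x.fst (idxLow i)), fun i => hW.functional hA (x.fst (idxHigh hn i)))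

theorem IsRoot.continuous_stateUnbounded (hW : W.IsRoot A) (hA : HypA1 A) (hn : 2 ≤ n) :
    Continuous (hW.stateUnbounded hA hn (p := p)) :=
  (continuous_pi fun i => (hW.equiv hA _).continuous.comp (continuous_snd_apply i).neg).prodMk
    ((continuous_pi fun i => (hW.equiv hA _).continuous.comp
      (continuous_fst_apply (idxLow i))).prodMk
      (continuous_pi fun i => (hW.continuous_functional hA).comp
        (continuous_fst_apply (idxHigh hn i))))

theorem IsRoot.stateUnbounded_zero (hW : W.IsRoot A) (hA : HypA1 A) (hn : 2 ≤ n) :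
    hW.stateUnbounded hA hn (0 : Ph (Pw (Idx n p) H)) = 0 := by
  refine Prod.ext (funext fun i => ?_) (Prod.ext (funext fun i => ?_) (funext fun i => ?_))
  · change hW.equiv hA _ (-0) = 0
    rw [neg_zero, map_zero]
  · exact map_zero (hW.equiv hA _)
  · change hW.functional hA 0 = 0
    rw [IsRoot.functional, map_zero, ContinuousLinearMap.zero_comp]

theorem IsRoot.exists_stateUnbounded (hW : W.IsRoot A) (hA : HypA1 A) (hn : 2 ≤ n)
    (Y : StateUnbounded A n p) : ∃ x, hW.stateUnbounded hA hn x = Y := by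
  choose a ha using fun i => hW.exists_functional hA (Y.2.2 i)
  refine ⟨ph (WithLp.toLp 2 fun i => if h : (i : ℕ) ∈ Finset.Icc 1 (n - 1) then
      (hW.equiv hA _).symm (Y.2.1 ⟨i, h⟩) else if h : (i : ℕ) ∈ Finset.Icc n (n + p) then
      a ⟨i, h⟩ else 0)
    (WithLp.toLp 2 fun i => -(hW.equiv hA _).symm (Y.1 i)),
    Prod.ext (funext fun i => ?_) (Prod.ext (funext fun i => ?_) (funext fun i => ?_))⟩
  · change hW.equiv hA _ (- -(hW.equiv hA _).symm (Y.1 i)) = Y.1 i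
    rw [neg_neg, LinearIsometryEquiv.apply_symm_apply]
  · change hW.equiv hA _ (dite _ _ _) = Y.2.1 i
    rw [dif_pos (show ((idxLow i : Idx n p) : ℕ) ∈ Finset.Icc 1 (n - 1) from i.2)]
    exact (hW.equiv hA _).apply_symm_apply (Y.2.1 i)
  · change hW.functional hA (dite _ _ _) = Y.2.2 i
    rw [dif_neg fun h => ?_,
      dif_pos (show ((idxHigh hn i : Idx n p) : ℕ) ∈ Finset.Icc n (n + p) from i.2)]
    · exact ha i
    · have h1 := (Finset.mem_Icc.mp h).2
      have h2 := (Finset.mem_Icc.mp i.2).1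
      simp only [idxHigh] at h1
      omega

theorem IsRoot.pairingUnbounded_eq (hW : W.IsRoot A) (hA : HypA1 A) (hn : 2 ≤ n)
    (x η : Ph (Pw (Idx n p) H)) {w : ℕ → HSp A 2} {w' : ℕ → HSp A 1}
    (hw : ∀ i : Idx n p, hW.equiv hA 2 (-η.snd i) = w i)
    (hw' : ∀ i : Idx n p, hW.equiv hA 1 (η.fst i) = w' i) :
    pairingUnbounded hA (hW.stateUnbounded hA hn x) w w'
      = inner ℝ x (W.weightPh n p 0 ((W.pi _).J η)) := by
  rw [Ph.inner_def, PiLp.inner_apply, PiLp.inner_apply, pairingUnbounded, sub_eq_add_neg,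
    ← Finset.sum_neg_distrib, sum_idx hn fun i => inner ℝ (x.fst i) _]
  refine congrArg₂ (· + ·) (congrArg₂ (· + ·) ?_ ?_) ?_
  · refine Finset.sum_congr rfl fun i _ => ?_
    have h1 := (Finset.mem_Icc.mp i.2).2
    rw [← show _ = w i from hw (idxLow i), hW.val_equiv, weightPh_fst, weight_apply, J_fst,
      PiLp.neg_apply, pi_S_apply]
    change inner ℝ ((W.S ^ (n - 1 - (i : ℕ))) (x.fst (idxLow i))) _
      = inner ℝ _ ((W.S ^ (n - (i : ℕ) + 0)) _)
    rw [inner_pow_pow, ← map_neg, pow_S]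
    congr 3
    omega
  · refine Finset.sum_congr rfl fun i _ => ?_
    have h1 := (Finset.mem_Icc.mp i.2).1
    rw [← show _ = w i from hw (idxHigh hn i), hW.toOne_equiv, weightPh_fst, weight_apply, J_fst,
      PiLp.neg_apply, pi_S_apply]
    change hW.functional hA (x.fst (idxHigh hn i)) _ = inner ℝ _ ((W.S ^ (n - (i : ℕ) + 0)) _)
    rw [hW.functional_equiv, show n - (i : ℕ) + 0 = 0 by omega, pow_zero, one_apply_eq_self, map_neg]
  · refine Finset.sum_congr rfl fun i _ => ?_
    rw [← hw', hW.val_equiv, weightPh_snd, weight_apply, J_snd, pi_S_apply]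
    change -inner ℝ ((W.S ^ (n - (i : ℕ))) (-x.snd i)) _ = _
    rw [inner_pow_pow, pow_S, inner_neg_left, neg_neg]

end WaveGroup

end Cascade

/-! ### Null controllability by transposition. -/

namespace Cascade

open MeasureTheory

namespace WaveGroup

variable {H : Type*} [NormedAddCommGroup H] [InnerProductSpace ℝ H] [CompleteSpace H]
  {W : WaveGroup H} {A : H →ₗ.[ℝ] H} {n p : ℕ} {C : ℕ → ℕ → H →L[ℝ] H} {P : ℕ → H →L[ℝ] H}

theorem IsRoot.equiv_posn (hW : W.IsRoot A) (hA : HypA1 A) {T : ℝ} {η : Ph (Pw (Idx n p) H)}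
    {w : ℕ → ℝ → HSp A 2} {w' : ℕ → ℝ → HSp A 1}
    (h : ∀ t ∈ Set.Icc 0 T, ∀ i : Idx n p, hW.equiv hA 2 (-(W.traj n p C t η).snd i) = w i t ∧
      hW.equiv hA 1 ((W.traj n p C t η).fst i) = w' i t) (hn : 2 ≤ n) {k : ℕ}
    (hk : k ∈ Finset.Icc n (n + p)) {t : ℝ} (ht : t ∈ Set.Icc 0 T) :
    hW.equiv hA 2 (W.posn n p C t k η) = w k t := by
  obtain ⟨h1, h2⟩ := Finset.mem_Icc.mp hk
  have hk' : k ∈ Idx n p := Finset.mem_Icc.mpr ⟨by omega, h2⟩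
  rw [posn_coe t ⟨k, hk'⟩]
  exact (h t ht ⟨k, hk'⟩).1

variable {G : ℕ → Type*} [∀ k, NormedAddCommGroup (G k)] [∀ k, InnerProductSpace ℝ (G k)]
  [∀ k, CompleteSpace (G k)]

/-- The transposition identity tested with the solutions parametrized by `η`. -/
theorem IsRoot.transposition_traj (hW : W.IsRoot A) (hA : HypA1 A) (hn : 2 ≤ n) {St : Type*}
    {pair : St → (ℕ → HSp A 2) → (ℕ → HSp A 1) → ℝ} {φ : Ph (Pw (Idx n p) H) → St} {e : ℕ}
    (hφ : ∀ x η w w', (∀ i : Idx n p, hW.equiv hA 2 (-η.snd i) = w i) →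
      (∀ i : Idx n p, hW.equiv hA 1 (η.fst i) = w' i) →
      pair (φ x) w w' = inner ℝ x (W.weightPh n p e ((W.pi _).J η)))
    (ob : ∀ k, HSp A 2 → G k) {v : ∀ k, ℝ → G k} {T τ : ℝ} (hτ : τ ∈ Set.Icc 0 T)
    {w : ℕ → ℝ → HSp A 2} {w' : ℕ → ℝ → HSp A 1} {η : Ph (Pw (Idx n p) H)}
    (h : ∀ t ∈ Set.Icc 0 T, ∀ i : Idx n p, hW.equiv hA 2 (-(W.traj n p C t η).snd i) = w i t ∧
      hW.equiv hA 1 ((W.traj n p C t η).fst i) = w' i t) (x x₀ : Ph (Pw (Idx n p) H)) :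
    (pair (φ x) (fun i => w i τ) (fun i => w' i τ)
        - pair (φ x₀) (fun i => w i 0) (fun i => w' i 0)
      = ∑ k ∈ Finset.Icc n (n + p), ∫ t in (0 : ℝ)..τ, inner ℝ (v k t) (ob k (w k t))) ↔
    inner ℝ x (W.weightPh n p e ((W.pi _).J (W.traj n p C τ η)))
      = inner ℝ x₀ (W.weightPh n p e ((W.pi _).J η)) + ∑ k ∈ Finset.Icc n (n + p),
        ∫ t in (0 : ℝ)..τ, inner ℝ (v k t) (ob k (hW.equiv hA 2 (W.posn n p C t k η))) := by
  have h0 : (0 : ℝ) ∈ Set.Icc 0 T := ⟨le_rfl, hτ.1.trans hτ.2⟩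
  have e1 := hφ x (W.traj n p C τ η) (fun i => w i τ) (fun i => w' i τ) (fun i => (h τ hτ i).1)
    fun i => (h τ hτ i).2
  have e2 := hφ x₀ (W.traj n p C 0 η) (fun i => w i 0) (fun i => w' i 0) (fun i => (h 0 h0 i).1)
    fun i => (h 0 h0 i).2
  have e3 : ∀ k ∈ Finset.Icc n (n + p), ∫ t in (0 : ℝ)..τ, inner ℝ (v k t) (ob k (w k t))
      = ∫ t in (0 : ℝ)..τ, inner ℝ (v k t) (ob k (hW.equiv hA 2 (W.posn n p C t k η))) := by
    intro k hk
    refine intervalIntegral.integral_congr fun t ht => ?_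
    rw [Set.uIcc_of_le hτ.1] at ht
    simp only [hW.equiv_posn hA h hn hk ⟨ht.1, ht.2.trans hτ.2⟩]
  rw [e1, e2, traj_zero, Finset.sum_congr rfl e3, sub_eq_iff_eq_add']

theorem IsRoot.comps_traj (hW : W.IsRoot A) (hA : HypA1 A) (η : Ph (Pw (Idx n p) H)) (t : ℝ)
    (i : Idx n p) :
    hW.equiv hA 2 (-(W.traj n p C t η).snd i)
        = hW.comps hA 2 (fun t => -(W.traj n p C t η).snd) i t ∧
      hW.equiv hA 1 ((W.traj n p C t η).fst i)
        = hW.comps hA 1 (fun t => (W.traj n p C t η).fst) i t :=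
  ⟨(hW.comps_apply hA 2 (fun t => -(W.traj n p C t η).snd) i t).symm,
    (hW.comps_apply hA 1 (fun t => (W.traj n p C t η).fst) i t).symm⟩

/-- Existence uses that every cascade solution is a trajectory of some `η`, the vanishing at `T`
that every trajectory is a cascade solution; the identification of states is onto, so nothing is
lost in either direction. -/
theorem IsRoot.null_controllable_bounded (hW : W.IsRoot A) (hA : HypA1 A) (hn : 2 ≤ n)
    (hA2 : HypA2 A n C P) (hC : HypC A n p C) {B : ∀ k, G k →L[ℝ] H} {Tstar T : ℝ} (hT0 : 0 < T)
    (hobs : IsObsTime A n p C (fun k => obsBounded A (B k)) Tstar) (hT : Tstar < T)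
    (Y₀ : StateBounded A n p) :
    ∃ v : ∀ k, ℝ → G k, (∀ k, MemLp (v k) 2) ∧
      (∃ Y, IsControlledBounded A n p C B T v Y₀ Y) ∧
      ∀ Y, IsControlledBounded A n p C B T v Y₀ Y → Y T = 0 := by
  obtain ⟨x₀, rfl⟩ := hW.exists_stateBounded hA Y₀
  obtain ⟨v, hv, ⟨Y, hYc, hY0, hY⟩, hfin⟩ :=
    hW.exists_control_bounded hA hn hA2 hC hT0 hobs hT x₀
  have hS : ∀ y : H, W.S (W.S y) = HSp.val (hW.equiv hA 2 y) := fun y => by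
    rw [hW.val_equiv, S_sq]
  simp only [hS] at hY hfin
  refine ⟨v, hv, ⟨fun t => hW.stateBounded hA (Y t),
    (hW.continuous_stateBounded hA).comp_continuousOn hYc, by rw [hY0], fun w w' h τ hτ => ?_⟩,
    fun Z hZ => ?_⟩
  · obtain ⟨η, hη⟩ := hW.exists_traj_eq hA hn h
    exact (hW.transposition_traj hA hn (fun x η w w' => hW.pairingBounded_eq hA x η)
      (fun k u => ContinuousLinearMap.adjoint (B k) (HSp.val u)) hτ hη (Y τ) x₀).mpr (hY τ hτ η)
  · obtain ⟨q, hq⟩ := hW.exists_stateBounded hA (Z T)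
    have hq0 : q = 0 := hfin q fun η => by
      have := hZ.transposition _ _ (hW.isCascadeSol_traj hA hn C T η) T ⟨hT0.le, le_rfl⟩
      rw [← hq] at this
      exact (hW.transposition_traj hA hn (fun x η w w' => hW.pairingBounded_eq hA x η)
        (fun k u => ContinuousLinearMap.adjoint (B k) (HSp.val u)) ⟨hT0.le, le_rfl⟩
        (fun t _ i => hW.comps_traj hA η t i) q x₀).mp this
    rw [← hq, hq0, hW.stateBounded_zero]

theorem IsRoot.null_controllable_unbounded (hW : W.IsRoot A) (hA : HypA1 A) (hn : 2 ≤ n)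
    (hA2 : HypA2 A n C P) (hC : HypC A n p C) {B : ∀ k, G k →L[ℝ] StrongDual ℝ (HSp A 2)}
    (h4 : ∀ k ∈ Finset.Icc n (n + p), HypA4 A (obsUnbounded (B k))) {Tstar T : ℝ} (hT0 : 0 < T)
    (hobs : IsObsTime A n p C (fun k => obsUnbounded (B k)) Tstar) (hT : Tstar < T)
    (Y₀ : StateUnbounded A n p) :
    ∃ v : ∀ k, ℝ → G k, (∀ k, MemLp (v k) 2) ∧
      (∃ Y, IsControlledUnbounded hA n p C B T v Y₀ Y) ∧
      ∀ Y, IsControlledUnbounded hA n p C B T v Y₀ Y → Y T = 0 := by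
  obtain ⟨x₀, rfl⟩ := hW.exists_stateUnbounded hA hn Y₀
  obtain ⟨v, hv, ⟨Y, hYc, hY0, hY⟩, hfin⟩ :=
    hW.exists_control_unbounded hA hn hA2 hC h4 hT0 hobs hT x₀
  refine ⟨v, hv, ⟨fun t => hW.stateUnbounded hA hn (Y t),
    (hW.continuous_stateUnbounded hA hn).comp_continuousOn hYc, by rw [hY0],
    fun w w' h τ hτ => ?_⟩, fun Z hZ => ?_⟩
  · obtain ⟨η, hη⟩ := hW.exists_traj_eq hA hn h
    exact (hW.transposition_traj hA hn (fun x η w w' => hW.pairingUnbounded_eq hA hn x η)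
      (fun k u => adjointUnbounded (B k) u) hτ hη (Y τ) x₀).mpr (hY τ hτ η)
  · obtain ⟨q, hq⟩ := hW.exists_stateUnbounded hA hn (Z T)
    have hq0 : q = 0 := hfin q fun η => by
      have := hZ.transposition _ _ (hW.isCascadeSol_traj hA hn C T η) T ⟨hT0.le, le_rfl⟩
      rw [← hq] at this
      exact (hW.transposition_traj hA hn (fun x η w w' => hW.pairingUnbounded_eq hA hn x η)
        (fun k u => adjointUnbounded (B k) u) ⟨hT0.le, le_rfl⟩
        (fun t _ i => hW.comps_traj hA η t i) q x₀).mp this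
    rw [← hq, hq0, hW.stateUnbounded_zero]

end WaveGroup

end Cascade

end

open Cascade MeasureTheory in
theorem theorem3p5 {H : Type*} [NormedAddCommGroup H] [InnerProductSpace ℝ H] [CompleteSpace H]
    {G : ℕ → Type*} [∀ k, NormedAddCommGroup (G k)] [∀ k, InnerProductSpace ℝ (G k)]
    [∀ k, CompleteSpace (G k)]
    (A : H →ₗ.[ℝ] H) (hA : HypA1 A) (n p : ℕ) (hn : 2 ≤ n) (hp : 1 ≤ p)
    (C : ℕ → ℕ → H →L[ℝ] H) (P : ℕ → H →L[ℝ] H)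
    (hA2 : HypA2 A n C P) (hA3 : HypA3 A n P) (hC : HypC A n p C) :
    (∀ B : ∀ k, G k →L[ℝ] H,
      (∀ k ∈ Finset.Icc n (n + p), HypA4 A (obsBounded A (B k)) ∧ HypA5 A (obsBounded A (B k))) →
      (∃ Tstar : ℝ, 0 < Tstar ∧ IsObsTime A n p C (fun k => obsBounded A (B k)) Tstar) ∧
      ∀ Tstar : ℝ, 0 < Tstar → IsObsTime A n p C (fun k => obsBounded A (B k)) Tstar →
        ∀ T > Tstar, ∀ Y₀ : StateBounded A n p, ∃ v : ∀ k, ℝ → G k,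
          (∀ k ∈ Finset.Icc n (n + p), MemLp (v k) 2 (volume.restrict (Set.Ioo 0 T))) ∧
          (∃ Y, IsControlledBounded A n p C B T v Y₀ Y) ∧
          ∀ Y, IsControlledBounded A n p C B T v Y₀ Y → Y T = 0) ∧
    (∀ B : ∀ k, G k →L[ℝ] StrongDual ℝ (HSp A 2),
      (∀ k ∈ Finset.Icc n (n + p), HypA4 A (obsUnbounded (B k)) ∧ HypA5 A (obsUnbounded (B k))) →
      (∃ Tstar : ℝ, 0 < Tstar ∧ IsObsTime A n p C (fun k => obsUnbounded (B k)) Tstar) ∧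
      ∀ Tstar : ℝ, 0 < Tstar → IsObsTime A n p C (fun k => obsUnbounded (B k)) Tstar →
        ∀ T > Tstar, ∀ Y₀ : StateUnbounded A n p, ∃ v : ∀ k, ℝ → G k,
          (∀ k ∈ Finset.Icc n (n + p), MemLp (v k) 2 (volume.restrict (Set.Ioo 0 T))) ∧
          (∃ Y, IsControlledUnbounded hA n p C B T v Y₀ Y) ∧
          ∀ Y, IsControlledUnbounded hA n p C B T v Y₀ Y → Y T = 0) := by
  obtain ⟨W, hW⟩ := hA.exists_waveGroup
  refine ⟨fun B hB => ⟨hW.exists_obsTime hA hn hA2 hA3 hB, fun Tstar h0 hobs T hT Y₀ => ?_⟩,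
    fun B hB => ⟨hW.exists_obsTime hA hn hA2 hA3 hB, fun Tstar h0 hobs T hT Y₀ => ?_⟩⟩
  · obtain ⟨v, hv, hY⟩ :=
      hW.null_controllable_bounded hA hn hA2 hC (h0.trans hT) hobs hT Y₀
    exact ⟨v, fun k _ => (hv k).restrict _, hY⟩
  · obtain ⟨v, hv, hY⟩ := hW.null_controllable_unbounded hA hn hA2 hC (fun k hk => (hB k hk).1)
      (h0.trans hT) hobs hT Y₀
    exact ⟨v, fun k _ => (hv k).restrict _, hY⟩
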